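/- A market consists of a finite simple directed graph $D=(V,A)$ (no loops or parallel arcs), a capacity $c(e)>0$, $c(e)\in\mathbb R$, for every arc $e\in A$, and, for every agent $v\in V$, a strict preference list of all agents $u$ with $(v,u)\in A$; write $t>_v u$ if $t$ precedes $u$ in the list of $v$. A (balanced) exchange $(\mathcal C,f)$ is a finite set $\mathcal C$ of directed cycles of $D$ with amounts $f(C)>0$ for $C\in\mathcal C$ such that $f(e):=\sum_{C\in\mathcal C,\,e\in C}f(C)\le c(e)$ for every $e\in A$. Agent $v$ with list $v_1,\dots,v_z$ prefers $(\mathcal C,f)$ to $(\mathcal C',f')$ if for some $k$ we have $f((v,v_i))=f'((v,v_i))$ for all $i<k$ and $f((v,v_k))>f'((v,v_k))$. An exchange dominates another one if some agent prefers the former and no agent prefers the latter; it is Pareto optimal if no exchange dominates it. Let $D'$ be the graph on $V$ with the arcs $e\in A$ such that $c(e)-f(e)>0$. The exchange $(\mathcal C,f)$ is maximal if $D'$ is acyclic, and trade-in-free if for no arc $(v,u)\in A$ with $f((v,u))>0$ there is a directed path $(v,t,\dots,u)$ in $D'$ with $t>_v u$. Corollary 1. There is a polynomial-time algorithm that, given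 a market and a maximal and trade-in-free exchange $(\mathcal C,f)$ in it (by a list of its cycles and their amounts), decides whether $(\mathcal C,f)$ is Pareto optimal; if it is, the algorithm returns $(\mathcal C,f)$, and if it is not, the algorithm returns a Pareto optimal exchange that dominates $(\mathcal C,f)$. Here the algorithm is a program of a unit-cost random access machine whose operations on natural numbers are addition, truncated subtraction and comparison, and whose operations on real numbers are addition, subtraction, multiplication by fixed rational constants and comparison; the number of its steps is bounded by a polynomial in the number of agents, plus the number of arcs, plus the total length of the listed cycles, plus the number of listed cycles. -/

import Mathlib

/-! ### Balanced exchange markets -/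

/-- A market on the agents `Fin n`: a finite simple directed graph (no loops, no parallel arcs;
antiparallel arcs are allowed) with positive real arc capacities, in which every agent `v` has a
strict preference list `pref v` of its out-neighbours, most preferred first.  The arcs are exactly
the pairs `(v, u)` with `u ∈ pref v`; values of `cap` off the arcs are irrelevant. -/
structure Market (n : ℕ) where
  pref : Fin n → List (Fin n)
  pref_nodup : ∀ v, (pref v).Nodup
  no_loop : ∀ v, v ∉ pref v
  cap : Fin n → Fin n → ℝ
  cap_pos : ∀ v u, u ∈ pref v → 0 < cap v u

namespace Market

variable {n : ℕ}

/-- `(v, u)` is an arc of the graph. -/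
def Arc (I : Market n) (v u : Fin n) : Prop := u ∈ I.pref v

/-- `t` strictly precedes `u` in the preference list of `v`. -/
def Precedes (I : Market n) (v t u : Fin n) : Prop :=
  ∃ i j : ℕ, i < j ∧ (I.pref v)[i]? = some t ∧ (I.pref v)[j]? = some u

end Market

/-- `C` is a directed cycle (without repeated vertices, of length at least two) of the digraph with
arc relation `r`. Cyclic lists of vertices are taken up to rotation. -/
def IsDicycle {n : ℕ} (r : Fin n → Fin n → Prop) (C : Cycle (Fin n)) : Prop :=
  C.Nodup ∧ C.Nontrivial ∧ C.Chain r

/-- The cycle `C` traverses the arc `(v, u)`. -/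
def CycleHasArc {n : ℕ} (C : Cycle (Fin n)) (v u : Fin n) : Prop :=
  ∃ l : List (Fin n), C = ((v :: u :: l : List (Fin n)) : Cycle (Fin n))

open Classical in
/-- The quantity sent over the arc `(v, u)`: the sum of `f C` over the cycles `C` of the packing
that traverse `(v, u)`. -/
noncomputable def arcFlow {n : ℕ} (packing : Finset (Cycle (Fin n))) (f : Cycle (Fin n) → ℝ)
    (v u : Fin n) : ℝ :=
  ∑ C ∈ packing.filter (fun C => CycleHasArc C v u), f C

/-- A (balanced) exchange: a finite set of directed cycles of the market with positive amounts that
respect all arc capacities. Values of `f` off the packing are irrelevant. -/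
structure Exchange {n : ℕ} (I : Market n) where
  packing : Finset (Cycle (Fin n))
  f : Cycle (Fin n) → ℝ
  isDicycle : ∀ C ∈ packing, IsDicycle I.Arc C
  f_pos : ∀ C ∈ packing, 0 < f C
  flow_le_cap : ∀ v u, I.Arc v u → arcFlow packing f v u ≤ I.cap v u

namespace Exchange

variable {n : ℕ} {I : Market n}

/-- The total quantity sent over the arc `(v, u)`. -/
noncomputable def flow (E : Exchange I) (v u : Fin n) : ℝ := arcFlow E.packing E.f v u

/-- Agent `v` strictly prefers `E` to `E'`: lexicographic comparison of the received quantities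
along the preference list of `v`. -/
def Prefers (v : Fin n) (E E' : Exchange I) : Prop :=
  ∃ (k : ℕ) (hk : k < (I.pref v).length),
    (∀ (i : ℕ) (hi : i < k),
      E.flow v ((I.pref v)[i]'(hi.trans hk)) = E'.flow v ((I.pref v)[i]'(hi.trans hk))) ∧
    E'.flow v (I.pref v)[k] < E.flow v (I.pref v)[k]

/-- `E` dominates `E'`: no agent strictly prefers `E'`, and some agent strictly prefers `E`. -/
def Dominates (E E' : Exchange I) : Prop :=
  (∀ v, ¬ Prefers v E' E) ∧ ∃ u, Prefers u E E'

/-- No exchange dominates `E`. -/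
def ParetoOptimal (E : Exchange I) : Prop := ∀ E' : Exchange I, ¬ E'.Dominates E

/-- The arcs of the residual graph: those with remaining capacity. -/
def ResArc (E : Exchange I) (v u : Fin n) : Prop := I.Arc v u ∧ 0 < I.cap v u - E.flow v u

/-- `E` is maximal: its residual graph is acyclic. -/
def Maximal (E : Exchange I) : Prop := ∀ C : Cycle (Fin n), ¬ IsDicycle E.ResArc C

/-- `E` is trade-in-free: for no arc `(v, u)` that is used by `E` there is a path
`(v, t, …, u)` in the residual graph such that `v` prefers `t` to `u`. -/
def TradeInFree (E : Exchange I) : Prop :=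
  ∀ v u, I.Arc v u → 0 < E.flow v u →
    ¬ ∃ (t : Fin n) (l : List (Fin n)), I.Precedes v t u ∧ (v :: t :: l).Nodup ∧
      (v :: t :: l).IsChain E.ResArc ∧ (v :: t :: l).getLast? = some u

/-- `L` is an explicit listing of `E`: it contains every cycle of the packing exactly once, as a
list of vertices starting anywhere on the cycle, together with its amount. -/
def ListedBy (E : Exchange I) (L : List (List (Fin n) × ℝ)) : Prop :=
  (L.map (fun x => (x.1 : Cycle (Fin n)))).Nodup ∧
  (∀ C, C ∈ E.packing ↔ ∃ x ∈ L, (x.1 : Cycle (Fin n)) = C) ∧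
  ∀ x ∈ L, E.f (x.1 : Cycle (Fin n)) = x.2

end Exchange

/-! ### The machine model

A random access machine with finitely many natural-number registers and arrays (for indices,
pointers and flags) and finitely many real registers and arrays, programmed in a structured
`while` language at unit cost.  The natural numbers are only added, subtracted (truncated) and
compared. The reals are only added, subtracted, multiplied by fixed rational constants of the
program, and compared: there is no multiplication or rounding.  Consequently, a polynomial number
of steps is polynomial time in the real-number model, and on rational data all numbers
keep polynomial length, so that it is also polynomial time on a Turing machine. -/

namespace RealRAM

/-- Memory contents: natural-number registers `nv` and two-index arrays `na`, real registers `rv`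
and two-index arrays `ra`; the first argument is the name of the register or array. -/
structure State where
  nv : ℕ → ℕ
  na : ℕ → ℕ → ℕ → ℕ
  rv : ℕ → ℝ
  ra : ℕ → ℕ → ℕ → ℝ

/-- Natural-number expressions. -/
inductive NExp where
  | const (k : ℕ)
  | var (x : ℕ)
  | get (a : ℕ) (i j : NExp)
  | add (e₁ e₂ : NExp)
  | sub (e₁ e₂ : NExp)

/-- Real expressions. -/
inductive RExp where
  | var (x : ℕ)
  | get (a : ℕ) (i j : NExp)
  | add (e₁ e₂ : RExp)
  | sub (e₁ e₂ : RExp)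
  | smul (q : ℚ) (e : RExp)

/-- Tests. -/
inductive BExp where
  | nle (e₁ e₂ : NExp)
  | rle (e₁ e₂ : RExp)
  | not (b : BExp)
  | and (b₁ b₂ : BExp)

def NExp.eval (σ : State) : NExp → ℕ
  | .const k => k
  | .var x => σ.nv x
  | .get a i j => σ.na a (i.eval σ) (j.eval σ)
  | .add e₁ e₂ => e₁.eval σ + e₂.eval σ
  | .sub e₁ e₂ => e₁.eval σ - e₂.eval σ

def RExp.eval (σ : State) : RExp → ℝ
  | .var x => σ.rv x
  | .get a i j => σ.ra a (i.eval σ) (j.eval σ)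
  | .add e₁ e₂ => e₁.eval σ + e₂.eval σ
  | .sub e₁ e₂ => e₁.eval σ - e₂.eval σ
  | .smul q e => (q : ℝ) * e.eval σ

def BExp.Holds (σ : State) : BExp → Prop
  | .nle e₁ e₂ => e₁.eval σ ≤ e₂.eval σ
  | .rle e₁ e₂ => e₁.eval σ ≤ e₂.eval σ
  | .not b => ¬ b.Holds σ
  | .and b₁ b₂ => b₁.Holds σ ∧ b₂.Holds σ

/-- Programs. -/
inductive Stmt where
  | skip
  | setNV (x : ℕ) (e : NExp)
  | setNA (a : ℕ) (i j : NExp) (e : NExp)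
  | setRV (x : ℕ) (e : RExp)
  | setRA (a : ℕ) (i j : NExp) (e : RExp)
  | seq (s₁ s₂ : Stmt)
  | ite (b : BExp) (s₁ s₂ : Stmt)
  | while (b : BExp) (s : Stmt)

/-- Overwrite one cell of a family of two-index arrays. -/
def upd {α : Type} (m : ℕ → ℕ → ℕ → α) (a i j : ℕ) (x : α) : ℕ → ℕ → ℕ → α :=
  fun a' i' j' => if a' = a ∧ i' = i ∧ j' = j then x else m a' i' j'

/-- `Exec s σ t σ'`: started in `σ`, the program `s` halts in `σ'` after exactly `t` steps. Every
assignment and every evaluation of a test is one step (the expressions in a program have a fixed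
length). -/
inductive Exec : Stmt → State → ℕ → State → Prop
  | skip (σ : State) : Exec .skip σ 1 σ
  | setNV (σ : State) (x : ℕ) (e : NExp) :
      Exec (.setNV x e) σ 1 { σ with nv := Function.update σ.nv x (e.eval σ) }
  | setNA (σ : State) (a : ℕ) (i j e : NExp) :
      Exec (.setNA a i j e) σ 1 { σ with na := upd σ.na a (i.eval σ) (j.eval σ) (e.eval σ) }
  | setRV (σ : State) (x : ℕ) (e : RExp) :
      Exec (.setRV x e) σ 1 { σ with rv := Function.update σ.rv x (e.eval σ) }
  | setRA (σ : State) (a : ℕ) (i j : NExp) (e : RExp) :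
      Exec (.setRA a i j e) σ 1 { σ with ra := upd σ.ra a (i.eval σ) (j.eval σ) (e.eval σ) }
  | seq {s₁ s₂ : Stmt} {σ σ' σ'' : State} {t₁ t₂ : ℕ} :
      Exec s₁ σ t₁ σ' → Exec s₂ σ' t₂ σ'' → Exec (.seq s₁ s₂) σ (t₁ + t₂) σ''
  | iteTrue {b : BExp} {s₁ s₂ : Stmt} {σ σ' : State} {t : ℕ} :
      b.Holds σ → Exec s₁ σ t σ' → Exec (.ite b s₁ s₂) σ (t + 1) σ'
  | iteFalse {b : BExp} {s₁ s₂ : Stmt} {σ σ' : State} {t : ℕ} :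
      ¬ b.Holds σ → Exec s₂ σ t σ' → Exec (.ite b s₁ s₂) σ (t + 1) σ'
  | whileTrue {b : BExp} {s : Stmt} {σ σ' σ'' : State} {t₁ t₂ : ℕ} :
      b.Holds σ → Exec s σ t₁ σ' → Exec (.while b s) σ' t₂ σ'' →
      Exec (.while b s) σ (t₁ + t₂ + 1) σ''
  | whileFalse {b : BExp} {s : Stmt} {σ : State} :
      ¬ b.Holds σ → Exec (.while b s) σ 1 σ

end RealRAM

/-! ### Input and output -/

/-- Input conventions.  Registers: `nv 0 = n`, `nv 1` = number of listed cycles.  Arrays: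
`na 0 v 0` = out-degree of `v`, `na 1 v i` = `i`-th entry of the preference list of `v`,
`na 2 k 0` = length of the `k`-th cycle, `na 3 k i` = its `i`-th vertex,
`ra 0 v u` = capacity of the arc `(v, u)`, `ra 1 k 0` = amount of the `k`-th cycle.
All other memory cells are `0`. -/
noncomputable def inputState {n : ℕ} (I : Market n) (L : List (List (Fin n) × ℝ)) :
    RealRAM.State where
  nv x := if x = 0 then n else if x = 1 then L.length else 0
  na a i j :=
    if a = 0 then (if h : i < n then (if j = 0 then (I.pref ⟨i, h⟩).length else 0) else 0)
    else if a = 1 then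
      (if h : i < n then (if hj : j < (I.pref ⟨i, h⟩).length
        then ((I.pref ⟨i, h⟩)[j] : Fin n).val else 0) else 0)
    else if a = 2 then (if h : i < L.length then (if j = 0 then L[i].1.length else 0) else 0)
    else if a = 3 then
      (if h : i < L.length then (if hj : j < L[i].1.length
        then (L[i].1[j] : Fin n).val else 0) else 0)
    else 0
  rv _ := 0
  ra a i j :=
    if a = 0 then
      (if h : i < n ∧ j < n then
        (if (⟨j, h.2⟩ : Fin n) ∈ I.pref ⟨i, h.1⟩ then I.cap ⟨i, h.1⟩ ⟨j, h.2⟩ else 0) else 0)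
    else if a = 1 then (if h : i < L.length then (if j = 0 then L[i].2 else 0) else 0)
    else 0

/-- Combinatorial size of the input: number of agents, plus number of arcs, plus, for every listed
cycle, its length and one amount. -/
def inputSize {n : ℕ} (I : Market n) (L : List (List (Fin n) × ℝ)) : ℕ :=
  n + ∑ v, (I.pref v).length + (L.map (fun x => x.1.length + 1)).sum

/-- The yes/no answer is left in register `nv 2`. -/
def answer (σ : RealRAM.State) : ℕ := σ.nv 2

/-- The listing `L` is left in the output area: `nv 3` = number of cycles, `na 4 k 0` = length of
the `k`-th cycle, `na 5 k i` = its `i`-th vertex, `ra 2 k 0` = its amount. -/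
def Outputs {n : ℕ} (σ : RealRAM.State) (L : List (List (Fin n) × ℝ)) : Prop :=
  σ.nv 3 = L.length ∧
  ∀ (k : ℕ) (hk : k < L.length),
    σ.na 4 k 0 = L[k].1.length ∧ σ.ra 2 k 0 = L[k].2 ∧
    ∀ (i : ℕ) (hi : i < L[k].1.length), σ.na 5 k i = (L[k].1[i] : Fin n).val

/-! Preferences see an exchange only through its arc flows. These form a circulation between zero
and the capacities (`Exchange.flow_feas`), and every such circulation splits into finitely many
distinct cycles (`decompose_spec`), so the whole problem concerns circulations. Let f be the given
one, and call h weakly better than f if no agent prefers f to h.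

Deciding. For each agent v let τ v count leading arcs of its list on which every weakly better h is
known to agree with f (`Frozen`). Such an h equals f on these arcs, is at least f on the next arc of
v, because a first difference there must be a gain, and obeys the capacities elsewhere
(`Frozen.bounds`). If f is already maximal on the next arc of some agent within these bounds, that
arc can be frozen too (`Frozen.succ`). Otherwise an augmenting path raises the flow on it, and
sending only half of the bottleneck preserves the strict gains made earlier on the next arcs of
other agents. In the end either all arcs are frozen, and f is Pareto optimal, or one circulation g
is strictly better than f on the next arc of every agent that still has one.

Improving. The values of g on these next arcs become lower bounds. Then the flow is maximized on one
arc after the other, down each list, and fixed at its maximum. The result h dominates f. If k is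
weakly better than h, it is weakly better than f, so the frozen values bind it, and on the next arcs
it is at least h; hence k obeys all the bounds. By lexicographic maximality k agrees with h on all
arcs, or some agent prefers h to k (`Market.SeqMax.step`, `Market.SeqMax.no_improvement`).

Time. Capacities are real, so the number of augmentations must not depend on them. Maximization uses
shortest augmenting paths: distances never decrease (`IsLabel.mono`), and a bounded integer
potential rises with every saturating augmentation (`Augmented.potential_lt`). Freezing happens at
most once per arc, with at most n agents visited in between, and every extracted cycle exhausts an
arc.

Memory. The real arrays 3, 4, 5 hold the current circulation and its lower and upper bounds, 6 holds
f, and 7 stays zero. The natural arrays 6 and 7 hold distances and predecessors, 8 holds τ, and 5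
holds the recorded paths. -/

/-! ### Reasoning about programs: frames and total correctness with time bounds -/

namespace RealRAM

/-- Sequential composition. -/
infixr:60 ";;" => Stmt.seq

def State.putNV (σ : State) (x k : ℕ) : State := { σ with nv := Function.update σ.nv x k }
def State.putNA (σ : State) (a i j k : ℕ) : State := { σ with na := upd σ.na a i j k }
def State.putRV (σ : State) (x : ℕ) (r : ℝ) : State := { σ with rv := Function.update σ.rv x r }
def State.putRA (σ : State) (a i j : ℕ) (r : ℝ) : State := { σ with ra := upd σ.ra a i j r }

/-! ### Effect of single assignments on the memory. -/

section put
variable (σ : State) (x y k a a' i i' j j' : ℕ) (r : ℝ)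

@[simp] theorem putNV_nv : (σ.putNV x k).nv y = if y = x then k else σ.nv y := by
  simp [State.putNV, Function.update_apply]
@[simp] theorem putNV_na : (σ.putNV x k).na = σ.na := rfl
@[simp] theorem putNV_rv : (σ.putNV x k).rv = σ.rv := rfl
@[simp] theorem putNV_ra : (σ.putNV x k).ra = σ.ra := rfl
@[simp] theorem putNA_nv : (σ.putNA a i j k).nv = σ.nv := rfl
@[simp] theorem putNA_na : (σ.putNA a i j k).na a' i' j' =
    if a' = a ∧ i' = i ∧ j' = j then k else σ.na a' i' j' := rfl
@[simp] theorem putNA_rv : (σ.putNA a i j k).rv = σ.rv := rfl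
@[simp] theorem putNA_ra : (σ.putNA a i j k).ra = σ.ra := rfl
@[simp] theorem putRV_nv : (σ.putRV x r).nv = σ.nv := rfl
@[simp] theorem putRV_na : (σ.putRV x r).na = σ.na := rfl
@[simp] theorem putRV_rv : (σ.putRV x r).rv y = if y = x then r else σ.rv y := by
  simp [State.putRV, Function.update_apply]
@[simp] theorem putRV_ra : (σ.putRV x r).ra = σ.ra := rfl
@[simp] theorem putRA_nv : (σ.putRA a i j r).nv = σ.nv := rfl
@[simp] theorem putRA_na : (σ.putRA a i j r).na = σ.na := rfl
@[simp] theorem putRA_rv : (σ.putRA a i j r).rv = σ.rv := rfl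
@[simp] theorem putRA_ra : (σ.putRA a i j r).ra a' i' j' =
    if a' = a ∧ i' = i ∧ j' = j then r else σ.ra a' i' j' := rfl

end put

attribute [simp] NExp.eval RExp.eval BExp.Holds

/-- The register `x` of natural numbers may be written by the program. -/
def Stmt.wrNV (x : ℕ) : Stmt → Bool
  | .setNV y _ => x == y
  | .seq s₁ s₂ => s₁.wrNV x || s₂.wrNV x
  | .ite _ s₁ s₂ => s₁.wrNV x || s₂.wrNV x
  | .while _ s => s.wrNV x
  | _ => false

/-- The array `x` of natural numbers may be written by the program. -/
def Stmt.wrNA (x : ℕ) : Stmt → Bool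
  | .setNA y _ _ _ => x == y
  | .seq s₁ s₂ => s₁.wrNA x || s₂.wrNA x
  | .ite _ s₁ s₂ => s₁.wrNA x || s₂.wrNA x
  | .while _ s => s.wrNA x
  | _ => false

/-- The real register `x` may be written by the program. -/
def Stmt.wrRV (x : ℕ) : Stmt → Bool
  | .setRV y _ => x == y
  | .seq s₁ s₂ => s₁.wrRV x || s₂.wrRV x
  | .ite _ s₁ s₂ => s₁.wrRV x || s₂.wrRV x
  | .while _ s => s.wrRV x
  | _ => false

/-- The real array `x` may be written by the program. -/
def Stmt.wrRA (x : ℕ) : Stmt → Bool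
  | .setRA y _ _ _ => x == y
  | .seq s₁ s₂ => s₁.wrRA x || s₂.wrRA x
  | .ite _ s₁ s₂ => s₁.wrRA x || s₂.wrRA x
  | .while _ s => s.wrRA x
  | _ => false

/-- `σ` and `σ'` agree on all registers and arrays that `s` does not write. -/
structure Frame (s : Stmt) (σ σ' : State) : Prop where
  nv : ∀ x, s.wrNV x = false → σ'.nv x = σ.nv x
  na : ∀ x, s.wrNA x = false → σ'.na x = σ.na x
  rv : ∀ x, s.wrRV x = false → σ'.rv x = σ.rv x
  ra : ∀ x, s.wrRA x = false → σ'.ra x = σ.ra x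

theorem Frame.refl (s : Stmt) (σ : State) : Frame s σ σ :=
  ⟨fun _ _ => rfl, fun _ _ => rfl, fun _ _ => rfl, fun _ _ => rfl⟩

theorem Frame.trans {s : Stmt} {σ σ' σ'' : State} (h : Frame s σ σ') (h' : Frame s σ' σ'') :
    Frame s σ σ'' :=
  ⟨fun x hx => (h'.nv x hx).trans (h.nv x hx), fun x hx => (h'.na x hx).trans (h.na x hx),
    fun x hx => (h'.rv x hx).trans (h.rv x hx), fun x hx => (h'.ra x hx).trans (h.ra x hx)⟩

/-- The program `s'` writes at most what `s` writes. -/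
structure Sub (s' s : Stmt) : Prop where
  nv : ∀ x, s.wrNV x = false → s'.wrNV x = false
  na : ∀ x, s.wrNA x = false → s'.wrNA x = false
  rv : ∀ x, s.wrRV x = false → s'.wrRV x = false
  ra : ∀ x, s.wrRA x = false → s'.wrRA x = false

theorem Frame.of_sub {s s' : Stmt} {σ σ' : State} (h : Frame s' σ σ') (hs : Sub s' s) :
    Frame s σ σ' :=
  ⟨fun x hx => h.nv x (hs.nv x hx), fun x hx => h.na x (hs.na x hx),
    fun x hx => h.rv x (hs.rv x hx), fun x hx => h.ra x (hs.ra x hx)⟩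

theorem Sub.seq_left (s₁ s₂ : Stmt) : Sub s₁ (s₁ ;; s₂) := by
  constructor <;> intro x <;> simp +contextual [Stmt.wrNV, Stmt.wrNA, Stmt.wrRV, Stmt.wrRA]

theorem Sub.seq_right (s₁ s₂ : Stmt) : Sub s₂ (s₁ ;; s₂) := by
  constructor <;> intro x <;> simp +contextual [Stmt.wrNV, Stmt.wrNA, Stmt.wrRV, Stmt.wrRA]

theorem Sub.ite_left (b : BExp) (s₁ s₂ : Stmt) : Sub s₁ (.ite b s₁ s₂) := by
  constructor <;> intro x <;> simp +contextual [Stmt.wrNV, Stmt.wrNA, Stmt.wrRV, Stmt.wrRA]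

theorem Sub.ite_right (b : BExp) (s₁ s₂ : Stmt) : Sub s₂ (.ite b s₁ s₂) := by
  constructor <;> intro x <;> simp +contextual [Stmt.wrNV, Stmt.wrNA, Stmt.wrRV, Stmt.wrRA]

theorem Sub.while_body (b : BExp) (s : Stmt) : Sub s (.while b s) :=
  ⟨fun _ h => h, fun _ h => h, fun _ h => h, fun _ h => h⟩

/-- Write sets are computed from the syntax, so a later claim that a register or an array is
unchanged reduces to a Boolean evaluation, usually closed by `rfl`. -/
theorem Exec.frame {s : Stmt} {σ σ' : State} {t : ℕ} (h : Exec s σ t σ') : Frame s σ σ' := by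
  induction h with
  | skip σ => exact Frame.refl _ _
  | setNV σ x e =>
    refine ⟨fun y hy => ?_, fun _ _ => rfl, fun _ _ => rfl, fun _ _ => rfl⟩
    exact Function.update_of_ne (by simpa [Stmt.wrNV] using hy) _ _
  | setNA σ a i j e =>
    refine ⟨fun _ _ => rfl, fun y hy => ?_, fun _ _ => rfl, fun _ _ => rfl⟩
    have : y ≠ a := by simpa [Stmt.wrNA] using hy
    funext i' j'
    simp [upd, this]
  | setRV σ x e =>
    refine ⟨fun _ _ => rfl, fun _ _ => rfl, fun y hy => ?_, fun _ _ => rfl⟩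
    exact Function.update_of_ne (by simpa [Stmt.wrRV] using hy) _ _
  | setRA σ a i j e =>
    refine ⟨fun _ _ => rfl, fun _ _ => rfl, fun _ _ => rfl, fun y hy => ?_⟩
    have : y ≠ a := by simpa [Stmt.wrRA] using hy
    funext i' j'
    simp [upd, this]
  | seq _ _ ih₁ ih₂ => exact (ih₁.of_sub (Sub.seq_left _ _)).trans (ih₂.of_sub (Sub.seq_right _ _))
  | iteTrue _ _ ih => exact ih.of_sub (Sub.ite_left _ _ _)
  | iteFalse _ _ ih => exact ih.of_sub (Sub.ite_right _ _ _)
  | whileTrue _ _ _ ih₁ ih₂ => exact (ih₁.of_sub (Sub.while_body _ _)).trans ih₂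
  | whileFalse _ => exact Frame.refl _ _

/-- Started in `σ`, the program `s` halts within `T` steps in a state satisfying `Q`. -/
def Runs (s : Stmt) (σ : State) (T : ℕ) (Q : State → Prop) : Prop :=
  ∃ t σ', Exec s σ t σ' ∧ t ≤ T ∧ Q σ'

/-! ### Rules for total correctness with time bounds. -/

namespace Runs

variable {s s₁ s₂ : Stmt} {σ : State} {T T' T₁ T₂ : ℕ} {Q Q' : State → Prop} {b : BExp}

theorem mono (h : Runs s σ T Q) (hT : T ≤ T') (hQ : ∀ σ', Frame s σ σ' → Q σ' → Q' σ') :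
    Runs s σ T' Q' := by
  obtain ⟨t, σ', he, ht, hq⟩ := h
  exact ⟨t, σ', he, ht.trans hT, hQ σ' he.frame hq⟩

theorem imp (h : Runs s σ T Q) (hQ : ∀ σ', Frame s σ σ' → Q σ' → Q' σ') : Runs s σ T Q' :=
  h.mono le_rfl hQ

theorem skip (h : Q σ) : Runs .skip σ 1 Q := ⟨1, σ, .skip σ, le_rfl, h⟩

theorem setNV {x : ℕ} {e : NExp} (h : Q (σ.putNV x (e.eval σ))) : Runs (.setNV x e) σ 1 Q :=
  ⟨1, _, .setNV σ x e, le_rfl, h⟩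

theorem setNA {a : ℕ} {i j e : NExp} (h : Q (σ.putNA a (i.eval σ) (j.eval σ) (e.eval σ))) :
    Runs (.setNA a i j e) σ 1 Q :=
  ⟨1, _, .setNA σ a i j e, le_rfl, h⟩

theorem setRV {x : ℕ} {e : RExp} (h : Q (σ.putRV x (e.eval σ))) : Runs (.setRV x e) σ 1 Q :=
  ⟨1, _, .setRV σ x e, le_rfl, h⟩

theorem setRA {a : ℕ} {i j : NExp} {e : RExp}
    (h : Q (σ.putRA a (i.eval σ) (j.eval σ) (e.eval σ))) : Runs (.setRA a i j e) σ 1 Q :=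
  ⟨1, _, .setRA σ a i j e, le_rfl, h⟩

/-- The second part is verified with the frame of the first at hand, so untouched memory need not be
repeated in intermediate assertions. -/
theorem seq (h : Runs s₁ σ T₁ (fun σ' => Frame s₁ σ σ' → Runs s₂ σ' T₂ Q)) :
    Runs (s₁ ;; s₂) σ (T₁ + T₂) Q := by
  obtain ⟨t₁, σ', h₁, ht₁, h'⟩ := h
  obtain ⟨t₂, σ'', h₂, ht₂, hq⟩ := h' h₁.frame
  exact ⟨t₁ + t₂, σ'', .seq h₁ h₂, add_le_add ht₁ ht₂, hq⟩

theorem setNV_seq {x : ℕ} {e : NExp} (h : Runs s (σ.putNV x (e.eval σ)) T Q) :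
    Runs (.setNV x e ;; s) σ (1 + T) Q :=
  seq (setNV fun _ => h)

theorem setNA_seq {a : ℕ} {i j e : NExp}
    (h : Runs s (σ.putNA a (i.eval σ) (j.eval σ) (e.eval σ)) T Q) :
    Runs (.setNA a i j e ;; s) σ (1 + T) Q :=
  seq (setNA fun _ => h)

theorem setRV_seq {x : ℕ} {e : RExp} (h : Runs s (σ.putRV x (e.eval σ)) T Q) :
    Runs (.setRV x e ;; s) σ (1 + T) Q :=
  seq (setRV fun _ => h)

theorem setRA_seq {a : ℕ} {i j : NExp} {e : RExp}
    (h : Runs s (σ.putRA a (i.eval σ) (j.eval σ) (e.eval σ)) T Q) :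
    Runs (.setRA a i j e ;; s) σ (1 + T) Q :=
  seq (setRA fun _ => h)

theorem ite (h₁ : b.Holds σ → Runs s₁ σ T₁ Q) (h₂ : ¬ b.Holds σ → Runs s₂ σ T₂ Q) :
    Runs (.ite b s₁ s₂) σ (max T₁ T₂ + 1) Q := by
  by_cases hb : b.Holds σ
  · obtain ⟨t, σ', he, ht, hq⟩ := h₁ hb
    exact ⟨t + 1, σ', .iteTrue hb he, by omega, hq⟩
  · obtain ⟨t, σ', he, ht, hq⟩ := h₂ hb
    exact ⟨t + 1, σ', .iteFalse hb he, by omega, hq⟩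

/-- Total correctness of a loop whose invariant carries a strictly decreasing counter. -/
theorem while_loop (J : ℕ → State → Prop) (k : ℕ) (h₀ : J k σ)
    (hstep : ∀ i ≤ k, ∀ σ', Frame (.while b s) σ σ' → J i σ' → b.Holds σ' →
      Runs s σ' T (fun σ'' => Frame s σ' σ'' → ∃ i' < i, J i' σ''))
    (hend : ∀ i ≤ k, ∀ σ', Frame (.while b s) σ σ' → J i σ' → ¬ b.Holds σ' → Q σ') :
    Runs (.while b s) σ (k * (T + 1) + 1) Q := by
  suffices H : ∀ i, i ≤ k → ∀ σ', Frame (.while b s) σ σ' → J i σ' →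
      Runs (.while b s) σ' (i * (T + 1) + 1) Q from H k le_rfl σ (Frame.refl _ _) h₀
  intro i
  induction i using Nat.strong_induction_on with
  | _ i ih =>
    intro hik σ' hF hJ
    by_cases hb : b.Holds σ'
    · obtain ⟨t₁, σ₁, he, ht, h₁⟩ := hstep i hik σ' hF hJ hb
      obtain ⟨i', hi', hJ'⟩ := h₁ he.frame
      obtain ⟨t₂, σ₂, he₂, ht₂, hq⟩ := ih i' hi' (hi'.le.trans hik) σ₁
        (hF.trans (he.frame.of_sub (Sub.while_body _ _))) hJ'
      refine ⟨t₁ + t₂ + 1, σ₂, .whileTrue hb he he₂, ?_, hq⟩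
      -- The counter drops by at least one, which pays for this round and its test.
      have : (i' + 1) * (T + 1) ≤ i * (T + 1) := Nat.mul_le_mul_right _ hi'
      rw [Nat.succ_mul] at this
      omega
    · exact ⟨1, σ', .whileFalse hb, by omega, hend i hik σ' hF hJ hb⟩

end Runs

/-- `for x < e do body`. -/
def forLoop (x : ℕ) (e : NExp) (body : Stmt) : Stmt :=
  .setNV x (.const 0) ;;
  .while (.not (.nle e (.var x))) (body ;; .setNV x (.add (.var x) (.const 1)))

/-- Time bound for a `for` loop with at most `B` rounds of at most `T` steps. -/
def forTime (B T : ℕ) : ℕ := 1 + (B * (T + 1 + 1) + 1)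

/-- The bound `e` is evaluated anew in each round, so `he` asks the invariant to fix its value. The
invariant for the next round is stated after the loop register has been incremented. The number of
remaining rounds is the counter for `while_loop`. -/
theorem Runs.for_loop {x : ℕ} {e : NExp} {body : Stmt} {σ : State} {T B : ℕ} {Q : State → Prop}
    (N : ℕ) (hN : N ≤ B) (J : ℕ → State → Prop) (hx : body.wrNV x = false)
    (h₀ : J 0 (σ.putNV x 0))
    (he : ∀ i σ', Frame (forLoop x e body) σ σ' → J i σ' → e.eval σ' = N)
    (hstep : ∀ i < N, ∀ σ', Frame (forLoop x e body) σ σ' → J i σ' → σ'.nv x = i →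
      Runs body σ' T (fun σ'' => Frame body σ' σ'' → J (i + 1) (σ''.putNV x (i + 1))))
    (hend : ∀ σ', Frame (forLoop x e body) σ σ' → J N σ' → Q σ') :
    Runs (forLoop x e body) σ (forTime B T) Q := by
  unfold forTime
  refine Runs.mono (T := 1 + (N * (T + 1 + 1) + 1)) ?_ (by gcongr) (fun _ _ h => h)
  unfold forLoop at *
  refine Runs.seq (Runs.setNV fun hF₀ => ?_)
  have hF₁ := hF₀.of_sub (Sub.seq_left _ (.while (.not (.nle e (.var x)))
    (body ;; .setNV x (.add (.var x) (.const 1)))))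
  refine Runs.while_loop
    (fun k σ' => k ≤ N ∧ σ'.nv x = N - k ∧ J (N - k) σ') N ?_ ?_ ?_
  · simpa using h₀
  · rintro k - σ' hF ⟨hk, hxk, hJ⟩ hb
    have hF' := hF₁.trans (hF.of_sub (Sub.seq_right _ _))
    have heN := he _ _ hF' hJ
    simp only [BExp.Holds, NExp.eval, heN, hxk, not_le] at hb
    refine Runs.seq ((hstep (N - k) hb σ' hF' hJ hxk).imp ?_)
    intro σ₁ hF₂ hJ₁ hF₃
    refine Runs.setNV fun hF₄ => ⟨k - 1, by omega, by omega, ?_, ?_⟩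
    · have := hF₃.nv x hx
      simp [this, hxk]; omega
    · have := hF₃.nv x hx
      simp only [NExp.eval, this, hxk]
      convert hJ₁ hF₃ using 1
      omega
  · rintro k - σ' hF ⟨hk, hxk, hJ⟩ hb
    have hF' := hF₁.trans (hF.of_sub (Sub.seq_right _ _))
    have heN := he _ _ hF' hJ
    simp only [BExp.Holds, NExp.eval, heN, hxk, not_le, not_lt] at hb
    have : k = 0 := by omega
    subst this
    exact hend σ' hF' hJ

end RealRAM

/-! ### Circulations, breadth-first labels and augmenting paths -/

namespace Flow

variable {n : ℕ}

/-- Conservation of flow at every vertex. -/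
def Circ (g : Fin n → Fin n → ℝ) : Prop := ∀ v, ∑ u, g v u = ∑ u, g u v

/-- Residual arcs of `g` with respect to the lower bounds `lo` and the upper bounds `hi`. -/
def Res (g lo hi : Fin n → Fin n → ℝ) (x y : Fin n) : Prop := g x y < hi x y ∨ lo y x < g y x

/-- `d` is the distance from `s` in the graph `R`, with `n` for the vertices out of reach, and `p`
gives the predecessor on a shortest path. -/
structure IsLabel (R : Fin n → Fin n → Prop) (s : Fin n) (d p : Fin n → ℕ) : Prop where
  source : d s = 0
  le : ∀ y, d y ≤ n
  step : ∀ x y, R x y → d y ≤ d x + 1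
  pred : ∀ y, d y < n → y = s ∨ ∃ x : Fin n, p y = x ∧ R x y ∧ d x + 1 = d y

/-- Predecessors lower the label by exactly one, so no level below a reached vertex is empty. -/
theorem IsLabel.exists_label_eq {R : Fin n → Fin n → Prop} {s : Fin n} {d p : Fin n → ℕ}
    (h : IsLabel R s d p) (j i : ℕ) (x : Fin n) (hx : d x < n) (hj : d x = j + i) :
    ∃ z, d z = j := by
  induction i generalizing x with
  | zero => exact ⟨x, by omega⟩
  | succ i ih =>
    rcases h.pred x hx with rfl | ⟨y, -, -, hy⟩
    · have := h.source; omega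
    · exact ih y (by omega) (by omega)

/-- The label n marks unreached vertices. If an arc led from a reached vertex to an unreached one,
the former would have label n - 1, and the n vertices would carry all n + 1 labels from 0 to n. -/
theorem IsLabel.lt_of_res {R : Fin n → Fin n → Prop} {s : Fin n} {d p : Fin n → ℕ}
    (h : IsLabel R s d p) {x y : Fin n} (hR : R x y) (hx : d x < n) : d y < n := by
  by_contra hy
  have h1 := h.step x y hR
  have h2 := h.le y
  have hsub : Finset.range (n + 1) ⊆ Finset.univ.image d := by
    intro j hj
    rw [Finset.mem_range] at hj
    rw [Finset.mem_image]
    by_cases hjn : j = n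
    · exact ⟨y, Finset.mem_univ _, by omega⟩
    · obtain ⟨z, hz⟩ := h.exists_label_eq j (d x - j) x hx (by omega)
      exact ⟨z, Finset.mem_univ _, hz⟩
  have := (Finset.card_le_card hsub).trans Finset.card_image_le
  simp at this

/-- Distances do not decrease if every new arc ascends by at most one level. -/
theorem IsLabel.mono {R R' : Fin n → Fin n → Prop} {s : Fin n} {d p d' p' : Fin n → ℕ}
    (h : IsLabel R s d p) (h' : IsLabel R' s d' p') (hR : ∀ x y, R' x y → d y ≤ d x + 1)
    (y : Fin n) : d y ≤ d' y := by
  induction hk : d' y using Nat.strong_induction_on generalizing y with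
  | _ k ih =>
    by_cases hy : d' y < n
    · rcases h'.pred y hy with rfl | ⟨x, -, hxy, hx⟩
      · rw [h.source]; omega
      · have := ih (d' x) (by omega) x rfl
        have := hR x y hxy
        omega
    · have := h.le y; omega

/-- `pt 0 = t, pt 1, …, pt (d t) = s` is a path traversed backwards, one level per step. -/
structure IsPath (R : Fin n → Fin n → Prop) (s t : Fin n) (d : Fin n → ℕ) (pt : ℕ → Fin n) :
    Prop where
  first : pt 0 = t
  last : pt (d t) = s
  label : ∀ i ≤ d t, d (pt i) + i = d t
  arc : ∀ i < d t, R (pt (i + 1)) (pt i)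

/-- Iterating the predecessor map from t lowers the label by one per step, so it meets s after d t
steps. Where the labels provide no predecessor the map takes an arbitrary value. -/
theorem IsLabel.exists_path {R : Fin n → Fin n → Prop} {s : Fin n} {d p : Fin n → ℕ}
    (h : IsLabel R s d p) {t : Fin n} (ht : d t < n) :
    ∃ pt : ℕ → Fin n, IsPath R s t d pt ∧ ∀ i < d t, p (pt i) = pt (i + 1) := by
  have hex : ∀ y : Fin n, ∃ x : Fin n, d y < n → y = s ∨ (p y = x ∧ R x y ∧ d x + 1 = d y) := by
    intro y
    by_cases hy : d y < n
    · rcases h.pred y hy with hs | ⟨x, hx⟩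
      · exact ⟨y, fun _ => .inl hs⟩
      · exact ⟨x, fun _ => .inr hx⟩
    · exact ⟨y, fun h => absurd h hy⟩
  choose q hq using hex
  have hlab : ∀ i ≤ d t, d (q^[i] t) + i = d t := by
    intro i
    induction i with
    | zero => simp
    | succ i ih =>
      intro hi
      have h1 := ih (by omega)
      rw [Function.iterate_succ_apply']
      rcases hq (q^[i] t) (by omega) with hs | ⟨-, -, h3⟩
      · rw [hs, h.source] at h1; omega
      · omega
  have hnot : ∀ i < d t, p (q^[i] t) = q^[i + 1] t ∧ R (q^[i + 1] t) (q^[i] t) := by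
    intro i hi
    have h1 := hlab i hi.le
    rw [Function.iterate_succ_apply']
    rcases hq (q^[i] t) (by omega) with hs | ⟨h2, h3, -⟩
    · rw [hs, h.source] at h1; omega
    · exact ⟨h2, h3⟩
  refine ⟨fun i => q^[i] t, ⟨rfl, ?_, hlab, fun i hi => (hnot i hi).2⟩, fun i hi => (hnot i hi).1⟩
  have h1 := hlab (d t) le_rfl
  rcases hq (q^[d t] t) (by omega) with hs | ⟨-, -, h3⟩
  · exact hs
  · omega

/-- The residual capacity of the arc that is used by a step from `x` to `y`. -/
noncomputable def resid (g lo hi : Fin n → Fin n → ℝ) (x y : Fin n) : ℝ :=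
  if g x y < hi x y then hi x y - g x y else g y x - lo y x

theorem resid_pos {g lo hi : Fin n → Fin n → ℝ} {x y : Fin n} (h : Res g lo hi x y) :
    0 < resid g lo hi x y := by
  unfold resid
  split_ifs with h1
  · linarith
  · rcases h with h | h
    · exact absurd h h1
    · linarith

/-- Send `δ` from `x` to `y`, on the arc `(x, y)` if it has room, else back on `(y, x)`. -/
noncomputable def push (hi : Fin n → Fin n → ℝ) (δ : ℝ) (g : Fin n → Fin n → ℝ) (x y : Fin n) :
    Fin n → Fin n → ℝ :=
  if g x y < hi x y then fun a b => if a = x ∧ b = y then g a b + δ else g a b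
  else fun a b => if a = y ∧ b = x then g a b - δ else g a b

/-- Send `δ` over the last `i` steps of a path. -/
noncomputable def pushes (hi : Fin n → Fin n → ℝ) (δ : ℝ) (pt : ℕ → Fin n)
    (g : Fin n → Fin n → ℝ) : ℕ → Fin n → Fin n → ℝ
  | 0 => g
  | i + 1 => push hi δ (pushes hi δ pt g i) (pt (i + 1)) (pt i)

/-- Flow out minus flow in. -/
def net (g : Fin n → Fin n → ℝ) (v : Fin n) : ℝ := ∑ u, g v u - ∑ u, g u v

theorem circ_iff_net {g : Fin n → Fin n → ℝ} : Circ g ↔ ∀ v, net g v = 0 := by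
  simp [Circ, net, sub_eq_zero]

theorem net_add_cell (g : Fin n → Fin n → ℝ) (x y : Fin n) (δ : ℝ) (v : Fin n) :
    net (fun a b => if a = x ∧ b = y then g a b + δ else g a b) v =
      net g v + (if v = x then δ else 0) - (if v = y then δ else 0) := by
  have h : ∀ a b, (if a = x ∧ b = y then g a b + δ else g a b) =
      g a b + (if a = x then (if b = y then δ else 0) else 0) := by
    intro a b; by_cases h1 : a = x <;> by_cases h2 : b = y <;> simp [h1, h2]
  simp only [net, h, Finset.sum_add_distrib]
  have h1 : ∑ u : Fin n, (if v = x then (if u = y then δ else 0) else 0) =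
      if v = x then δ else 0 := by split_ifs <;> simp
  have h2 : ∑ u : Fin n, (if u = x then (if v = y then δ else 0) else 0) =
      if v = y then δ else 0 := by simp
  rw [h1, h2]; ring

theorem net_push (hi : Fin n → Fin n → ℝ) (δ : ℝ) (g : Fin n → Fin n → ℝ) (x y v : Fin n) :
    net (push hi δ g x y) v = net g v + (if v = x then δ else 0) - (if v = y then δ else 0) := by
  unfold push
  split_ifs with h
  all_goals first
    | (rw [net_add_cell]; simp_all)
    | (simp only [sub_eq_add_neg]
       rw [net_add_cell]; split_ifs
       all_goals simp)

/-- The effect of an augmentation by `δ` on one cell, on a path with residual capacity `ρ`. -/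
def CellChange (g lo hi h : Fin n → Fin n → ℝ) (d : Fin n → ℕ) (δ ρ : ℝ) (a b : Fin n) :
    Prop :=
  h a b = g a b ∨
  (h a b = g a b + δ ∧ g a b < hi a b ∧ ρ ≤ hi a b - g a b ∧ d b = d a + 1) ∨
  (h a b = g a b - δ ∧ lo a b < g a b ∧ ρ ≤ g a b - lo a b ∧ d a = d b + 1)

/-! ### Effect of an augmentation on single cells. -/

section pushes

variable {g lo hi : Fin n → Fin n → ℝ} {s t : Fin n} {d : Fin n → ℕ} {pt : ℕ → Fin n} {δ ρ : ℝ}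

/-- The first i pushes all involve a vertex of level above d t - i. In particular each push still
finds the original flow between its two vertices. -/
theorem pushes_untouched (hp : IsPath (Res g lo hi) s t d pt) (i : ℕ) (hi' : i ≤ d t) (a b : Fin n)
    (ha : d a + i ≤ d t) (hb : d b + i ≤ d t) : pushes hi δ pt g i a b = g a b := by
  induction i with
  | zero => rfl
  | succ i ih =>
    have := ih (by omega) (by omega) (by omega)
    have hl := hp.label i (by omega)
    have h1 : a ≠ pt i := by rintro rfl; omega
    have h2 : b ≠ pt i := by rintro rfl; omega
    simp only [pushes, push]
    split_ifs <;> simp_all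

/-- When no arc has room above, every step runs backwards and the augmentation becomes an explicit
sum. Cycle extraction is of this kind. -/
theorem pushes_back (hp : IsPath (Res g lo hi) s t d pt) (hhi : ∀ a b, ¬ g a b < hi a b) (i : ℕ)
    (hit : i ≤ d t) (a b : Fin n) :
    pushes hi δ pt g i a b =
      g a b - ∑ j ∈ Finset.range i, if a = pt j ∧ b = pt (j + 1) then δ else 0 := by
  induction i with
  | zero => simp [pushes]
  | succ i ih =>
    have hl := hp.label i (by omega)
    have hl' := hp.label (i + 1) (by omega)
    have hu := pushes_untouched (δ := δ) hp i (by omega) (pt (i + 1)) (pt i) (by omega) (by omega)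
    rw [Finset.sum_range_succ, ← sub_sub, ← ih (by omega)]
    simp only [pushes, push, hu, hhi, if_false]
    split_ifs <;> simp

/-- Push i involves only the levels d t - i and d t - i - 1; a cell with an end above them has its
final value. -/
theorem pushes_later (hp : IsPath (Res g lo hi) s t d pt) (i : ℕ) (hit : i < d t) (a b : Fin n)
    (hab : d t < d a + i ∨ d t < d b + i) :
    pushes hi δ pt g (i + 1) a b = pushes hi δ pt g i a b := by
  have hl := hp.label i (by omega)
  have hl' := hp.label (i + 1) (by omega)
  have h1 : ¬ (a = pt (i + 1) ∧ b = pt i) := by rintro ⟨rfl, rfl⟩; omega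
  have h2 : ¬ (a = pt i ∧ b = pt (i + 1)) := by rintro ⟨rfl, rfl⟩; omega
  simp only [pushes, push]
  split_ifs <;> simp [h1, h2]

theorem net_pushes (hp : IsPath (Res g lo hi) s t d pt) (i : ℕ) (v : Fin n) :
    net (pushes hi δ pt g i) v =
      net g v + (if v = pt i then δ else 0) - (if v = t then δ else 0) := by
  induction i with
  | zero => simp [pushes, hp.first]
  | succ i ih => rw [pushes, net_push, ih]; ring

/-- Distinct steps lie between distinct pairs of levels, so a cell is changed at most once and a
single δ accounts for its total change. -/
theorem pushes_cell (hp : IsPath (Res g lo hi) s t d pt)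
    (hρ : ∀ i < d t, ρ ≤ resid g lo hi (pt (i + 1)) (pt i)) (i : ℕ) (hit : i ≤ d t) (a b : Fin n) :
    CellChange g lo hi (pushes hi δ pt g i) d δ ρ a b := by
  induction i with
  | zero => exact .inl rfl
  | succ i ih =>
    have hl := hp.label i (by omega)
    have hl' := hp.label (i + 1) (by omega)
    by_cases hab : d t < d a + i ∨ d t < d b + i
    · have := pushes_later (δ := δ) hp i (by omega) a b hab
      simpa only [CellChange, this] using ih (by omega)
    · push Not at hab
      have hu : ∀ a b, d a + i ≤ d t → d b + i ≤ d t → pushes hi δ pt g i a b = g a b :=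
        fun a b => pushes_untouched hp i (by omega) a b
      have h1 := hρ i (by omega)
      have hR := hp.arc i (by omega)
      simp only [CellChange, pushes, push]
      rw [hu _ _ (by omega) (by omega)]
      unfold resid at h1
      by_cases hlt : g (pt (i + 1)) (pt i) < hi (pt (i + 1)) (pt i)
      · simp only [hlt, if_true] at h1 ⊢
        by_cases hc : a = pt (i + 1) ∧ b = pt i
        · obtain ⟨rfl, rfl⟩ := hc
          refine .inr (.inl ⟨?_, hlt, h1, by omega⟩)
          simp [hu _ _ hab.1 hab.2]
        · left
          simp [hc, hu a b hab.1 hab.2]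
      · simp only [hlt, if_false] at h1 ⊢
        by_cases hc : a = pt i ∧ b = pt (i + 1)
        · obtain ⟨rfl, rfl⟩ := hc
          refine .inr (.inr ⟨?_, hR.resolve_left hlt, h1, by omega⟩)
          simp [hu _ _ hab.1 hab.2]
        · left
          simp [hc, hu a b hab.1 hab.2]

/-- Identifies the cell that is saturated by the step where the bottleneck is attained. -/
theorem pushes_used (hp : IsPath (Res g lo hi) s t d pt) (j : ℕ) (hj : j < d t) :
    (g (pt (j + 1)) (pt j) < hi (pt (j + 1)) (pt j) ∧
      pushes hi δ pt g (d t) (pt (j + 1)) (pt j) = g (pt (j + 1)) (pt j) + δ) ∨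
    (¬ g (pt (j + 1)) (pt j) < hi (pt (j + 1)) (pt j) ∧
      pushes hi δ pt g (d t) (pt j) (pt (j + 1)) = g (pt j) (pt (j + 1)) - δ) := by
  have hl := hp.label j (by omega)
  have hl' := hp.label (j + 1) (by omega)
  have hu : ∀ a b, d a + j ≤ d t → d b + j ≤ d t → pushes hi δ pt g j a b = g a b :=
    fun a b => pushes_untouched hp j (by omega) a b
  suffices H : ∀ i, i ≤ d t → j + 1 ≤ i →
      ((g (pt (j + 1)) (pt j) < hi (pt (j + 1)) (pt j) ∧
        pushes hi δ pt g i (pt (j + 1)) (pt j) = g (pt (j + 1)) (pt j) + δ) ∨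
      (¬ g (pt (j + 1)) (pt j) < hi (pt (j + 1)) (pt j) ∧
        pushes hi δ pt g i (pt j) (pt (j + 1)) = g (pt j) (pt (j + 1)) - δ)) from
    H (d t) le_rfl hj
  intro i hit hji
  induction i, hji using Nat.le_induction with
  | base =>
    simp only [pushes, push]
    rw [hu _ _ (by omega) (by omega)]
    by_cases hlt : g (pt (j + 1)) (pt j) < hi (pt (j + 1)) (pt j)
    · left; simp [hlt, hu (pt (j + 1)) (pt j) (by omega) (by omega)]
    · right; simp [hlt, hu (pt j) (pt (j + 1)) (by omega) (by omega)]
  | succ i hji ih =>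
    rw [pushes_later hp i (by omega) _ _ (by omega), pushes_later hp i (by omega) _ _ (by omega)]
    exact ih (by omega)

end pushes

/-- If no residual arc leaves a set that contains `s` but not `t`, then `g` is maximal on the arc
`(t, s)` among the circulations within the bounds. -/
theorem le_of_closed {g lo hi h : Fin n → Fin n → ℝ} {s t : Fin n} (S : Finset (Fin n))
    (hs : s ∈ S) (ht : t ∉ S) (hS : ∀ x ∈ S, ∀ y ∉ S, ¬ Res g lo hi x y) (hg : Circ g)
    (hh : Circ h) (hb : ∀ a b, ¬ (a = t ∧ b = s) → lo a b ≤ h a b ∧ h a b ≤ hi a b) :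
    h t s ≤ g t s := by
  -- The difference of two circulations has equal flow in both directions across the cut. Its
  -- outgoing cells are nonpositive and its incoming cells other than (t, s) are nonnegative, so the
  -- cell (t, s) is nonpositive.
  set D : Fin n → Fin n → ℝ := fun a b => h a b - g a b with hD
  have hDc : ∀ v, ∑ u, D v u - ∑ u, D u v = 0 := by
    intro v; simp only [hD, Finset.sum_sub_distrib]; have := hg v; have := hh v; linarith
  have hsplit : ∀ F : Fin n → ℝ, ∑ u, F u = ∑ u ∈ S, F u + ∑ u ∈ Sᶜ, F u :=
    fun F => (Finset.sum_add_sum_compl S F).symm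
  have hcut : ∑ x ∈ S, ∑ u ∈ Sᶜ, D x u - ∑ x ∈ S, ∑ u ∈ Sᶜ, D u x = 0 := by
    have h1 : ∑ x ∈ S, (∑ u, D x u - ∑ u, D u x) = 0 := Finset.sum_eq_zero fun x _ => hDc x
    simp only [hsplit, Finset.sum_sub_distrib, Finset.sum_add_distrib] at h1
    have h2 : ∑ x ∈ S, ∑ u ∈ S, D x u = ∑ x ∈ S, ∑ u ∈ S, D u x := Finset.sum_comm
    linarith
  have hout : ∑ x ∈ S, ∑ u ∈ Sᶜ, D x u ≤ 0 := by
    refine Finset.sum_nonpos fun x hx => Finset.sum_nonpos fun u hu => ?_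
    rw [Finset.mem_compl] at hu
    have h1 := hS x hx u hu
    have h2 := hb x u (by rintro ⟨rfl, rfl⟩; exact ht hx)
    simp only [Res, not_or, not_lt] at h1
    simp only [hD]; linarith
  have hin : D t s ≤ ∑ x ∈ S, ∑ u ∈ Sᶜ, D u x := by
    by_contra hcon
    push Not at hcon
    have hcell : ∀ x ∈ S, ∀ u ∈ Sᶜ, ¬ (u = t ∧ x = s) → 0 ≤ D u x := by
      intro x hx u hu hne
      rw [Finset.mem_compl] at hu
      have h1 := hS x hx u hu
      have h2 := hb u x hne
      simp only [Res, not_or, not_lt] at h1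
      simp only [hD]; linarith
    have hts : t ∈ Sᶜ := by simpa using ht
    rw [← Finset.add_sum_erase S _ hs, ← Finset.add_sum_erase Sᶜ _ hts] at hcon
    have h1 : 0 ≤ ∑ u ∈ Sᶜ.erase t, D u s := by
      refine Finset.sum_nonneg fun u hu => hcell s hs u (Finset.mem_of_mem_erase hu) ?_
      rintro ⟨rfl, -⟩; simp at hu
    have h2 : 0 ≤ ∑ x ∈ S.erase s, ∑ u ∈ Sᶜ, D u x := by
      refine Finset.sum_nonneg fun x hx => Finset.sum_nonneg fun u hu =>
        hcell x (Finset.mem_of_mem_erase hx) u hu ?_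
      rintro ⟨-, rfl⟩; simp at hx
    linarith
  simp only [hD] at hin
  linarith

/-- The reached vertices form the closed set. Since h is unconstrained on (t, s), this arc may be
frozen in the bounds while its maximum is being tested. -/
theorem IsLabel.maximal {g lo hi h : Fin n → Fin n → ℝ} {s t : Fin n} {d p : Fin n → ℕ}
    (hl : IsLabel (Res g lo hi) s d p) (ht : ¬ d t < n) (hg : Circ g) (hh : Circ h)
    (hb : ∀ a b, ¬ (a = t ∧ b = s) → lo a b ≤ h a b ∧ h a b ≤ hi a b) : h t s ≤ g t s := by
  refine le_of_closed (Finset.univ.filter fun x => d x < n) ?_ (by simpa using ht) ?_ hg hh hb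
  · have := hl.source; have := s.isLt; simp; omega
  · intro x hx y hy hR
    simp only [Finset.mem_filter, Finset.mem_univ, true_and] at hx hy
    exact hy (hl.lt_of_res hR hx)

/-! ### The potential of shortest augmenting paths -/

open Classical in
/-- Every arc with room above counts the level of its tail, otherwise that of its head, and
symmetrically for the room below. -/
noncomputable def potential (U D : Fin n → Fin n → Prop) (d : Fin n → ℕ) : ℕ :=
  ∑ a, ∑ b, ((if U a b then d a else d b) + (if D a b then d b else d a))

open Classical in
theorem potential_le (U D : Fin n → Fin n → Prop) (d : Fin n → ℕ) (hd : ∀ x, d x ≤ n) :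
    potential U D d ≤ n * (n * (n + n)) := by
  unfold potential
  have h : ∀ a b : Fin n, (if U a b then d a else d b) + (if D a b then d b else d a) ≤ n + n := by
    intro a b; have := hd a; have := hd b; split_ifs <;> omega
  calc _ ≤ ∑ a : Fin n, ∑ b : Fin n, (n + n) :=
        Finset.sum_le_sum fun a _ => Finset.sum_le_sum fun b _ => h a b
    _ = _ := by simp

theorem potential_mono {U D : Fin n → Fin n → Prop} {d d' : Fin n → ℕ} (h : ∀ x, d x ≤ d' x) :
    potential U D d ≤ potential U D d' := by
  unfold potential
  refine Finset.sum_le_sum fun a _ => Finset.sum_le_sum fun b _ => ?_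
  have := h a; have := h b
  split_ifs <;> omega

-- Under fixed labels, raising the flow on an arc (a, b) with d b = d a + 1 can move the first
-- summand only from d a to d b and brings the second to d b, so neither falls; saturation makes the
-- first one rise. Lowering the flow is symmetric.
open Classical in
theorem potential_lt {U D U' D' : Fin n → Fin n → Prop} {d : Fin n → ℕ}
    (hcell : ∀ a b, ((U' a b ↔ U a b) ∧ (D' a b ↔ D a b)) ∨
      (d b = d a + 1 ∧ U a b ∧ D' a b) ∨ (d a = d b + 1 ∧ D a b ∧ U' a b))
    (hsat : ∃ a b, (d b = d a + 1 ∧ U a b ∧ D' a b ∧ ¬ U' a b) ∨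
      (d a = d b + 1 ∧ D a b ∧ U' a b ∧ ¬ D' a b)) :
    potential U D d < potential U' D' d := by
  have hle : ∀ a b, (if U a b then d a else d b) + (if D a b then d b else d a) ≤
      (if U' a b then d a else d b) + (if D' a b then d b else d a) := by
    intro a b
    rcases hcell a b with ⟨h1, h2⟩ | ⟨h1, h2, h3⟩ | ⟨h1, h2, h3⟩
    · simp [h1, h2]
    · simp only [h2, h3, if_true]; split_ifs <;> omega
    · simp only [h2, h3, if_true]; split_ifs <;> omega
  obtain ⟨a, b, hab⟩ := hsat
  have hlt : (if U a b then d a else d b) + (if D a b then d b else d a) <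
      (if U' a b then d a else d b) + (if D' a b then d b else d a) := by
    rcases hab with ⟨h1, h2, h3, h4⟩ | ⟨h1, h2, h3, h4⟩
    · simp only [h2, h3, h4, if_true, if_false]; split_ifs <;> omega
    · simp only [h2, h3, h4, if_true, if_false]; split_ifs <;> omega
  unfold potential
  refine Finset.sum_lt_sum (fun a _ => Finset.sum_le_sum fun b _ => ?_)
    ⟨a, Finset.mem_univ _, Finset.sum_lt_sum (fun b _ => ?_) ⟨b, Finset.mem_univ _, ?_⟩⟩
  · exact hle _ _
  · exact hle _ _
  · exact hlt

end Flow

/-! ### Breadth-first search as a program -/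

open RealRAM Flow

namespace RealRAM

variable {n : ℕ}

/-- The real array `a` as a matrix. -/
def mat (n : ℕ) (σ : State) (a : ℕ) : Fin n → Fin n → ℝ := fun x y => σ.ra a x y

/-- The first column of the array `a` as a vector. -/
def vec (n : ℕ) (σ : State) (a : ℕ) : Fin n → ℕ := fun x => σ.na a x 0

theorem vec_putNA_same (σ : State) (a : ℕ) (y : Fin n) (k : ℕ) :
    vec n (σ.putNA a y 0 k) a = Function.update (vec n σ a) y k := by
  funext z
  simp [vec, Function.update_apply, Fin.ext_iff]

theorem vec_congr {σ σ' : State} {a : ℕ} (h : σ'.na a = σ.na a) : vec n σ' a = vec n σ a := by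
  funext z; simp [vec, h]

theorem mat_congr {σ σ' : State} {a : ℕ} (h : σ'.ra a = σ.ra a) : mat n σ' a = mat n σ a := by
  funext z w; simp [mat, h]

@[simp] theorem vec_putNV (σ : State) (x k a : ℕ) : vec n (σ.putNV x k) a = vec n σ a := rfl
@[simp] theorem mat_putNV (σ : State) (x k a : ℕ) : mat n (σ.putNV x k) a = mat n σ a := rfl
@[simp] theorem mat_putRV (σ : State) (x a : ℕ) (r : ℝ) : mat n (σ.putRV x r) a = mat n σ a := rfl
@[simp] theorem mat_putNA (σ : State) (b i j a k : ℕ) :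
    mat n (σ.putNA b i j k) a = mat n σ a := rfl

theorem vec_putNA_ne (σ : State) {a b : ℕ} (i j k : ℕ) (h : a ≠ b) :
    vec n (σ.putNA b i j k) a = vec n σ a := by
  funext z; simp [vec, h]

theorem mat_putRA_ne (σ : State) {a b : ℕ} (i j : ℕ) (r : ℝ) (h : a ≠ b) :
    mat n (σ.putRA b i j r) a = mat n σ a := by
  funext z w; simp [mat, h]

/-- Replace one entry of a matrix. -/
def setCell (g : Fin n → Fin n → ℝ) (x y : Fin n) (r : ℝ) : Fin n → Fin n → ℝ :=
  fun a b => if a = x ∧ b = y then r else g a b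

theorem mat_putRA_same (σ : State) (a : ℕ) (x y : Fin n) (r : ℝ) :
    mat n (σ.putRA a x y r) a = setCell (mat n σ a) x y r := by
  funext z w
  simp [mat, setCell, Fin.ext_iff]

/-- Test for a residual arc of array `3` with lower bounds in `4` and upper bounds in `5`. -/
def resTest (x y : NExp) : BExp :=
  .not (.and (.rle (.get 5 x y) (.get 3 x y)) (.rle (.get 3 y x) (.get 4 y x)))

theorem resTest_holds (σ : State) (e e' : NExp) (x y : Fin n) (hx : e.eval σ = x)
    (hy : e'.eval σ = y) :
    (resTest e e').Holds σ ↔ Res (mat n σ 3) (mat n σ 4) (mat n σ 5) x y := by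
  simp only [resTest, BExp.Holds, RExp.eval, hx, hy, Res, mat, not_and_or, not_le]

/-- One relaxation: the arc from register `7` to register `8` at level register `6`. -/
def relax : Stmt :=
  .ite (.and (.and (.nle (.get 6 (.var 7) (.const 0)) (.var 6))
      (.nle (.var 6) (.get 6 (.var 7) (.const 0))))
      (.and (.not (.nle (.get 6 (.var 8) (.const 0)) (.add (.var 6) (.const 1))))
        (resTest (.var 7) (.var 8))))
    (.setNA 6 (.var 8) (.const 0) (.add (.var 6) (.const 1)) ;;
      .setNA 7 (.var 8) (.const 0) (.var 7))
    .skip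

/-- Breadth-first search in the residual graph from the vertex in register `4`: distances in array
`6`, predecessors in array `7`. -/
def search : Stmt :=
  forLoop 7 (.var 0) (.setNA 6 (.var 7) (.const 0) (.var 0)) ;;
  .setNA 6 (.var 4) (.const 0) (.const 0) ;;
  forLoop 6 (.var 0) (forLoop 7 (.var 0) (forLoop 8 (.var 0) relax))

/-- State of the search before the arc `(x, y)` is examined at level `k`. -/
structure SearchInv (R : Fin n → Fin n → Prop) (s : Fin n) (d p : Fin n → ℕ) (k x y : ℕ) :
    Prop where
  source : d s = 0
  le : ∀ z, d z ≤ n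
  level : ∀ z, d z = n ∨ d z ≤ k + 1
  pred : ∀ z, d z < n → z = s ∨ ∃ x : Fin n, p z = x ∧ R x z ∧ d x + 1 = d z
  done : ∀ a b : Fin n, R a b → (d a < k ∨ d a = k ∧ ((a : ℕ) < x ∨ (a : ℕ) = x ∧ (b : ℕ) < y)) →
    d b ≤ d a + 1

/-! ### Preservation of the search invariant. -/

namespace SearchInv

variable {R : Fin n → Fin n → Prop} {s : Fin n} {d p : Fin n → ℕ} {k : ℕ}

theorem init (h0 : d s = 0) (h : ∀ z, z ≠ s → d z = n) : SearchInv R s d p 0 0 0 where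
  source := h0
  le z := by by_cases hz : z = s <;> simp [hz, h0, h]
  level z := by by_cases hz : z = s <;> simp [hz, h0, h]
  pred z hz := by
    by_cases hzs : z = s
    · exact .inl hzs
    · rw [h z hzs] at hz; omega
  done a b _ h := by omega

theorem relax_arc {x y : Fin n} (h : SearchInv R s d p k x y) (hx : d x = k) (hy : k + 1 < d y)
    (hR : R x y) :
    SearchInv R s (Function.update d y (k + 1)) (Function.update p y x) k x (y + 1) := by
  -- Labels are n or at most k + 1, so a label above k + 1 means that y was not reached before.
  have hyn : d y = n := by have := h.level y; omega
  have hys : y ≠ s := by rintro rfl; have := h.source; omega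
  have hxy : x ≠ y := by rintro rfl; omega
  refine ⟨?_, ?_, ?_, ?_, ?_⟩
  · rw [Function.update_of_ne hys.symm, h.source]
  · intro z
    rw [Function.update_apply]
    have := h.le z
    split_ifs <;> omega
  · intro z
    rw [Function.update_apply]
    have := h.level z
    split_ifs <;> omega
  · intro z hz
    by_cases hzy : z = y
    · subst hzy
      refine .inr ⟨x, by simp, hR, ?_⟩
      rw [Function.update_of_ne hxy, Function.update_self, hx]
    · rw [Function.update_of_ne hzy] at hz ⊢
      rcases h.pred z hz with hs | ⟨w, h1, h2, h3⟩
      · exact .inl hs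
      · have : w ≠ y := by rintro rfl; omega
        exact .inr ⟨w, h1, h2, by rw [Function.update_of_ne this, Function.update_of_ne hzy, h3]⟩
  · intro a b hab hdone
    -- The new label k + 1 lies above the current level, so no arc leaving y counts as done. A
    -- finished arc into y would have forced d y ≤ k + 1 already.
    by_cases hay : a = y
    · subst hay; simp only [Function.update_self] at hdone; omega
    · rw [Function.update_of_ne hay] at hdone ⊢
      by_cases hby : b = y
      · subst hby
        rw [Function.update_self]
        by_cases hax : a = x
        · subst hax; omega
        · have hax' : (a : ℕ) ≠ x := fun h => hax (Fin.ext h)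
          have := h.done a b hab (by omega)
          omega
      · rw [Function.update_of_ne hby]
        have hby' : (b : ℕ) ≠ y := fun h => hby (Fin.ext h)
        exact h.done a b hab (by omega)

theorem skip_arc {x y : Fin n} (h : SearchInv R s d p k x y)
    (hn : ¬ (d x = k ∧ k + 1 < d y ∧ R x y)) : SearchInv R s d p k x (y + 1) := by
  refine ⟨h.source, h.le, h.level, h.pred, fun a b hab hdone => ?_⟩
  by_cases hax : (a : ℕ) = x
  · by_cases hby : (b : ℕ) = y
    · obtain rfl : a = x := Fin.ext hax
      obtain rfl : b = y := Fin.ext hby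
      by_cases hk : d a = k
      · have : ¬ k + 1 < d b := fun h => hn ⟨hk, h, hab⟩
        omega
      · exact h.done a b hab (by omega)
    · exact h.done a b hab (by omega)
  · exact h.done a b hab (by omega)

theorem next_row {x : ℕ} (h : SearchInv R s d p k x n) : SearchInv R s d p k (x + 1) 0 :=
  ⟨h.source, h.le, h.level, h.pred, fun a b hab hd => h.done a b hab (by have := b.isLt; omega)⟩

theorem next_level (h : SearchInv R s d p k n 0) : SearchInv R s d p (k + 1) 0 0 :=
  ⟨h.source, h.le, fun z => by have := h.level z; omega, h.pred,
    fun a b hab hd => h.done a b hab (by have := a.isLt; omega)⟩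

/-- After the levels below n, every arc from a reached vertex is done; from an unreached vertex the
step condition is implied by labels being at most n. -/
theorem isLabel (h : SearchInv R s d p n 0 0) : IsLabel R s d p :=
  ⟨h.source, h.le, fun a b hab => by
    have h1 := h.le a
    have h2 := h.le b
    by_cases ha : d a < n
    · exact h.done a b hab (.inl ha)
    · omega, h.pred⟩

end SearchInv

theorem relax_spec {σ : State} {x y s : Fin n} {k : ℕ}
    (hk : σ.nv 6 = k) (hx : σ.nv 7 = x) (hy : σ.nv 8 = y)
    (h : SearchInv (Res (mat n σ 3) (mat n σ 4) (mat n σ 5)) s (vec n σ 6) (vec n σ 7) k x y) :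
    Runs relax σ 3 (fun σ' => SearchInv (Res (mat n σ 3) (mat n σ 4) (mat n σ 5)) s
      (vec n σ' 6) (vec n σ' 7) k x (y + 1)) := by
  have hb : ((BExp.and (.and (.nle (.get 6 (.var 7) (.const 0)) (.var 6))
      (.nle (.var 6) (.get 6 (.var 7) (.const 0))))
      (.and (.not (.nle (.get 6 (.var 8) (.const 0)) (.add (.var 6) (.const 1))))
        (resTest (.var 7) (.var 8)))).Holds σ) ↔
      (vec n σ 6 x = k ∧ k + 1 < vec n σ 6 y ∧
        Res (mat n σ 3) (mat n σ 4) (mat n σ 5) x y) := by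
    have hr := resTest_holds σ (.var 7) (.var 8) x y hx hy
    simp only [BExp.Holds, hr, NExp.eval, hk, hx, hy, vec, not_le, and_assoc]
    constructor
    · rintro ⟨h1, h2, h3⟩; exact ⟨by omega, h3⟩
    · rintro ⟨h1, h3⟩; exact ⟨by omega, by omega, h3⟩
  refine Runs.mono (T := max (1 + 1) 1 + 1) (Runs.ite (fun hh => ?_) (fun hh => ?_)) (by simp)
    (fun _ _ h => h)
  · obtain ⟨h1, h2, h3⟩ := hb.1 hh
    refine Runs.setNA_seq (Runs.setNA ?_)
    convert h.relax_arc h1 h2 h3 using 1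
    · simp only [NExp.eval, putNA_nv, hy, hx, hk]
      rw [vec_putNA_ne _ _ _ _ (by norm_num), vec_putNA_same]
    · simp only [NExp.eval, putNA_nv, hy, hx, hk]
      rw [vec_putNA_same, vec_putNA_ne _ _ _ _ (by norm_num)]
  · exact Runs.skip (h.skip_arc fun hc => hh (hb.2 hc))

def searchTime (B : ℕ) : ℕ :=
  forTime B 1 + (1 + forTime B (forTime B (forTime B 3)))

theorem search_spec {σ : State} {B : ℕ} (hB : n ≤ B) (hn : σ.nv 0 = n) (s : Fin n)
    (hs : σ.nv 4 = s) :
    Runs search σ (searchTime B) (fun σ' =>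
      IsLabel (Res (mat n σ 3) (mat n σ 4) (mat n σ 5)) s (vec n σ' 6) (vec n σ' 7)) := by
  refine Runs.seq ((Runs.for_loop (Q := fun σ' => ∀ z : Fin n, vec n σ' 6 z = n) n hB
    (fun i σ' => ∀ z : Fin n, (z : ℕ) < i → vec n σ' 6 z = n) rfl (by simp)
    (fun i σ' hF _ => by simp [hF.nv 0 rfl, hn]) ?_ ?_).imp ?_)
  · intro i hi σ' hF hJ hv
    refine Runs.setNA fun _ z hz => ?_
    have := hF.nv 0 rfl
    by_cases hzi : (z : ℕ) = i
    · simp [vec, hzi, hv, this, hn]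
    · have := hJ z (by omega)
      simpa [vec, hv, hzi] using this
  · exact fun σ' _ h z => h z z.isLt
  intro σ₁ hF₁ hall _
  refine Runs.setNA_seq ?_
  have hs₁ : σ₁.nv 4 = s := (hF₁.nv 4 rfl).trans hs
  have hn₁ : σ₁.nv 0 = n := (hF₁.nv 0 rfl).trans hn
  simp only [NExp.eval, hs₁]
  set σ₂ := σ₁.putNA 6 s 0 0 with hσ₂
  have hn₂ : σ₂.nv 0 = n := hn₁
  set R := Res (mat n σ 3) (mat n σ 4) (mat n σ 5) with hR
  have hR₂ : R = Res (mat n σ₂ 3) (mat n σ₂ 4) (mat n σ₂ 5) := by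
    rw [hR, ← mat_congr (hF₁.ra 3 rfl), ← mat_congr (hF₁.ra 4 rfl), ← mat_congr (hF₁.ra 5 rfl)]
    rfl
  have hinit : SearchInv R s (vec n σ₂ 6) (vec n σ₂ 7) 0 0 0 := by
    apply SearchInv.init
    · rw [hσ₂, vec_putNA_same, Function.update_self]
    · intro z hz
      rw [hσ₂, vec_putNA_same, Function.update_of_ne hz, hall z]
  refine Runs.for_loop n hB
    (fun k σ' => SearchInv R s (vec n σ' 6) (vec n σ' 7) k 0 0) rfl hinit
    (fun i σ' hF _ => by simp [hF.nv 0 rfl, hn₂]) ?_ (fun σ' _ h => h.isLabel)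
  intro k hk σ₃ hF₃ hJ₃ hv₃
  refine Runs.for_loop n hB
    (fun x σ' => SearchInv R s (vec n σ' 6) (vec n σ' 7) k x 0) rfl hJ₃
    (fun i σ' hF _ => by simp [hF.nv 0 rfl, hF₃.nv 0 rfl, hn₂]) ?_
    (fun σ' _ h _ => h.next_level)
  intro x hx σ₄ hF₄ hJ₄ hv₄
  refine Runs.for_loop n hB
    (fun y σ' => SearchInv R s (vec n σ' 6) (vec n σ' 7) k x y) rfl hJ₄
    (fun i σ' hF _ => by simp [hF.nv 0 rfl, hF₄.nv 0 rfl, hF₃.nv 0 rfl, hn₂]) ?_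
    (fun σ' _ h _ => h.next_row)
  intro y hy σ₅ hF₅ hJ₅ hv₅
  have hra : ∀ a, σ₅.ra a = σ₂.ra a := fun a =>
    ((hF₅.ra a rfl).trans (hF₄.ra a rfl)).trans (hF₃.ra a rfl)
  have hR₅ : R = Res (mat n σ₅ 3) (mat n σ₅ 4) (mat n σ₅ 5) := by
    rw [hR₂, mat_congr (hra 3), mat_congr (hra 4), mat_congr (hra 5)]
  rw [hR₅] at hJ₅ ⊢
  exact (relax_spec (x := ⟨x, hx⟩) (y := ⟨y, hy⟩)
    (((hF₅.nv 6 rfl).trans (hF₄.nv 6 rfl)).trans hv₃) ((hF₅.nv 7 rfl).trans hv₄) hv₅ hJ₅).imp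
    fun _ _ h _ => h

end RealRAM

/-! ### Augmentation as a program -/

namespace Flow

variable {n : ℕ}

/-- `h` arises from `g` by sending `δ` from `s` to `t` on a shortest residual path; `ρ` is the
minimum of `room` and of the residual capacity of the path. -/
structure Augmented (g lo hi h : Fin n → Fin n → ℝ) (s t : Fin n) (d : Fin n → ℕ)
    (room ρ δ : ℝ) : Prop where
  pos : 0 < ρ
  le : ρ ≤ room
  net : ∀ v, net h v = net g v + (if v = s then δ else 0) - (if v = t then δ else 0)
  cell : ∀ a b, CellChange g lo hi h d δ ρ a b
  sat : ρ = room ∨ ∃ a b,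
    (d b = d a + 1 ∧ g a b < hi a b ∧ ρ = hi a b - g a b ∧ h a b = g a b + δ) ∨
    (d a = d b + 1 ∧ lo a b < g a b ∧ ρ = g a b - lo a b ∧ h a b = g a b - δ)

theorem IsPath.augmented {g lo hi : Fin n → Fin n → ℝ} {s t : Fin n} {d : Fin n → ℕ}
    {pt : ℕ → Fin n} {room ρ : ℝ} (hp : IsPath (Res g lo hi) s t d pt) (δ : ℝ) (hroom : 0 < room)
    (hle : ρ ≤ room) (hρ : ∀ i < d t, ρ ≤ resid g lo hi (pt (i + 1)) (pt i))
    (hsat : ρ = room ∨ ∃ i < d t, ρ = resid g lo hi (pt (i + 1)) (pt i)) :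
    Augmented g lo hi (pushes hi δ pt g (d t)) s t d room ρ δ where
  pos := by
    rcases hsat with h | ⟨i, hi, h⟩
    · rwa [h]
    · rw [h]; exact resid_pos (hp.arc i hi)
  le := hle
  net v := by rw [net_pushes hp, hp.last]
  cell a b := pushes_cell hp hρ (d t) le_rfl a b
  sat := by
    refine hsat.imp_right ?_
    rintro ⟨i, hi', h⟩
    have hl := hp.label i (by omega)
    have hl' := hp.label (i + 1) (by omega)
    have hR := hp.arc i hi'
    unfold resid at h
    rcases pushes_used (δ := δ) hp i hi' with ⟨h1, h2⟩ | ⟨h1, h2⟩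
    · rw [if_pos h1] at h
      exact ⟨pt (i + 1), pt i, .inl ⟨by omega, h1, h, h2⟩⟩
    · rw [if_neg h1] at h
      exact ⟨pt i, pt (i + 1), .inr ⟨by omega, hR.resolve_left h1, h, h2⟩⟩

end Flow

namespace RealRAM

variable {n : ℕ}

/-- One step of `bottleneck`, from the vertex in register `9` to its predecessor. -/
def bottleneckStep : Stmt :=
  .setNA 5 (.var 3) (.var 10) (.var 9) ;;
  .setNV 11 (.get 7 (.var 9) (.const 0)) ;;
  .ite (.rle (.get 5 (.var 11) (.var 9)) (.get 3 (.var 11) (.var 9)))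
    (.setRV 1 (.sub (.get 3 (.var 9) (.var 11)) (.get 4 (.var 9) (.var 11))))
    (.setRV 1 (.sub (.get 5 (.var 11) (.var 9)) (.get 3 (.var 11) (.var 9)))) ;;
  .ite (.rle (.var 1) (.var 0)) (.setRV 0 (.var 1)) .skip ;;
  .setNV 9 (.var 11) ;;
  .setNV 10 (.add (.var 10) (.const 1))

/-- Walk back from the vertex in register `5` to the one in register `4`, write the path into the
row of array `5` given by register `3`, and lower the real register `0` to its residual
capacity. -/
def bottleneck : Stmt :=
  .setNV 9 (.var 5) ;; .setNV 10 (.const 0) ;;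
  .while (.not (.and (.nle (.var 9) (.var 4)) (.nle (.var 4) (.var 9)))) bottleneckStep ;;
  .setNA 5 (.var 3) (.var 10) (.var 9)

/-- Send the amount in the real register `0` along the recorded path. -/
def pushPath : Stmt :=
  forLoop 12 (.var 10)
    (.setNV 9 (.get 5 (.var 3) (.var 12)) ;;
    .setNV 11 (.get 5 (.var 3) (.add (.var 12) (.const 1))) ;;
    .ite (.rle (.get 5 (.var 11) (.var 9)) (.get 3 (.var 11) (.var 9)))
      (.setRA 3 (.var 9) (.var 11) (.sub (.get 3 (.var 9) (.var 11)) (.var 0)))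
      (.setRA 3 (.var 11) (.var 9) (.add (.get 3 (.var 11) (.var 9)) (.var 0))))

/-- Augment by `q` times the residual capacity. -/
def augment (q : ℚ) : Stmt :=
  bottleneck ;; .setRV 0 (.smul q (.var 0)) ;; pushPath

/-- The contents of the path register during `bottleneck`. -/
structure WalkInv (σ₀ : State) (g lo hi : Fin n → Fin n → ℝ) (pt : ℕ → Fin n) (i : ℕ)
    (σ : State) : Prop where
  cur : σ.nv 9 = pt i
  idx : σ.nv 10 = i
  path : ∀ j < i, σ.na 5 (σ₀.nv 3) j = pt j
  rows : ∀ r ≠ σ₀.nv 3, ∀ j, σ.na 5 r j = σ₀.na 5 r j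
  le : σ.rv 0 ≤ σ₀.rv 0
  min : ∀ j < i, σ.rv 0 ≤ resid g lo hi (pt (j + 1)) (pt j)
  sat : σ.rv 0 = σ₀.rv 0 ∨ ∃ j < i, σ.rv 0 = resid g lo hi (pt (j + 1)) (pt j)

theorem bottleneckStep_spec {σ₀ σ : State} {pt : ℕ → Fin n} {i : ℕ}
    (hpred : vec n σ 7 (pt i) = pt (i + 1)) (h3 : σ.nv 3 = σ₀.nv 3)
    (h : WalkInv σ₀ (mat n σ 3) (mat n σ 4) (mat n σ 5) pt i σ) :
    Runs bottleneckStep σ 8 (WalkInv σ₀ (mat n σ 3) (mat n σ 4) (mat n σ 5) pt (i + 1)) := by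
  have hx : σ.na 7 (pt i) 0 = pt (i + 1) := hpred
  -- Common tail of both branches, once the real register 1 holds the residual capacity of this
  -- step.
  have key : ∀ σ₁ : State, σ₁.nv 3 = σ₀.nv 3 → σ₁.nv 9 = pt i → σ₁.nv 10 = i →
      σ₁.nv 11 = pt (i + 1) →
      (∀ j < i + 1, σ₁.na 5 (σ₀.nv 3) j = pt j) →
      (∀ r ≠ σ₀.nv 3, ∀ j, σ₁.na 5 r j = σ₀.na 5 r j) →
      σ₁.rv 0 = σ.rv 0 →
      σ₁.rv 1 = resid (mat n σ 3) (mat n σ 4) (mat n σ 5) (pt (i + 1)) (pt i) →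
      Runs (.ite (.rle (.var 1) (.var 0)) (.setRV 0 (.var 1)) .skip ;;
        .setNV 9 (.var 11) ;; .setNV 10 (.add (.var 10) (.const 1))) σ₁ (max 1 1 + 1 + (1 + 1))
        (WalkInv σ₀ (mat n σ 3) (mat n σ 4) (mat n σ 5) pt (i + 1)) := by
    intro σ₁ h3' h9 h10 h11 hpath hrows h0 h1
    refine Runs.seq (Runs.ite (fun hb => Runs.setRV fun _ => ?_) (fun hb => Runs.skip fun _ => ?_))
    · refine Runs.setNV_seq (Runs.setNV ?_)
      simp only [BExp.Holds, RExp.eval, h1, h0] at hb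
      constructor
      · simp [h11]
      · simp [h10]
      · simpa using hpath
      · simpa using hrows
      · simp only [putNV_rv, putRV_rv, RExp.eval, if_true, h1]; exact hb.trans h.le
      · intro j hj
        simp only [putNV_rv, putRV_rv, RExp.eval, if_true, h1]
        rcases Nat.lt_succ_iff_lt_or_eq.1 hj with hj | rfl
        · exact hb.trans (h.min j hj)
        · exact le_rfl
      · exact .inr ⟨i, by omega, by simp [h1]⟩
    · refine Runs.setNV_seq (Runs.setNV ?_)
      simp only [BExp.Holds, RExp.eval, h1, h0, not_le] at hb
      constructor
      · simp [h11]
      · simp [h10]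
      · simpa using hpath
      · simpa using hrows
      · simp only [putNV_rv, h0]; exact h.le
      · intro j hj
        simp only [putNV_rv, h0]
        rcases Nat.lt_succ_iff_lt_or_eq.1 hj with hj | rfl
        · exact h.min j hj
        · exact hb.le
      · simp only [putNV_rv, h0]
        rcases h.sat with h | ⟨j, hj, h⟩
        · exact .inl h
        · exact .inr ⟨j, by omega, h⟩
  refine Runs.mono (T := 1 + (1 + (max 1 1 + 1 + (max 1 1 + 1 + (1 + 1))))) ?_ (by simp)
    (fun _ _ h => h)
  refine Runs.setNA_seq (Runs.setNV_seq (Runs.seq (Runs.ite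
    (fun hb => Runs.setRV fun _ => ?_) (fun hb => Runs.setRV fun _ => ?_))))
  · simp only [BExp.Holds, RExp.eval, NExp.eval, putNV_nv, putNA_nv, putNA_na, h.cur, hx,
      putNV_ra, putNA_ra] at hb
    refine key _ ?_ ?_ ?_ ?_ ?_ ?_ ?_ ?_
    · simp [h3]
    · simp [h.cur]
    · simp [h.idx]
    · simp [h.cur, hx]
    · intro j hj
      rcases Nat.lt_succ_iff_lt_or_eq.1 hj with hj | rfl
      · simp [h3, h.idx, h.path j hj, hj.ne]
      · simp [h3, h.idx, h.cur]
    · intro r hr j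
      simp [h3, hr, h.rows]
    · simp
    · have : ¬ (mat n σ 3 (pt (i + 1)) (pt i) < mat n σ 5 (pt (i + 1)) (pt i)) := by
        simpa [mat] using hb
      simp [resid, this, h.cur, hx]
      simp [mat]
  · simp only [BExp.Holds, RExp.eval, NExp.eval, putNV_nv, putNA_nv, putNA_na, h.cur, hx,
      putNV_ra, putNA_ra] at hb
    refine key _ ?_ ?_ ?_ ?_ ?_ ?_ ?_ ?_
    · simp [h3]
    · simp [h.cur]
    · simp [h.idx]
    · simp [h.cur, hx]
    · intro j hj
      rcases Nat.lt_succ_iff_lt_or_eq.1 hj with hj | rfl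
      · simp [h3, h.idx, h.path j hj, hj.ne]
      · simp [h3, h.idx, h.cur]
    · intro r hr j
      simp [h3, hr, h.rows]
    · simp
    · have : mat n σ 3 (pt (i + 1)) (pt i) < mat n σ 5 (pt (i + 1)) (pt i) := by
        simpa [mat] using hb
      simp [resid, this, h.cur, hx]
      simp [mat]

def bottleneckTime (B : ℕ) : ℕ := 1 + (1 + (B * (8 + 1) + 1 + 1))

theorem bottleneck_spec {σ : State} {B : ℕ} {s t : Fin n} {d : Fin n → ℕ} {pt : ℕ → Fin n}
    (hs : σ.nv 4 = s) (ht : σ.nv 5 = t)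
    (hp : IsPath (Res (mat n σ 3) (mat n σ 4) (mat n σ 5)) s t d pt) (hB : d t ≤ B)
    (hpred : ∀ i < d t, vec n σ 7 (pt i) = pt (i + 1)) :
    Runs bottleneck σ (bottleneckTime B) (fun σ' =>
      WalkInv σ (mat n σ 3) (mat n σ 4) (mat n σ 5) pt (d t) σ' ∧
      σ'.na 5 (σ.nv 3) (d t) = s) := by
  refine Runs.setNV_seq (Runs.setNV_seq (Runs.seq ?_))
  set σ₁ := (σ.putNV 9 (NExp.eval σ (.var 5))).putNV 10
    (NExp.eval (σ.putNV 9 (NExp.eval σ (.var 5))) (.const 0)) with hσ₁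
  refine Runs.mono (T := d t * (8 + 1) + 1) (Runs.while_loop
    (fun k σ' => ∃ i, i + k = d t ∧
      WalkInv σ (mat n σ 3) (mat n σ 4) (mat n σ 5) pt i σ') (d t) ?_ ?_ ?_) (by gcongr)
    (Q := fun σ' => σ'.nv 3 = σ.nv 3 ∧ σ'.nv 9 = s ∧
      WalkInv σ (mat n σ 3) (mat n σ 4) (mat n σ 5) pt (d t) σ') ?_
  · refine ⟨0, by simp, ⟨?_, ?_, by simp, ?_, ?_, by simp, ?_⟩⟩ <;> simp [hσ₁, ht, hp.first]
  · rintro k - σ' hF ⟨i, hik, hw⟩ hb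
    have h4 : σ'.nv 4 = s := (hF.nv 4 rfl).trans (by simpa [hσ₁] using hs)
    have hi : i < d t := by
      by_contra hcon
      have : i = d t := by omega
      subst this
      have := hw.cur
      rw [hp.last] at this
      simp [BExp.Holds, this, h4] at hb
    have hm : ∀ a, mat n σ' a = mat n σ a := fun a => mat_congr (hF.ra a rfl)
    have h7 : vec n σ' 7 = vec n σ 7 := vec_congr (hF.na 7 rfl)
    rw [← hm 3, ← hm 4, ← hm 5] at hw ⊢
    refine (bottleneckStep_spec (by rw [h7]; exact hpred i hi) ?_ hw).imp fun σ'' _ hw' _ =>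
      ⟨k - 1, by omega, i + 1, by omega, hw'⟩
    exact (hF.nv 3 rfl).trans (by simp [hσ₁])
  · rintro k - σ' hF ⟨i, hik, hw⟩ hb
    have h4 : σ'.nv 4 = s := (hF.nv 4 rfl).trans (by simpa [hσ₁] using hs)
    have h3 : σ'.nv 3 = σ.nv 3 := (hF.nv 3 rfl).trans (by simp [hσ₁])
    simp only [BExp.Holds, NExp.eval, hw.cur, h4, not_not] at hb
    -- The walk stops at the first visit to s. The label of `pt i` is d t - i, so this is the end of
    -- the path.
    have hsi : pt i = s := Fin.ext (by omega)
    have hl := hp.label i (by omega)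
    have hl' := hp.label (d t) le_rfl
    rw [hp.last] at hl'
    rw [hsi] at hl
    obtain rfl : i = d t := by omega
    exact ⟨h3, by rw [hw.cur, hsi], hw⟩
  · rintro σ' hF ⟨h3, h9, hw⟩ _
    refine Runs.setNA ⟨⟨?_, ?_, ?_, ?_, ?_, ?_, ?_⟩, ?_⟩
    · exact hw.cur
    · exact hw.idx
    · intro j hj
      simp [h3, hw.idx, hj.ne, hw.path j hj]
    · intro r hr j
      simp [h3, hr, hw.rows]
    · exact hw.le
    · exact hw.min
    · exact hw.sat
    · simp [h3, hw.idx, h9]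

theorem pushPath_spec {σ : State} {B k : ℕ} {pt : ℕ → Fin n} (hk : σ.nv 10 = k) (hB : k ≤ B)
    (hpath : ∀ i ≤ k, σ.na 5 (σ.nv 3) i = pt i) :
    Runs pushPath σ (forTime B 4) (fun σ' =>
      mat n σ' 3 = pushes (mat n σ 5) (σ.rv 0) pt (mat n σ 3) k) := by
  refine Runs.for_loop k hB
    (fun i σ' => mat n σ' 3 = pushes (mat n σ 5) (σ.rv 0) pt (mat n σ 3) i) rfl rfl
    (fun i σ' hF _ => by simp [hF.nv 10 rfl, hk]) ?_ (fun σ' _ h => h)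
  intro i hi σ' hF hJ hv
  have h5 : mat n σ' 5 = mat n σ 5 := mat_congr (hF.ra 5 rfl)
  have hy : σ'.na 5 (σ'.nv 3) i = pt i := by
    rw [hF.na 5 rfl, hF.nv 3 rfl]; exact hpath i hi.le
  have hx : σ'.na 5 (σ'.nv 3) (i + 1) = pt (i + 1) := by
    rw [hF.na 5 rfl, hF.nv 3 rfl]; exact hpath (i + 1) hi
  have hr : σ'.rv 0 = σ.rv 0 := by rw [hF.rv 0 rfl]
  refine Runs.mono (T := 1 + (1 + (max 1 1 + 1))) ?_ (by simp) (fun _ _ h => h)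
  refine Runs.setNV_seq (Runs.setNV_seq (Runs.ite (fun hb => Runs.setRA fun _ => ?_)
    (fun hb => Runs.setRA fun _ => ?_)))
  · have hb' : ¬ mat n σ' 3 (pt (i + 1)) (pt i) < mat n σ 5 (pt (i + 1)) (pt i) := by
      rw [← h5]
      simpa [hv, hx, hy, mat] using hb
    simp only [mat_putNV, NExp.eval, putNV_nv, putNV_na, hv, hx, hy, RExp.eval, putNV_ra, putNV_rv,
      hr, if_true, Nat.reduceEqDiff, if_false]
    rw [mat_putRA_same, mat_putNV, mat_putNV, pushes, ← hJ, push, if_neg hb']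
    funext a b
    simp only [setCell]
    split_ifs with hc
    · rw [hc.1, hc.2]; simp [mat]
    · rfl
  · have hb' : mat n σ' 3 (pt (i + 1)) (pt i) < mat n σ 5 (pt (i + 1)) (pt i) := by
      rw [← h5]
      simpa [hv, hx, hy, mat] using hb
    simp only [mat_putNV, NExp.eval, putNV_nv, putNV_na, hv, hx, hy, RExp.eval, putNV_ra, putNV_rv,
      hr, if_true, Nat.reduceEqDiff, if_false]
    rw [mat_putRA_same, mat_putNV, mat_putNV, pushes, ← hJ, push, if_pos hb']
    funext a b
    simp only [setCell]
    split_ifs with hc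
    · rw [hc.1, hc.2]; simp [mat]
    · rfl

def augmentTime (B : ℕ) : ℕ := bottleneckTime B + (1 + forTime B 4)

/-- The outcome of `augment q`. -/
structure AugmentPost (q : ℚ) (σ : State) (s t : Fin n) (pt : ℕ → Fin n) (ρ : ℝ) (σ' : State) :
    Prop where
  isPath : IsPath (Res (mat n σ 3) (mat n σ 4) (mat n σ 5)) s t (vec n σ 6) pt
  augmented : Augmented (mat n σ 3) (mat n σ 4) (mat n σ 5) (mat n σ' 3) s t (vec n σ 6)
    (σ.rv 0) ρ (q * ρ)
  amount : σ'.rv 0 = q * ρ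
  pushed : mat n σ' 3 = pushes (mat n σ 5) (q * ρ) pt (mat n σ 3) (vec n σ 6 t)
  idx : σ'.nv 10 = vec n σ 6 t
  path : ∀ i ≤ vec n σ 6 t, σ'.na 5 (σ.nv 3) i = pt i
  rows : ∀ r ≠ σ.nv 3, ∀ i, σ'.na 5 r i = σ.na 5 r i

theorem augment_spec {q : ℚ} {σ : State} {B : ℕ} (hB : n ≤ B) {s t : Fin n}
    (hs : σ.nv 4 = s) (ht : σ.nv 5 = t)
    (hl : IsLabel (Res (mat n σ 3) (mat n σ 4) (mat n σ 5)) s (vec n σ 6) (vec n σ 7))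
    (hreach : vec n σ 6 t < n) (hroom : 0 < σ.rv 0) :
    Runs (augment q) σ (augmentTime B) (fun σ' => ∃ pt ρ, AugmentPost q σ s t pt ρ σ') := by
  obtain ⟨pt, hp, hpred⟩ := hl.exists_path hreach
  refine Runs.seq ((bottleneck_spec hs ht hp (hreach.le.trans hB) hpred).imp ?_)
  rintro σ₁ hF₁ ⟨hw, hlast⟩ -
  refine Runs.setRV_seq ?_
  set σ₂ := σ₁.putRV 0 ((RExp.smul q (.var 0)).eval σ₁) with hσ₂
  have h3 : σ₂.nv 3 = σ.nv 3 := hF₁.nv 3 rfl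
  have hr : σ₂.rv 0 = q * σ₁.rv 0 := by simp [hσ₂]
  have hm : ∀ a, mat n σ₂ a = mat n σ a := fun a => mat_congr (hF₁.ra a rfl)
  have hpath : ∀ i ≤ vec n σ 6 t, σ₂.na 5 (σ₂.nv 3) i = pt i := by
    intro i hi
    rw [h3]
    rcases hi.lt_or_eq with hi | rfl
    · exact hw.path i hi
    · rw [hp.last]; exact hlast
  refine (pushPath_spec (σ := σ₂) (k := vec n σ 6 t) hw.idx (hreach.le.trans hB) hpath).imp ?_
  intro σ₃ hF₃ hpush
  rw [hm 5, hm 3, hr] at hpush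
  refine ⟨pt, σ₁.rv 0, hp, ?_, ?_, hpush, ?_, ?_, ?_⟩
  · rw [hpush]; exact hp.augmented _ hroom hw.le hw.min hw.sat
  · rw [hF₃.rv 0 rfl, hr]
  · rw [hF₃.nv 10 rfl]; exact hw.idx
  · intro i hi; rw [hF₃.na 5 rfl, ← h3]; exact hpath i hi
  · intro r hr i; rw [hF₃.na 5 rfl]; exact hw.rows r hr i

end RealRAM

/-! ### Maximizing the flow on one arc -/

namespace Flow

variable {n : ℕ} {g lo hi h : Fin n → Fin n → ℝ} {s t : Fin n} {d : Fin n → ℕ} {room ρ δ : ℝ}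

/-- An increase on (t, s) would put s one level above t, and the lower bound bars a decrease. So the
path avoids this cell, and raising it by δ afterwards restores conservation. -/
theorem Augmented.closing_cell (ha : Augmented g lo hi h s t d room ρ δ) (hs : d s = 0)
    (hlo : ¬ lo t s < g t s) : h t s = g t s := by
  rcases ha.cell t s with h1 | ⟨-, -, -, h1⟩ | ⟨-, h1, -⟩
  · exact h1
  · omega
  · exact absurd h1 hlo

theorem Augmented.bounds (ha : Augmented g lo hi h s t d room ρ δ) (hδ : 0 ≤ δ) (hδρ : δ ≤ ρ)
    {a b : Fin n} (hb : lo a b ≤ g a b ∧ g a b ≤ hi a b) : lo a b ≤ h a b ∧ h a b ≤ hi a b := by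
  rcases ha.cell a b with h1 | ⟨h1, h2, h3, -⟩ | ⟨h1, h2, h3, -⟩ <;> rw [h1] <;>
    constructor <;> linarith

theorem Augmented.circ (ha : Augmented g lo hi h s t d room ρ δ) (hg : Circ g) :
    Circ (setCell h t s (h t s + δ)) := by
  rw [circ_iff_net] at *
  intro v
  have h1 : setCell h t s (h t s + δ) = fun a b => if a = t ∧ b = s then h a b + δ else h a b := by
    funext a b
    simp only [setCell]
    split_ifs with hc
    · rw [hc.1, hc.2]
    · rfl
  rw [h1, net_add_cell, ha.net, hg v]
  ring

/-- Arcs of the new residual graph ascend by at most one level of the old one. -/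
theorem Augmented.res_step (ha : Augmented g lo hi h s t d room ρ δ)
    (hd : ∀ x y, Res g lo hi x y → d y ≤ d x + 1) {x y : Fin n} (hR : Res h lo hi x y) :
    d y ≤ d x + 1 := by
  rcases hR with hR | hR
  · rcases ha.cell x y with h1 | ⟨-, -, -, h1⟩ | ⟨-, -, -, h1⟩
    · exact hd x y (.inl (h1 ▸ hR))
    · omega
    · omega
  · rcases ha.cell y x with h1 | ⟨-, -, -, h1⟩ | ⟨-, -, -, h1⟩
    · exact hd x y (.inr (h1 ▸ hR))
    · omega
    · omega

/-- A saturating augmentation raises the potential. -/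
theorem Augmented.potential_lt (ha : Augmented g lo hi h s t d room ρ ρ) (hroom : ρ ≠ room)
    (hb : ∀ a b, lo a b ≤ g a b ∧ g a b ≤ hi a b) :
    potential (fun a b => g a b < hi a b) (fun a b => lo a b < g a b) d <
      potential (fun a b => h a b < hi a b) (fun a b => lo a b < h a b) d := by
  have hpos := ha.pos
  apply Flow.potential_lt
  · intro a b
    have := hb a b
    rcases ha.cell a b with h1 | ⟨h1, h2, h3, h4⟩ | ⟨h1, h2, h3, h4⟩
    · left; rw [h1]; exact ⟨Iff.rfl, Iff.rfl⟩
    · exact .inr (.inl ⟨h4, h2, by linarith⟩)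
    · exact .inr (.inr ⟨h4, h2, by linarith⟩)
  · obtain ⟨a, b, h1 | h1⟩ := ha.sat.resolve_left hroom
    · have := hb a b
      exact ⟨a, b, .inl ⟨h1.1, h1.2.1, by linarith [h1.2.2], by linarith [h1.2.2]⟩⟩
    · have := hb a b
      exact ⟨a, b, .inr ⟨h1.1, h1.2.1, by linarith [h1.2.2], by linarith [h1.2.2]⟩⟩

/-- Equality of the residual graphs after moving a frozen cell. -/
theorem setCell_lt_iff (g f : Fin n → Fin n → ℝ) (x y : Fin n) (r : ℝ) (hxy : f x y = g x y)
    (a b : Fin n) : setCell g x y r a b < setCell f x y r a b ↔ g a b < f a b := by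
  simp only [setCell]
  split_ifs with hc
  · rw [hc.1, hc.2, hxy]; simp
  · rfl

end Flow

namespace RealRAM

variable {n : ℕ}

/-- The real constant zero. -/
def rzero : RExp := .smul 0 (.var 0)

@[simp] theorem rzero_eval (σ : State) : rzero.eval σ = 0 := by simp [rzero]

/-- Augment once the flow on the arc from register `13` to register `15`, whose remaining capacity
is in the real register `2`, or clear register `16`. -/
def maximizeStep : Stmt :=
  search ;;
  .ite (.nle (.var 0) (.get 6 (.var 5) (.const 0)))
    (.setNV 16 (.const 0))
    (.setRV 0 (.var 2) ;; augment 1 ;;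
      .setRA 3 (.var 13) (.var 15) (.add (.get 3 (.var 13) (.var 15)) (.var 0)) ;;
      .setRA 4 (.var 13) (.var 15) (.get 3 (.var 13) (.var 15)) ;;
      .setRA 5 (.var 13) (.var 15) (.get 3 (.var 13) (.var 15)) ;;
      .setRV 2 (.sub (.var 2) (.var 0)))

/-- Maximize the flow on the arc from register `13` to register `15` and freeze it. -/
def maximize : Stmt :=
  .setNV 4 (.var 15) ;; .setNV 5 (.var 13) ;;
  .setRV 2 (.sub (.get 5 (.var 13) (.var 15)) (.get 3 (.var 13) (.var 15))) ;;
  .setRA 4 (.var 13) (.var 15) (.get 3 (.var 13) (.var 15)) ;;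
  .setRA 5 (.var 13) (.var 15) (.get 3 (.var 13) (.var 15)) ;;
  .setNV 16 (.const 1) ;;
  .while (.and (.nle (.const 1) (.var 16)) (.not (.rle (.var 2) rzero))) maximizeStep

/-- No circulation within the bounds `lo` and `hi` has a larger value than `g` on `(v, u)`. -/
def MaxOn (g lo hi : Fin n → Fin n → ℝ) (v u : Fin n) : Prop :=
  ∀ k, Circ k → (∀ a b, lo a b ≤ k a b ∧ k a b ≤ hi a b) → k v u ≤ g v u

/-- Invariant of `maximize`: `lo` and `hi` are the original bounds. -/
structure MaxInv (lo hi : Fin n → Fin n → ℝ) (v u : Fin n) (k : ℕ) (σ : State) : Prop where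
  circ : Circ (mat n σ 3)
  bounds : ∀ a b, lo a b ≤ mat n σ 3 a b ∧ mat n σ 3 a b ≤ hi a b
  lower : mat n σ 4 = setCell lo v u (mat n σ 3 v u)
  upper : mat n σ 5 = setCell hi v u (mat n σ 3 v u)
  room : σ.rv 2 = hi v u - mat n σ 3 v u
  halted : σ.nv 16 = 0 → MaxOn (mat n σ 3) lo hi v u
  -- The labels are recomputed in each round, hence the claim for every labelling of the current
  -- residual graph. It is needed only while a further round is due.
  count : 0 < σ.nv 16 → 0 < σ.rv 2 → ∀ d p,
    IsLabel (Res (mat n σ 3) (mat n σ 4) (mat n σ 5)) u d p →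
    n * (n * (n + n)) + 1 ≤ potential (fun a b => mat n σ 3 a b < mat n σ 5 a b)
      (fun a b => mat n σ 4 a b < mat n σ 3 a b) d + k

def maximizeStepTime (B : ℕ) : ℕ :=
  searchTime B + (max 1 (1 + (augmentTime B + (1 + (1 + (1 + 1))))) + 1)

theorem maximizeStep_spec {σ : State} {B k : ℕ} (hB : n ≤ B) (hn : σ.nv 0 = n)
    {lo hi : Fin n → Fin n → ℝ} {v u : Fin n} (h4 : σ.nv 4 = u) (h5 : σ.nv 5 = v)
    (h13 : σ.nv 13 = v) (h15 : σ.nv 15 = u) (hJ : MaxInv lo hi v u k σ) (h16 : 0 < σ.nv 16)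
    (hroom : 0 < σ.rv 2) :
    Runs maximizeStep σ (maximizeStepTime B) (fun σ' => ∃ k' < k, MaxInv lo hi v u k' σ') := by
  refine Runs.seq ((search_spec hB hn u h4).imp fun σ₁ hF₁ hl _ => ?_)
  have hpot := hJ.count h16 hroom _ _ hl
  -- The potential never exceeds n * (n * (n + n)), so the count leaves a round to spend.
  have hk : 0 < k := by
    have := potential_le (fun a b => mat n σ 3 a b < mat n σ 5 a b)
      (fun a b => mat n σ 4 a b < mat n σ 3 a b) _ hl.le
    omega
  have hm : ∀ a, mat n σ₁ a = mat n σ a := fun a => mat_congr (hF₁.ra a rfl)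
  have h5' : σ₁.nv 5 = v := (hF₁.nv 5 rfl).trans h5
  have hn' : σ₁.nv 0 = n := (hF₁.nv 0 rfl).trans hn
  set g := mat n σ 3 with hg
  have hb₁ : ∀ a b, mat n σ 4 a b ≤ g a b ∧ g a b ≤ mat n σ 5 a b := by
    intro a b
    rw [hJ.lower, hJ.upper]
    simp only [setCell]
    split_ifs with hc
    · rw [hc.1, hc.2]; exact ⟨le_rfl, le_rfl⟩
    · exact hJ.bounds a b
  refine Runs.ite (fun hb => Runs.setNV ?_) (fun hb => ?_)
  · simp only [BExp.Holds, NExp.eval, hn', h5'] at hb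
    refine ⟨0, hk, ?_⟩
    constructor
    · simpa [hm] using hJ.circ
    · simpa [hm] using hJ.bounds
    · simpa [hm] using hJ.lower
    · simpa [hm] using hJ.upper
    · simpa [hm, hF₁.rv 2 rfl] using hJ.room
    · intro _ f hf hfb
      simp only [mat_putNV, hm]
      -- The stored bounds differ from the original ones only on (v, u), the arc on which no bounds
      -- are required of the competitor.
      refine hl.maximal (s := u) (t := v) (by simpa [vec] using hb) hJ.circ hf ?_
      intro a b hab
      rw [hJ.lower, hJ.upper]
      simpa [setCell, hab] using hfb a b
    · simp
  · simp only [BExp.Holds, NExp.eval, hn', h5', not_le] at hb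
    refine Runs.setRV_seq ?_
    set σ₂ := σ₁.putRV 0 ((RExp.var 2).eval σ₁) with hσ₂
    have hm₂ : ∀ a, mat n σ₂ a = mat n σ a := hm
    have hr₂ : σ₂.rv 0 = σ.rv 2 := by simp [hσ₂, hF₁.rv 2 rfl]
    have hv6 : vec n σ₂ 6 = vec n σ₁ 6 := rfl
    have hl₂ : IsLabel (Res (mat n σ₂ 3) (mat n σ₂ 4) (mat n σ₂ 5)) u (vec n σ₂ 6) (vec n σ₂ 7) := by
      rw [hm₂, hm₂, hm₂]; exact hl
    refine Runs.seq ((augment_spec (q := 1) (σ := σ₂) (t := v) hB ((hF₁.nv 4 rfl).trans h4) h5' hl₂ hb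
      (by rw [hr₂]; exact hroom)).imp fun σ₃ hF₃ hpost _ => ?_)
    obtain ⟨pt, ρ, hpost⟩ := hpost
    have ha := hpost.augmented
    have hamt := hpost.amount
    simp only [Rat.cast_one, one_mul] at ha hamt
    rw [hm₂, hm₂, hm₂, hv6, hr₂, ← hg] at ha
    have h13₃ : σ₃.nv 13 = v := ((hF₃.nv 13 rfl).trans (hF₁.nv 13 rfl)).trans h13
    have h15₃ : σ₃.nv 15 = u := ((hF₃.nv 15 rfl).trans (hF₁.nv 15 rfl)).trans h15
    have h2₃ : σ₃.rv 2 = σ.rv 2 := (hF₃.rv 2 rfl).trans (by simp [hσ₂, hF₁.rv 2 rfl])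
    have h16₃ : σ₃.nv 16 = σ.nv 16 := (hF₃.nv 16 rfl).trans (hF₁.nv 16 rfl)
    set h := mat n σ₃ 3 with hh
    have hcl : h v u = g v u := by
      refine ha.closing_cell hl.source ?_
      rw [hJ.lower]; simp [setCell, hg]
    have hbd : ∀ a b, mat n σ 4 a b ≤ h a b ∧ h a b ≤ mat n σ 5 a b :=
      fun a b => ha.bounds ha.pos.le le_rfl (hb₁ a b)
    have hm4 : mat n σ₃ 4 = mat n σ 4 := (mat_congr (hF₃.ra 4 rfl)).trans (hm₂ 4)
    have hm5 : mat n σ₃ 5 = mat n σ 5 := (mat_congr (hF₃.ra 5 rfl)).trans (hm₂ 5)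
    refine Runs.setRA_seq (Runs.setRA_seq (Runs.setRA_seq (Runs.setRV ?_)))
    simp only [NExp.eval, RExp.eval, putRA_nv, putRA_rv, putRA_ra, h13₃, h15₃, hamt]
    norm_num
    have hval : σ₃.ra 3 v u = g v u := hcl
    rw [hval, h2₃]
    set r := g v u + ρ with hr
    set σ₄ := ((((σ₃.putRA 3 v u r).putRA 4 v u r).putRA 5 v u r).putRV 2 (σ.rv 2 - ρ)) with hσ₄
    have e3 : mat n σ₄ 3 = setCell h v u r := by
      rw [hσ₄, mat_putRV, mat_putRA_ne _ _ _ _ (by norm_num), mat_putRA_ne _ _ _ _ (by norm_num),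
        mat_putRA_same]
    have e4 : mat n σ₄ 4 = setCell (mat n σ 4) v u r := by
      rw [hσ₄, mat_putRV, mat_putRA_ne _ _ _ _ (by norm_num), mat_putRA_same,
        mat_putRA_ne _ _ _ _ (by norm_num), hm4]
    have e5 : mat n σ₄ 5 = setCell (mat n σ 5) v u r := by
      rw [hσ₄, mat_putRV, mat_putRA_same, mat_putRA_ne _ _ _ _ (by norm_num),
        mat_putRA_ne _ _ _ _ (by norm_num), hm5]
    have e3' : mat n σ₄ 3 v u = r := by rw [e3]; simp [setCell]
    have hρle : ρ ≤ hi v u - g v u := by have := ha.le; have := hJ.room; linarith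
    -- The cell (v, u) and both its bounds move together and leave no residual capacity there,
    -- before or after. The new residual graph is thus that of h under the old bounds.
    have hU : ∀ a b, mat n σ₄ 3 a b < mat n σ₄ 5 a b ↔ h a b < mat n σ 5 a b := by
      intro a b; rw [e3, e5]
      exact setCell_lt_iff _ _ _ _ _ (by rw [hcl, hJ.upper]; simp [setCell, hg]) a b
    have hD : ∀ a b, mat n σ₄ 4 a b < mat n σ₄ 3 a b ↔ mat n σ 4 a b < h a b := by
      intro a b; rw [e3, e4]
      exact setCell_lt_iff _ _ _ _ _ (by rw [hcl, hJ.lower]; simp [setCell, hg]) a b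
    refine ⟨k - 1, by omega, ?_⟩
    constructor
    · rw [e3]
      have := ha.circ hJ.circ
      rwa [hcl] at this
    · intro a b
      rw [e3]
      simp only [setCell]
      split_ifs with hc
      · rw [hc.1, hc.2]
        have := hJ.bounds v u
        have := ha.pos
        constructor <;> linarith
      · have := hbd a b
        rw [hJ.lower, hJ.upper] at this
        simpa [setCell, hc] using this
    · rw [e4, e3', hJ.lower]; funext a b; simp only [setCell]; split_ifs <;> rfl
    · rw [e5, e3', hJ.upper]; funext a b; simp only [setCell]; split_ifs <;> rfl
    · rw [e3']
      have := hJ.room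
      simp only [hσ₄, putRV_rv, if_true]; linarith
    · intro h0
      have : σ.nv 16 = 0 := by rw [← h16₃]; exact h0
      omega
    · intro _ hpos d' p' hl'
      -- As room is left on (v, u), the bottleneck lies on the path and the augmentation saturates a
      -- residual arc.
      have hne : ρ ≠ σ.rv 2 := by
        simp only [hσ₄, putRV_rv, if_true] at hpos; linarith
      have h1 := ha.potential_lt hne hb₁
      have h2 : ∀ x, vec n σ₁ 6 x ≤ d' x := by
        refine hl.mono hl' fun x y hxy => ha.res_step hl.step ?_
        rcases hxy with hxy | hxy
        · exact .inl ((hU _ _).1 hxy)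
        · exact .inr ((hD _ _).1 hxy)
      have h3 := potential_mono (U := fun a b => h a b < mat n σ 5 a b)
        (D := fun a b => mat n σ 4 a b < h a b) h2
      simp only [hU, hD]
      omega

def maximizeTime (B : ℕ) : ℕ :=
  1 + (1 + (1 + (1 + (1 + (1 + ((B * (B * (B + B)) + 1) * (maximizeStepTime B + 1) + 1))))))

theorem maximize_spec {σ : State} {B : ℕ} (hB : n ≤ B) (hn : σ.nv 0 = n) {v u : Fin n}
    (h13 : σ.nv 13 = v) (h15 : σ.nv 15 = u) (hc : Circ (mat n σ 3))
    (hb : ∀ a b, mat n σ 4 a b ≤ mat n σ 3 a b ∧ mat n σ 3 a b ≤ mat n σ 5 a b) :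
    Runs maximize σ (maximizeTime B) (fun σ' =>
      Circ (mat n σ' 3) ∧
      (∀ a b, mat n σ 4 a b ≤ mat n σ' 3 a b ∧ mat n σ' 3 a b ≤ mat n σ 5 a b) ∧
      mat n σ' 4 = setCell (mat n σ 4) v u (mat n σ' 3 v u) ∧
      mat n σ' 5 = setCell (mat n σ 5) v u (mat n σ' 3 v u) ∧
      MaxOn (mat n σ' 3) (mat n σ 4) (mat n σ 5) v u) := by
  refine Runs.setNV_seq (Runs.setNV_seq (Runs.setRV_seq (Runs.setRA_seq (Runs.setRA_seq
    (Runs.setNV_seq ?_)))))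
  simp only [NExp.eval, RExp.eval, putRA_nv, putRV_nv, putNV_nv, putRA_ra, putRV_ra,
    putNV_ra, h13, h15]
  norm_num
  set r := σ.ra 3 v u with hr
  set σ₁ := ((((((σ.putNV 4 u).putNV 5 v).putRV 2 (σ.ra 5 v u - r)).putRA 4 v u r).putRA 5 v u
    r).putNV 16 1) with hσ₁
  have e3 : mat n σ₁ 3 = mat n σ 3 := by
    rw [hσ₁, mat_putNV, mat_putRA_ne _ _ _ _ (by norm_num), mat_putRA_ne _ _ _ _ (by norm_num)]
    rfl
  have hrv : mat n σ 3 v u = r := rfl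
  have e4 : mat n σ₁ 4 = setCell (mat n σ 4) v u (mat n σ₁ 3 v u) := by
    rw [e3, hrv, hσ₁, mat_putNV, mat_putRA_ne _ _ _ _ (by norm_num), mat_putRA_same]; rfl
  have e5 : mat n σ₁ 5 = setCell (mat n σ 5) v u (mat n σ₁ 3 v u) := by
    rw [e3, hrv, hσ₁, mat_putNV, mat_putRA_same, mat_putRA_ne _ _ _ _ (by norm_num)]; rfl
  have hn₁ : σ₁.nv 0 = n := by simp [hσ₁, hn]
  have h4₁ : σ₁.nv 4 = u := by simp [hσ₁]
  have h5₁ : σ₁.nv 5 = v := by simp [hσ₁]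
  have h13₁ : σ₁.nv 13 = v := by simp [hσ₁, h13]
  have h15₁ : σ₁.nv 15 = u := by simp [hσ₁, h15]
  refine Runs.mono (T := (n * (n * (n + n)) + 1) * (maximizeStepTime B + 1) + 1) (Runs.while_loop
    (fun k σ' => MaxInv (mat n σ 4) (mat n σ 5) v u k σ') (n * (n * (n + n)) + 1) ?_ ?_ ?_)
    (by gcongr) (fun _ _ h => h)
  · constructor
    · rw [e3]; exact hc
    · rw [e3]; exact hb
    · exact e4
    · exact e5
    · simp [hσ₁, mat, hr]
    · simp [hσ₁]
    · intros; omega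
  · rintro k - σ' hF hJ hcond
    simp only [BExp.Holds, NExp.eval, RExp.eval, rzero_eval, not_le] at hcond
    exact (maximizeStep_spec hB ((hF.nv 0 rfl).trans hn₁) ((hF.nv 4 rfl).trans h4₁)
      ((hF.nv 5 rfl).trans h5₁) ((hF.nv 13 rfl).trans h13₁) ((hF.nv 15 rfl).trans h15₁) hJ
      hcond.1 hcond.2).imp fun _ _ h _ => h
  · rintro k - σ' hF hJ hcond
    refine ⟨hJ.circ, hJ.bounds, hJ.lower, hJ.upper, ?_⟩
    simp only [BExp.Holds, NExp.eval, RExp.eval, rzero_eval, not_and, not_not] at hcond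
    -- Either the search failed and certified maximality, or the flow has reached its upper bound.
    by_cases h16 : σ'.nv 16 = 0
    · exact hJ.halted h16
    · intro f _ hf
      have := hcond (by omega)
      have := hJ.room
      have := hf v u
      linarith

end RealRAM

/-! ### Pareto optimality in terms of flow matrices -/

namespace Market

variable {n : ℕ}

/-- Capacities, extended by zero. -/
noncomputable def capM (I : Market n) : Fin n → Fin n → ℝ :=
  fun v u => if u ∈ I.pref v then I.cap v u else 0

/-- Circulations that respect the capacities. -/
structure Feas (I : Market n) (g : Fin n → Fin n → ℝ) : Prop where
  circ : Circ g
  nonneg : ∀ v u, 0 ≤ g v u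
  le_cap : ∀ v u, g v u ≤ I.capM v u

theorem Feas.eq_zero {I : Market n} {g : Fin n → Fin n → ℝ} (h : I.Feas g) {v u : Fin n}
    (hu : u ∉ I.pref v) : g v u = 0 := by
  have h1 := h.nonneg v u
  have h2 := h.le_cap v u
  simp only [capM, hu, if_false] at h2
  linarith

/-- Agent `v` prefers the flow `g` to the flow `h`, and the first difference is in position `k`. -/
def PrefersAt (I : Market n) (v : Fin n) (k : ℕ) (g h : Fin n → Fin n → ℝ) : Prop :=
  ∃ hk : k < (I.pref v).length,
    (∀ (i : ℕ) (hi : i < k), g v ((I.pref v)[i]'(hi.trans hk)) = h v ((I.pref v)[i]'(hi.trans hk))) ∧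
    h v (I.pref v)[k] < g v (I.pref v)[k]

/-- Agent `v` prefers the flow `g` to the flow `h`. -/
def PrefersM (I : Market n) (v : Fin n) (g h : Fin n → Fin n → ℝ) : Prop :=
  ∃ k, I.PrefersAt v k g h

variable {I : Market n} {v : Fin n} {f g h k : Fin n → Fin n → ℝ}

/-- A larger value of f would be a first difference in favour of f. -/
theorem le_of_not_prefersM (hn : ¬ I.PrefersM v f h) {j : ℕ} (hj : j < (I.pref v).length)
    (heq : ∀ (i : ℕ) (hi : i < j),
      f v ((I.pref v)[i]'(hi.trans hj)) = h v ((I.pref v)[i]'(hi.trans hj))) :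
    f v (I.pref v)[j] ≤ h v (I.pref v)[j] := by
  by_contra hcon
  exact hn ⟨j, hj, heq, not_le.1 hcon⟩

/-- If f beat k first at position j, then by induction f, h and k agree at all earlier positions:
there f ≤ h ≤ k = f. At j itself f ≤ h ≤ k, a contradiction. -/
theorem not_prefersM_trans (h₁ : ¬ I.PrefersM v f h) (h₂ : ¬ I.PrefersM v h k) :
    ¬ I.PrefersM v f k := by
  rintro ⟨j, hj, heq, hlt⟩
  have key : ∀ i (hi : i ≤ j), (∀ i' (hi' : i' < i),
      f v ((I.pref v)[i']'(by omega)) = h v ((I.pref v)[i']'(by omega))) := by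
    intro i
    induction i with
    | zero => intro _ i' hi'; omega
    | succ i ih =>
      intro hi i' hi'
      have ih' := ih (by omega)
      rcases Nat.lt_succ_iff_lt_or_eq.1 hi' with h' | rfl
      · exact ih' i' h'
      · have a1 := le_of_not_prefersM h₁ (j := i') (by omega) ih'
        have a2 := le_of_not_prefersM h₂ (j := i') (by omega)
          (fun a ha => (ih' a ha).symm.trans (heq a (by omega)))
        have a3 := heq i' (by omega)
        linarith
  have e := key j le_rfl
  have a1 := le_of_not_prefersM h₁ hj e
  have a2 := le_of_not_prefersM h₂ hj (fun a ha => (e a ha).symm.trans (heq a ha))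
  linarith

theorem PrefersM.asymm (hp : I.PrefersM v g h) : ¬ I.PrefersM v h g := by
  rintro ⟨j, hj, heq, hlt⟩
  obtain ⟨i, hi, heq', hlt'⟩ := hp
  rcases lt_trichotomy i j with hij | rfl | hij
  · have := heq i hij; linarith
  · linarith
  · have := heq' j hij; linarith

theorem not_prefersM_of_eq (he : ∀ u ∈ I.pref v, g v u = h v u) : ¬ I.PrefersM v g h := by
  rintro ⟨j, hj, -, hlt⟩
  have := he _ (List.getElem_mem hj)
  linarith

/-- Every flow that is weakly better than `f` for all agents agrees with `f` on the first `τ v`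
arcs of every `v`. -/
def Frozen (I : Market n) (f : Fin n → Fin n → ℝ) (τ : Fin n → ℕ) : Prop :=
  ∀ h, I.Feas h → (∀ v, ¬ I.PrefersM v f h) → ∀ v, ∀ u ∈ (I.pref v).take (τ v), h v u = f v u

/-- Lower bounds: `f` on the first `τ v + 1` arcs of `v`, and zero on the others. -/
noncomputable def lowerB (I : Market n) (f : Fin n → Fin n → ℝ) (τ : Fin n → ℕ) :
    Fin n → Fin n → ℝ :=
  fun v u => if u ∈ (I.pref v).take (τ v + 1) then f v u else 0

/-- Upper bounds: `f` on the first `τ v` arcs of `v`, and the capacities on the others. -/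
noncomputable def upperB (I : Market n) (f : Fin n → Fin n → ℝ) (τ : Fin n → ℕ) :
    Fin n → Fin n → ℝ :=
  fun v u => if u ∈ (I.pref v).take (τ v) then f v u else I.capM v u

theorem mem_take_succ {α : Type*} {l : List α} {i : ℕ} (hi : i < l.length) {u : α} :
    u ∈ l.take (i + 1) ↔ u ∈ l.take i ∨ u = l[i] := by
  rw [List.take_add_one, List.getElem?_eq_getElem hi, Option.toList_some, List.mem_append,
    List.mem_singleton]

theorem getElem_mem_take {α : Type*} {l : List α} {i j : ℕ} (hj : j < i) (hl : j < l.length) :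
    l[j] ∈ l.take i := by
  rw [List.mem_take_iff_getElem]
  exact ⟨j, by omega, rfl⟩

theorem getElem_notMem_take {α : Type*} {l : List α} (hl : l.Nodup) {i : ℕ} (hi : i < l.length) :
    l[i] ∉ l.take i := by
  rw [List.mem_take_iff_getElem]
  rintro ⟨j, hj, he⟩
  have := (hl.getElem_inj_iff).1 he
  omega

/-- Makes f available as a restart point, whatever has been frozen. -/
theorem Feas.self_bounds (hf : I.Feas f) (τ : Fin n → ℕ) (a b : Fin n) :
    I.lowerB f τ a b ≤ f a b ∧ f a b ≤ I.upperB f τ a b := by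
  unfold lowerB upperB
  have := hf.nonneg a b
  have := hf.le_cap a b
  constructor <;> split_ifs <;> linarith

/-- On the first open arc h cannot fall below f, since the two agree on everything before it. An
agent without open arcs has all its arcs frozen, and `take` ignores the excess index. -/
theorem Frozen.bounds {τ : Fin n → ℕ} (hF : I.Frozen f τ) (hh : I.Feas h)
    (hw : ∀ v, ¬ I.PrefersM v f h) (a b : Fin n) :
    I.lowerB f τ a b ≤ h a b ∧ h a b ≤ I.upperB f τ a b := by
  have key := hF h hh hw a
  constructor
  · unfold lowerB
    split_ifs with hc
    · by_cases ha : τ a < (I.pref a).length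
      · rcases (mem_take_succ ha).1 hc with hb | rfl
        · exact (key b hb).ge
        · exact le_of_not_prefersM (hw a) ha fun i hi =>
            (key _ (getElem_mem_take hi _)).symm
      · rw [List.take_of_length_le (by omega)] at hc
        rw [List.take_of_length_le (by omega)] at key
        exact (key b hc).ge
    · exact hh.nonneg a b
  · unfold upperB
    split_ifs with hc
    · exact (key b hc).le
    · exact hh.le_cap a b

theorem Frozen.zero : I.Frozen f 0 := by
  intro h _ _ v u hu
  simp at hu

/-- Freeze one more arc of `v`. -/
theorem Frozen.succ {τ : Fin n → ℕ} (hF : I.Frozen f τ) (hv : τ v < (I.pref v).length)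
    (hmax : MaxOn f (I.lowerB f τ) (I.upperB f τ) v (I.pref v)[τ v]) :
    I.Frozen f (Function.update τ v (τ v + 1)) := by
  intro h hh hw w u hu
  by_cases hwv : w = v
  · subst hwv
    rw [Function.update_self] at hu
    rcases (mem_take_succ hv).1 hu with hu | rfl
    · exact hF h hh hw w u hu
    · refine le_antisymm (hmax h hh.circ (hF.bounds hh hw)) ?_
      exact le_of_not_prefersM (hw w) hv fun i hi =>
        (hF h hh hw w _ (getElem_mem_take hi _)).symm
  · rw [Function.update_of_ne hwv] at hu
    exact hF h hh hw w u hu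

theorem upperB_succ {τ : Fin n → ℕ} (hv : τ v < (I.pref v).length) :
    I.upperB f (Function.update τ v (τ v + 1)) =
      setCell (I.upperB f τ) v (I.pref v)[τ v] (f v (I.pref v)[τ v]) := by
  funext a b
  unfold upperB setCell
  by_cases hav : a = v
  · subst hav
    simp only [Function.update_self, mem_take_succ hv, true_and]
    by_cases hb : b = (I.pref a)[τ a]
    · subst hb; simp
    · simp [hb]
  · simp [hav]

/-- Freezing the arc at τ v changes the lower bound only at the following index, as the frozen arc
already had the lower bound f. -/
theorem lowerB_succ {τ : Fin n → ℕ} (hv : τ v + 1 < (I.pref v).length) :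
    I.lowerB f (Function.update τ v (τ v + 1)) =
      setCell (I.lowerB f τ) v (I.pref v)[τ v + 1] (f v (I.pref v)[τ v + 1]) := by
  funext a b
  unfold lowerB setCell
  by_cases hav : a = v
  · subst hav
    simp only [Function.update_self, mem_take_succ hv, true_and]
    by_cases hb : b = (I.pref a)[τ a + 1]
    · subst hb; simp
    · simp [hb]
  · simp [hav]

theorem lowerB_succ_of_le {τ : Fin n → ℕ} (hv : (I.pref v).length ≤ τ v + 1) :
    I.lowerB f (Function.update τ v (τ v + 1)) = I.lowerB f τ := by
  funext a b
  unfold lowerB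
  by_cases hav : a = v
  · subst hav
    rw [Function.update_self, List.take_of_length_le (by omega), List.take_of_length_le hv]
  · simp [hav]

/-- If everything is frozen, then nobody can be better off. -/
theorem Frozen.no_improvement {τ : Fin n → ℕ} (hF : I.Frozen f τ)
    (hall : ∀ v, (I.pref v).length ≤ τ v) (hh : I.Feas h) (hw : ∀ v, ¬ I.PrefersM v f h)
    (v : Fin n) : ¬ I.PrefersM v h f := by
  refine not_prefersM_of_eq fun u hu => hF h hh hw v u ?_
  rwa [List.take_of_length_le (hall v)]

/-! ### Sequential maximization -/

/-- The cells in `Done` are frozen at values that are lexicographically maximal among the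
circulations with the bounds `lo₀`, `hi₀`. -/
structure SeqMax (I : Market n) (lo₀ hi₀ : Fin n → Fin n → ℝ) (Done : Fin n → Fin n → Prop)
    (g lo hi : Fin n → Fin n → ℝ) : Prop where
  circ : Circ g
  bounds₀ : ∀ a b, lo₀ a b ≤ g a b ∧ g a b ≤ hi₀ a b
  done : ∀ a b, Done a b → lo a b = g a b ∧ hi a b = g a b
  undone : ∀ a b, ¬ Done a b → lo a b = lo₀ a b ∧ hi a b = hi₀ a b
  max : ∀ k, Circ k → (∀ a b, lo₀ a b ≤ k a b ∧ k a b ≤ hi₀ a b) →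
    (∀ a b, Done a b → k a b = g a b) ∨
    ∃ w j, I.PrefersAt w j g k ∧ ∀ u ∈ (I.pref w).take (j + 1), Done w u

variable {lo₀ hi₀ lo hi g' : Fin n → Fin n → ℝ} {Done Done' : Fin n → Fin n → Prop}

theorem SeqMax.bounds (hs : I.SeqMax lo₀ hi₀ Done g lo hi) (a b : Fin n) :
    lo a b ≤ g a b ∧ g a b ≤ hi a b := by
  by_cases hd : Done a b
  · rw [(hs.done a b hd).1, (hs.done a b hd).2]; exact ⟨le_rfl, le_rfl⟩
  · rw [(hs.undone a b hd).1, (hs.undone a b hd).2]; exact hs.bounds₀ a b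

theorem SeqMax.init (hg : Circ g) (hb : ∀ a b, lo₀ a b ≤ g a b ∧ g a b ≤ hi₀ a b)
    (hD : ∀ a b, ¬ Done a b) : I.SeqMax lo₀ hi₀ Done g lo₀ hi₀ :=
  ⟨hg, hb, fun a b h => absurd h (hD a b), fun _ _ _ => ⟨rfl, rfl⟩,
    fun _ _ _ => .inl fun a b h => absurd h (hD a b)⟩

theorem SeqMax.congr (hs : I.SeqMax lo₀ hi₀ Done g lo hi) (hD : ∀ a b, Done' a b ↔ Done a b) :
    I.SeqMax lo₀ hi₀ Done' g lo hi := by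
  have : Done' = Done := by funext a b; exact propext (hD a b)
  rwa [this]

/-- A competitor k that agrees on all finished cells lies within the current bounds, so it is at
most g' on the new cell. Equality extends the agreement. A smaller value is a first difference in
favour of g', because the cells above it in the list of v are finished. A preference found earlier
survives, since it concerns finished cells only. -/
theorem SeqMax.step (hs : I.SeqMax lo₀ hi₀ Done g lo hi) {i : ℕ} (hi' : i < (I.pref v).length)
    (hprev : ∀ u ∈ (I.pref v).take i, Done v u) (hc : Circ g')
    (hb : ∀ a b, lo a b ≤ g' a b ∧ g' a b ≤ hi a b) (hmax : MaxOn g' lo hi v (I.pref v)[i])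
    (hD : ∀ a b, Done' a b ↔ Done a b ∨ (a = v ∧ b = (I.pref v)[i])) :
    I.SeqMax lo₀ hi₀ Done' g' (setCell lo v (I.pref v)[i] (g' v (I.pref v)[i]))
      (setCell hi v (I.pref v)[i] (g' v (I.pref v)[i])) := by
  have hfix : ∀ a b, Done a b → g' a b = g a b := by
    intro a b hd
    have h1 := hs.done a b hd
    have h2 := hb a b
    rw [h1.1, h1.2] at h2
    exact le_antisymm h2.2 h2.1
  refine ⟨hc, ?_, ?_, ?_, ?_⟩
  · intro a b
    by_cases hd : Done a b
    · rw [hfix a b hd]; exact hs.bounds₀ a b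
    · rw [← (hs.undone a b hd).1, ← (hs.undone a b hd).2]; exact hb a b
  · intro a b hd
    simp only [setCell]
    split_ifs with hc'
    · rw [hc'.1, hc'.2]; exact ⟨rfl, rfl⟩
    · have hd' := ((hD a b).1 hd).resolve_right hc'
      rw [hfix a b hd']; exact hs.done a b hd'
  · intro a b hd
    rw [hD, not_or] at hd
    simp only [setCell, hd.2, if_false]
    exact hs.undone a b hd.1
  · intro k hk hkb
    rcases hs.max k hk hkb with hagree | ⟨w, j, ⟨hj, heq, hlt⟩, hdone⟩
    · have hkb' : ∀ a b, lo a b ≤ k a b ∧ k a b ≤ hi a b := by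
        intro a b
        by_cases hd : Done a b
        · rw [(hs.done a b hd).1, (hs.done a b hd).2, hagree a b hd]; exact ⟨le_rfl, le_rfl⟩
        · rw [(hs.undone a b hd).1, (hs.undone a b hd).2]; exact hkb a b
      rcases (hmax k hk hkb').lt_or_eq with hlt | heq
      · right
        refine ⟨v, i, ⟨hi', fun j hj => ?_, hlt⟩, fun u hu => ?_⟩
        · have hd := hprev _ (getElem_mem_take hj (hj.trans hi'))
          rw [hfix _ _ hd, hagree _ _ hd]
        · rw [hD]
          rcases (mem_take_succ hi').1 hu with hu | rfl
          · exact .inl (hprev u hu)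
          · exact .inr ⟨rfl, rfl⟩
      · left
        intro a b hd
        rcases (hD a b).1 hd with hd | ⟨rfl, rfl⟩
        · rw [hfix a b hd, hagree a b hd]
        · exact heq
    · right
      refine ⟨w, j, ⟨hj, fun i hi => ?_, ?_⟩, fun u hu => (hD w u).2 (.inl (hdone u hu))⟩
      · rw [hfix _ _ (hdone _ (getElem_mem_take (by omega) (by omega)))]; exact heq i hi
      · rw [hfix _ _ (hdone _ (getElem_mem_take (by omega) hj))]; exact hlt

/-- Lower bounds that keep the improvement `g` on the first arcs that are not frozen. -/
noncomputable def improvedB (I : Market n) (f g : Fin n → Fin n → ℝ) (τ : Fin n → ℕ) :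
    Fin n → Fin n → ℝ :=
  fun v u => if (I.pref v)[τ v]? = some u then g v u else I.lowerB f τ v u

/-! ### Domination and Pareto optimality after the improvement. -/

section final

variable {τ : Fin n → ℕ}

theorem improvedB_bounds (hb : ∀ a b, I.lowerB f τ a b ≤ g a b ∧ g a b ≤ I.upperB f τ a b)
    (a b : Fin n) : I.improvedB f g τ a b ≤ g a b ∧ g a b ≤ I.upperB f τ a b := by
  refine ⟨?_, (hb a b).2⟩
  unfold improvedB
  split_ifs
  · exact le_rfl
  · exact (hb a b).1

/-- Raising the lower bound to g concerns only the arc at index τ a, which lies outside the frozen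
prefix; on the prefix both bounds are f. -/
theorem eq_of_improvedB (hb : ∀ a b, I.improvedB f g τ a b ≤ h a b ∧ h a b ≤ I.upperB f τ a b)
    {a b : Fin n} (hab : b ∈ (I.pref a).take (τ a)) : h a b = f a b := by
  have h1 := hb a b
  unfold improvedB upperB at h1
  have hne : ¬ (I.pref a)[τ a]? = some b := by
    intro hcon
    obtain ⟨hlt, rfl⟩ := List.getElem?_eq_some_iff.1 hcon
    exact getElem_notMem_take (I.pref_nodup a) hlt hab
  have hmem : b ∈ (I.pref a).take (τ a + 1) := by
    rw [List.take_add_one]; exact List.mem_append_left _ hab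
  simp only [hne, hab, if_true, if_false, lowerB, hmem] at h1
  exact le_antisymm h1.2 h1.1

theorem feas_of_improvedB (hf : I.Feas f) (hg : ∀ a b, 0 ≤ g a b) (hc : Circ h)
    (hb : ∀ a b, I.improvedB f g τ a b ≤ h a b ∧ h a b ≤ I.upperB f τ a b) : I.Feas h := by
  refine ⟨hc, fun a b => ?_, fun a b => ?_⟩
  · refine le_trans ?_ (hb a b).1
    unfold improvedB lowerB
    split_ifs
    · exact hg a b
    · exact hf.nonneg a b
    · exact le_rfl
  · refine (hb a b).2.trans ?_
    unfold upperB
    split_ifs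
    · exact hf.le_cap a b
    · exact le_rfl

theorem prefersM_of_improvedB
    (hb : ∀ a b, I.improvedB f g τ a b ≤ h a b ∧ h a b ≤ I.upperB f τ a b)
    (hv : τ v < (I.pref v).length) (hlt : f v (I.pref v)[τ v] < g v (I.pref v)[τ v]) :
    I.PrefersM v h f := by
  refine ⟨τ v, hv, fun i hi => eq_of_improvedB hb (getElem_mem_take hi _), ?_⟩
  refine hlt.trans_le ?_
  have := (hb v (I.pref v)[τ v]).1
  unfold improvedB at this
  simpa [List.getElem?_eq_getElem hv] using this

theorem not_prefersM_of_improvedB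
    (hb : ∀ a b, I.improvedB f g τ a b ≤ h a b ∧ h a b ≤ I.upperB f τ a b)
    (hlt : ∀ v (hv : τ v < (I.pref v).length), f v (I.pref v)[τ v] < g v (I.pref v)[τ v])
    (v : Fin n) : ¬ I.PrefersM v f h := by
  by_cases hv : τ v < (I.pref v).length
  · exact (prefersM_of_improvedB hb hv (hlt v hv)).asymm
  · refine not_prefersM_of_eq fun u hu => (eq_of_improvedB hb ?_).symm
    rwa [List.take_of_length_le (by omega)]

/-- The outcome of the sequential maximization cannot be improved. -/
theorem SeqMax.no_improvement (hF : I.Frozen f τ)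
    (hs : I.SeqMax (I.improvedB f g τ) (I.upperB f τ) Done h lo hi)
    (hD : ∀ v, ∀ u ∈ I.pref v, Done v u)
    (hlt : ∀ v (hv : τ v < (I.pref v).length), f v (I.pref v)[τ v] < g v (I.pref v)[τ v])
    (hk : I.Feas k) (hw : ∀ v, ¬ I.PrefersM v h k) (v : Fin n) : ¬ I.PrefersM v k h := by
  -- Being weakly better than h implies being weakly better than f, so the frozen values bind k as
  -- well.
  have hwf : ∀ v, ¬ I.PrefersM v f k := fun v =>
    not_prefersM_trans (not_prefersM_of_improvedB hs.bounds₀ hlt v) (hw v)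
  have hkb : ∀ a b, I.improvedB f g τ a b ≤ k a b ∧ k a b ≤ I.upperB f τ a b := by
    intro a b
    refine ⟨?_, (hF.bounds hk hwf a b).2⟩
    by_cases hc : (I.pref a)[τ a]? = some b
    · obtain ⟨ha, rfl⟩ := List.getElem?_eq_some_iff.1 hc
      -- On the first open arc, k and h agree with f before it, so k is at least h there, and h is
      -- at least g by the raised bound.
      refine (hs.bounds₀ a _).1.trans (le_of_not_prefersM (hw a) ha fun i hi => ?_)
      have hm := getElem_mem_take hi (hi.trans ha)
      rw [eq_of_improvedB hs.bounds₀ hm, hF k hk hwf a _ hm]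
    · simp only [improvedB, hc, if_false]
      exact (hF.bounds hk hwf a b).1
  rcases hs.max k hk.circ hkb with hagree | ⟨w, j, hp, -⟩
  · exact not_prefersM_of_eq fun u hu => hagree v u (hD v u hu)
  · exact absurd ⟨j, hp⟩ (hw w)

end final

end Market

/-! ### Exchanges and listings of cycles -/

section listings

variable {n : ℕ}

/-- The `i`-th arc of the closed walk through the list `l` is `(v, u)`. -/
abbrev ArcAt (l : List (Fin n)) (i : ℕ) (v u : Fin n) : Prop :=
  l[i]? = some v ∧ l[(i + 1) % l.length]? = some u

/-- The flow on the first `m` arcs of a listed cycle. -/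
noncomputable def cycFlow (x : List (Fin n) × ℝ) (m : ℕ) (v u : Fin n) : ℝ :=
  ∑ i ∈ Finset.range m, if ArcAt x.1 i v u then x.2 else 0

/-- The flow of a list of cycles. -/
noncomputable def listFlow (L : List (List (Fin n) × ℝ)) (v u : Fin n) : ℝ :=
  (L.map fun x => cycFlow x x.1.length v u).sum

theorem listFlow_concat (L : List (List (Fin n) × ℝ)) (x : List (Fin n) × ℝ) (v u : Fin n) :
    listFlow (L ++ [x]) v u = listFlow L v u + cycFlow x x.1.length v u := by
  simp [listFlow]

/-- Rotating the list brings the arc to the front. The length condition excludes a single vertex,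
which `ArcAt` would read as a loop. -/
theorem cycleHasArc_coe_iff {l : List (Fin n)} (hl : 2 ≤ l.length) (v u : Fin n) :
    CycleHasArc (l : Cycle (Fin n)) v u ↔ ∃ i < l.length, ArcAt l i v u := by
  constructor
  · rintro ⟨m, hm⟩
    rw [Cycle.coe_eq_coe] at hm
    obtain ⟨k, hk⟩ := hm
    have h0 : (l.rotate k)[0]? = some v := by rw [hk]; rfl
    have h1 : (l.rotate k)[1]? = some u := by rw [hk]; rfl
    rw [List.getElem?_rotate (by omega)] at h0 h1
    refine ⟨k % l.length, Nat.mod_lt _ (by omega), by simpa using h0, ?_⟩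
    rw [Nat.mod_add_mod, add_comm]; exact h1
  · rintro ⟨i, hi, h0, h1⟩
    have h0' : (l.rotate i)[0]? = some v := by
      rw [List.getElem?_rotate (by omega), zero_add, Nat.mod_eq_of_lt hi]; exact h0
    have h1' : (l.rotate i)[1]? = some u := by
      rw [List.getElem?_rotate (by omega), add_comm]; exact h1
    rcases hr : l.rotate i with _ | ⟨a, _ | ⟨b, m⟩⟩
    · rw [hr] at h0'; simp at h0'
    · rw [hr] at h1'; simp at h1'
    · rw [hr] at h0' h1'
      simp only [List.getElem?_cons_zero, List.getElem?_cons_succ, Option.some.injEq] at h0' h1'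
      subst h0' h1'
      exact ⟨m, Cycle.coe_eq_coe.2 ⟨i, hr⟩⟩

-- Without repeated vertices the tail of an arc determines its index, so at most one summand is
-- nonzero.
open Classical in
theorem cycFlow_eq {l : List (Fin n)} (hl : 2 ≤ l.length) (hnd : l.Nodup) (r : ℝ) (v u : Fin n) :
    cycFlow (l, r) l.length v u = if CycleHasArc (l : Cycle (Fin n)) v u then r else 0 := by
  unfold cycFlow
  rw [cycleHasArc_coe_iff hl]
  split_ifs with h
  · obtain ⟨i, hi, h0, h1⟩ := h
    rw [Finset.sum_eq_single i]
    · exact if_pos ⟨h0, h1⟩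
    · intro j hj hji
      rw [if_neg]
      rintro ⟨h2, -⟩
      rw [Finset.mem_range] at hj
      exact hji ((List.getElem?_inj hj hnd).1 (h2.trans h0.symm))
    · intro hni; exact absurd (Finset.mem_range.2 hi) hni
  · refine Finset.sum_eq_zero fun i hi => if_neg fun hc => h ⟨i, Finset.mem_range.1 hi, hc⟩

theorem isDicycle_coe {r : Fin n → Fin n → Prop} {l : List (Fin n)}
    (h : IsDicycle r (l : Cycle (Fin n))) : l.Nodup ∧ 2 ≤ l.length := by
  have hnd : l.Nodup := Cycle.nodup_coe_iff.1 h.1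
  exact ⟨hnd, (Cycle.nontrivial_coe_nodup_iff hnd).1 h.2.1⟩

theorem IsDicycle.rel_of_hasArc {r : Fin n → Fin n → Prop} {C : Cycle (Fin n)}
    (h : IsDicycle r C) {v u : Fin n} (ha : CycleHasArc C v u) : r v u := by
  obtain ⟨l, rfl⟩ := ha
  have := h.2.2
  rw [Cycle.chain_coe_cons] at this
  simp only [List.cons_append, List.isChain_cons_cons] at this
  exact this.1

/-- A nodup list all of whose cyclic arcs are in `r` is a directed cycle. -/
theorem isDicycle_of_arcs {r : Fin n → Fin n → Prop} {l : List (Fin n)} (hnd : l.Nodup)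
    (hl : 2 ≤ l.length) (h : ∀ i < l.length, ∀ v u, ArcAt l i v u → r v u) :
    IsDicycle r (l : Cycle (Fin n)) := by
  refine ⟨Cycle.nodup_coe_iff.2 hnd, (Cycle.nontrivial_coe_nodup_iff hnd).2 hl, ?_⟩
  rcases l with _ | ⟨a, m⟩
  · simp at hl
  · rw [Cycle.chain_coe_cons, List.isChain_iff_getElem]
    intro i hi
    simp only [List.length_cons, List.length_append, List.length_nil] at hi
    refine h i (by simp; omega) _ _ ⟨?_, ?_⟩
    · have : (a :: (m ++ [a]))[i] = (a :: m)[i]'(by simp; omega) := by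
        have : a :: (m ++ [a]) = (a :: m) ++ [a] := rfl
        simp only [this]
        rw [List.getElem_append_left]
      rw [this, List.getElem?_eq_getElem]
    · by_cases him : i + 1 < (a :: m).length
      · rw [Nat.mod_eq_of_lt him]
        have : (a :: (m ++ [a]))[i + 1] = (a :: m)[i + 1] := by
          have : a :: (m ++ [a]) = (a :: m) ++ [a] := rfl
          simp only [this]
          rw [List.getElem_append_left]
        rw [this, List.getElem?_eq_getElem]
      · have h1 : i = m.length := by simp at him; omega
        subst h1
        simp

theorem sum_cycFlow_out (x : List (Fin n) × ℝ) (v : Fin n) :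
    ∑ u, cycFlow x x.1.length v u =
      ∑ i ∈ Finset.range x.1.length, if x.1[i]? = some v then x.2 else 0 := by
  unfold cycFlow
  rw [Finset.sum_comm]
  refine Finset.sum_congr rfl fun i hi => ?_
  have hlt : (i + 1) % x.1.length < x.1.length :=
    Nat.mod_lt _ (by rw [Finset.mem_range] at hi; omega)
  simp only [ArcAt, List.getElem?_eq_getElem hlt, Option.some.injEq]
  by_cases h : x.1[i]? = some v <;> simp [h]

theorem sum_cycFlow_in (x : List (Fin n) × ℝ) (v : Fin n) :
    ∑ u, cycFlow x x.1.length u v =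
      ∑ i ∈ Finset.range x.1.length, if x.1[(i + 1) % x.1.length]? = some v then x.2 else 0 := by
  unfold cycFlow
  rw [Finset.sum_comm]
  refine Finset.sum_congr rfl fun i hi => ?_
  rw [Finset.mem_range] at hi
  simp only [ArcAt, List.getElem?_eq_getElem hi, Option.some.injEq]
  by_cases h : x.1[(i + 1) % x.1.length]? = some v <;> simp [h]

theorem sum_range_rotate (m : ℕ) (F : ℕ → ℝ) :
    ∑ i ∈ Finset.range m, F ((i + 1) % m) = ∑ i ∈ Finset.range m, F i := by
  rcases m with _ | m
  · simp
  · rw [Finset.sum_range_succ, Finset.sum_range_succ']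
    simp only [Nat.mod_self]
    congr 1
    refine Finset.sum_congr rfl fun i hi => ?_
    rw [Finset.mem_range] at hi
    rw [Nat.mod_eq_of_lt (by omega)]

/-- For each closed walk, outflow and inflow are the same sum up to a cyclic shift of the index. -/
theorem circ_listFlow (L : List (List (Fin n) × ℝ)) : Circ (listFlow L) := by
  induction L with
  | nil => intro v; simp [listFlow]
  | cons x L ih =>
    intro v
    have h1 : ∀ v u, listFlow (x :: L) v u = cycFlow x x.1.length v u + listFlow L v u :=
      fun v u => by simp [listFlow]
    simp only [h1, Finset.sum_add_distrib]
    rw [ih v, sum_cycFlow_out, sum_cycFlow_in,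
      sum_range_rotate x.1.length fun i => if x.1[i]? = some v then x.2 else 0]

/-! ### Exchanges as feasible flow matrices. -/

namespace Exchange

variable {I : Market n}

open Classical in
theorem ListedBy.flow_eq {E : Exchange I} {L : List (List (Fin n) × ℝ)} (h : E.ListedBy L)
    (v u : Fin n) : E.flow v u = listFlow L v u := by
  have hp : E.packing = (L.map (fun x => (x.1 : Cycle (Fin n)))).toFinset := by
    ext C
    rw [h.2.1 C]; simp
  unfold flow arcFlow listFlow
  rw [Finset.sum_filter, hp, List.sum_toFinset _ h.1, List.map_map]
  congr 1
  refine List.map_congr_left fun x hx => ?_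
  have hd := isDicycle_coe (E.isDicycle _ ((h.2.1 _).2 ⟨x, hx, rfl⟩))
  simp only [Function.comp_apply]
  rw [h.2.2 x hx, show x = (x.1, x.2) from rfl, cycFlow_eq hd.2 hd.1]

theorem exists_listedBy (E : Exchange I) : ∃ L, E.ListedBy L := by
  obtain ⟨rep, hrep⟩ : ∃ rep : Cycle (Fin n) → List (Fin n), ∀ C, (rep C : Cycle (Fin n)) = C :=
    ⟨fun C => Quotient.out C, fun C => Quotient.out_eq C⟩
  refine ⟨E.packing.toList.map fun C => (rep C, E.f C), ?_, ?_, ?_⟩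
  · rw [List.map_map]
    have : ((fun x : List (Fin n) × ℝ => (x.1 : Cycle (Fin n))) ∘
        fun C : Cycle (Fin n) => (rep C, E.f C)) = id := by
      funext C
      exact hrep C
    rw [this, List.map_id]
    exact Finset.nodup_toList _
  · intro C
    constructor
    · intro hC
      exact ⟨_, List.mem_map.2 ⟨C, Finset.mem_toList.2 hC, rfl⟩, hrep C⟩
    · rintro ⟨x, hx, rfl⟩
      obtain ⟨C, hC, rfl⟩ := List.mem_map.1 hx
      rw [hrep]; exact Finset.mem_toList.1 hC
  · intro x hx
    obtain ⟨C, hC, rfl⟩ := List.mem_map.1 hx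
    simp only [hrep]

/-- Conservation is read off an arbitrary listing; outside the market arcs the flow vanishes because
no packed cycle uses such a pair. -/
theorem flow_feas (E : Exchange I) : I.Feas E.flow := by
  classical
  have hnn : ∀ v u, 0 ≤ E.flow v u := fun v u =>
    Finset.sum_nonneg fun C hC => (E.f_pos C (Finset.mem_filter.1 hC).1).le
  refine ⟨?_, hnn, ?_⟩
  · obtain ⟨L, hL⟩ := E.exists_listedBy
    have : E.flow = listFlow L := by funext v u; exact hL.flow_eq v u
    rw [this]; exact circ_listFlow L
  · intro v u
    unfold Market.capM
    split_ifs with h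
    · exact E.flow_le_cap v u h
    · refine (Finset.sum_eq_zero fun C hC => ?_).le
      rw [Finset.mem_filter] at hC
      exact absurd ((E.isDicycle C hC.1).rel_of_hasArc hC.2) h

theorem prefers_iff (v : Fin n) (E E' : Exchange I) :
    Prefers v E E' ↔ I.PrefersM v E.flow E'.flow := Iff.rfl

/-- Build an exchange from a list of cycles. -/
theorem exists_of_list (L : List (List (Fin n) × ℝ))
    (hnd : (L.map (fun x => (x.1 : Cycle (Fin n)))).Nodup)
    (hcyc : ∀ x ∈ L, IsDicycle I.Arc (x.1 : Cycle (Fin n))) (hpos : ∀ x ∈ L, 0 < x.2)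
    (hcap : ∀ v u, I.Arc v u → listFlow L v u ≤ I.cap v u) :
    ∃ E : Exchange I, E.ListedBy L := by
  classical
  have hex : ∃ f : Cycle (Fin n) → ℝ, ∀ x ∈ L, f (x.1 : Cycle (Fin n)) = x.2 := by
    refine ⟨fun C => if h : ∃ x ∈ L, (x.1 : Cycle (Fin n)) = C then h.choose.2 else 0, ?_⟩
    intro x hx
    have h : ∃ y ∈ L, (y.1 : Cycle (Fin n)) = x.1 := ⟨x, hx, rfl⟩
    simp only [h, dif_pos]
    have := List.inj_on_of_nodup_map hnd h.choose_spec.1 hx h.choose_spec.2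
    rw [this]
  obtain ⟨f, hf⟩ := hex
  set P : Finset (Cycle (Fin n)) := (L.map (fun x => (x.1 : Cycle (Fin n)))).toFinset with hP
  have hmem : ∀ C, C ∈ P ↔ ∃ x ∈ L, (x.1 : Cycle (Fin n)) = C := by intro C; simp [hP]
  have hflow : ∀ v u, arcFlow P f v u = listFlow L v u := by
    intro v u
    unfold arcFlow listFlow
    rw [Finset.sum_filter, hP, List.sum_toFinset _ hnd, List.map_map]
    congr 1
    refine List.map_congr_left fun x hx => ?_
    have hd := isDicycle_coe (hcyc x hx)
    simp only [Function.comp_apply]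
    rw [hf x hx, show x = (x.1, x.2) from rfl, cycFlow_eq hd.2 hd.1]
  refine ⟨⟨P, f, ?_, ?_, ?_⟩, hnd, hmem, hf⟩
  · intro C hC
    obtain ⟨x, hx, rfl⟩ := (hmem C).1 hC
    exact hcyc x hx
  · intro C hC
    obtain ⟨x, hx, rfl⟩ := (hmem C).1 hC
    rw [hf x hx]; exact hpos x hx
  · intro v u hvu
    rw [hflow]; exact hcap v u hvu

end Exchange

end listings

/-! ### Reading the input -/

namespace RealRAM

variable {n : ℕ} {I : Market n} {L : List (List (Fin n) × ℝ)}

/-- The market is stored in the input arrays. -/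
structure HasMarket (I : Market n) (σ : State) : Prop where
  size : σ.nv 0 = n
  deg : ∀ v : Fin n, σ.na 0 v 0 = (I.pref v).length
  pref : ∀ (v : Fin n) (i : ℕ) (hi : i < (I.pref v).length), σ.na 1 v i = ((I.pref v)[i] : Fin n)
  cap : mat n σ 0 = I.capM

/-- The listing is stored in the input arrays. -/
structure HasList (L : List (List (Fin n) × ℝ)) (σ : State) : Prop where
  count : σ.nv 1 = L.length
  len : ∀ (k : ℕ) (hk : k < L.length), σ.na 2 k 0 = L[k].1.length
  vert : ∀ (k : ℕ) (hk : k < L.length) (i : ℕ) (hi : i < L[k].1.length),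
    σ.na 3 k i = (L[k].1[i] : Fin n)
  amount : ∀ (k : ℕ) (hk : k < L.length), σ.ra 1 k 0 = L[k].2

theorem hasMarket_inputState : HasMarket I (inputState I L) where
  size := by simp [inputState]
  deg v := by simp [inputState]
  pref v i hi := by simp [inputState, hi]
  cap := by funext v u; simp [inputState, mat, Market.capM]

theorem hasList_inputState : HasList L (inputState I L) where
  count := by simp [inputState]
  len k hk := by simp [inputState, hk]
  vert k hk i hi := by simp [inputState, hk, hi]
  amount k hk := by simp [inputState, hk]

theorem HasMarket.congr {σ σ' : State} (h : HasMarket I σ) (h1 : σ'.nv 0 = σ.nv 0)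
    (h2 : σ'.na 0 = σ.na 0) (h3 : σ'.na 1 = σ.na 1) (h4 : σ'.ra 0 = σ.ra 0) : HasMarket I σ' where
  size := h1.trans h.size
  deg v := by rw [h2]; exact h.deg v
  pref v i hi := by rw [h3]; exact h.pref v i hi
  cap := by rw [mat_congr h4]; exact h.cap

theorem HasMarket.frame {s : Stmt} {σ σ' : State} (h : HasMarket I σ) (hF : Frame s σ σ')
    (h1 : s.wrNV 0 = false := by rfl) (h2 : s.wrNA 0 = false := by rfl)
    (h3 : s.wrNA 1 = false := by rfl) (h4 : s.wrRA 0 = false := by rfl) : HasMarket I σ' :=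
  h.congr (hF.nv 0 h1) (hF.na 0 h2) (hF.na 1 h3) (hF.ra 0 h4)

theorem HasList.congr {σ σ' : State} (h : HasList L σ) (h1 : σ'.nv 1 = σ.nv 1)
    (h2 : σ'.na 2 = σ.na 2) (h3 : σ'.na 3 = σ.na 3) (h4 : σ'.ra 1 = σ.ra 1) : HasList L σ' where
  count := h1.trans h.count
  len k hk := by rw [h2]; exact h.len k hk
  vert k hk i hi := by rw [h3]; exact h.vert k hk i hi
  amount k hk := by rw [h4]; exact h.amount k hk

theorem HasList.frame {s : Stmt} {σ σ' : State} (h : HasList L σ) (hF : Frame s σ σ')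
    (h1 : s.wrNV 1 = false := by rfl) (h2 : s.wrNA 2 = false := by rfl)
    (h3 : s.wrNA 3 = false := by rfl) (h4 : s.wrRA 1 = false := by rfl) : HasList L σ' :=
  h.congr (hF.nv 1 h1) (hF.na 2 h2) (hF.na 3 h3) (hF.ra 1 h4)

theorem pref_length_le (I : Market n) (v : Fin n) : (I.pref v).length ≤ n := by
  simpa using (I.pref_nodup v).length_le_card

/-- Add the amounts of all listed cycles to the array `6`. -/
def sumCycles : Stmt :=
  forLoop 13 (.var 1) (forLoop 14 (.get 2 (.var 13) (.const 0))
    (.setNV 9 (.get 3 (.var 13) (.var 14)) ;;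
    .ite (.nle (.get 2 (.var 13) (.const 0)) (.add (.var 14) (.const 1)))
      (.setNV 11 (.get 3 (.var 13) (.const 0)))
      (.setNV 11 (.get 3 (.var 13) (.add (.var 14) (.const 1)))) ;;
    .setRA 6 (.var 9) (.var 11)
      (.add (.get 6 (.var 9) (.var 11)) (.get 1 (.var 13) (.const 0)))))

theorem sumCycles_spec {σ : State} {B : ℕ} (hK : L.length ≤ B) (hB : n ≤ B)
    (hnd : ∀ x ∈ L, x.1.Nodup) (hL : HasList L σ) (h6 : ∀ v u, mat n σ 6 v u = 0) :
    Runs sumCycles σ (forTime B (forTime B 4)) (fun σ' => mat n σ' 6 = listFlow L) := by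
  refine Runs.for_loop L.length hK (fun k σ' => mat n σ' 6 = listFlow (L.take k)) rfl ?_
    (fun i σ' hF _ => by simpa using (hL.frame hF).count) ?_
    (fun σ' _ h => by rwa [List.take_length] at h)
  · funext v u; simpa [listFlow] using h6 v u
  intro k hk σ₁ hF₁ hJ₁ hv₁
  have hL₁ : HasList L σ₁ := hL.frame hF₁
  have hlen : L[k].1.length ≤ B := by
    refine le_trans ?_ hB
    simpa using (hnd _ (List.getElem_mem hk)).length_le_card
  refine Runs.for_loop L[k].1.length hlen
    (fun i σ' => ∀ v u, mat n σ' 6 v u = listFlow (L.take k) v u + cycFlow L[k] i v u) rfl ?_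
    (fun i σ' hF _ => ?_) ?_ ?_
  · intro v u; rw [mat_putNV, hJ₁]; simp [cycFlow]
  · have := hF.nv 13 rfl
    simpa [this, hv₁] using (hL₁.frame hF).len k hk
  · intro i hi σ₂ hF₂ hJ₂ hv₂
    have hL₂ : HasList L σ₂ := hL₁.frame hF₂
    have h13 : σ₂.nv 13 = k := (hF₂.nv 13 rfl).trans hv₁
    have hpos : 0 < L[k].1.length := by omega
    have hmod : (i + 1) % L[k].1.length < L[k].1.length := Nat.mod_lt _ hpos
    set x := L[k].1[i] with hx
    set y := L[k].1[(i + 1) % L[k].1.length] with hy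
    have hxv : σ₂.na 3 k i = x := hL₂.vert k hk i hi
    have hyv : σ₂.na 3 k ((i + 1) % L[k].1.length) = y := hL₂.vert k hk _ hmod
    have hlen := hL₂.len k hk
    -- Both branches put the vertex at index i + 1 modulo the length into register 11; only the
    -- addition remains.
    have key : ∀ σ₃ : State, σ₃.nv 9 = x → σ₃.nv 11 = y → σ₃.nv 13 = k → σ₃.ra = σ₂.ra →
        Runs (.setRA 6 (.var 9) (.var 11)
          (.add (.get 6 (.var 9) (.var 11)) (.get 1 (.var 13) (.const 0)))) σ₃ 1
        (fun σ' => ∀ v u, mat n σ' 6 v u = listFlow (L.take k) v u + cycFlow L[k] (i + 1) v u) := by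
      intro σ₃ h9 h11 h13 hra
      refine Runs.setRA ?_
      simp only [NExp.eval, RExp.eval, h9, h11, h13, hra, hL₂.amount k hk]
      rw [mat_putRA_same, mat_congr (σ := σ₂) (congrFun hra 6)]
      intro v u
      have hcell : (ArcAt L[k].1 i v u) ↔ (v = x ∧ u = y) := by
        rw [ArcAt, List.getElem?_eq_getElem hi, List.getElem?_eq_getElem hmod,
          Option.some.injEq, Option.some.injEq, ← hx, ← hy, eq_comm, @eq_comm _ y]
      unfold cycFlow
      rw [Finset.sum_range_succ, ← add_assoc]
      have := hJ₂ v u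
      unfold cycFlow at this
      rw [← this]
      simp only [hcell, setCell]
      split_ifs with hc
      · rw [hc.1, hc.2]; rfl
      · simp
    refine Runs.mono (T := 1 + (max 1 1 + 1 + 1)) ?_ (by simp) (fun σ' _ h _ => h)
    refine Runs.setNV_seq (Runs.seq (Runs.ite (fun hb => Runs.setNV fun _ => ?_)
      (fun hb => Runs.setNV fun _ => ?_)))
    · simp only [BExp.Holds, NExp.eval, putNV_nv, putNV_na] at hb
      norm_num [h13, hv₂, hlen] at hb
      have he : i + 1 = L[k].1.length := by omega
      rw [he, Nat.mod_self] at hyv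
      refine key _ ?_ ?_ ?_ rfl <;> simp [h13, hv₂, hxv, hyv]
    · simp only [BExp.Holds, NExp.eval, putNV_nv, putNV_na] at hb
      norm_num [h13, hv₂, hlen] at hb
      rw [Nat.mod_eq_of_lt hb] at hyv
      refine key _ ?_ ?_ ?_ rfl <;> simp [h13, hv₂, hxv, hyv]
  · intro σ₂ hF₂ h _
    funext v u
    rw [mat_putNV, h, List.take_add_one, List.getElem?_eq_getElem hk, Option.toList_some,
      listFlow_concat]

/-- Copy the real array `b` to the real array `a`. -/
def copyMat (a b : ℕ) : Stmt :=
  forLoop 7 (.var 0) (forLoop 8 (.var 0)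
    (.setRA a (.var 7) (.var 8) (.get b (.var 7) (.var 8))))

theorem copyMat_spec {σ : State} {B a b : ℕ} (hab : (b == a) = false) (hB : n ≤ B)
    (hn : σ.nv 0 = n) :
    Runs (copyMat a b) σ (forTime B (forTime B 1)) (fun σ' => mat n σ' a = mat n σ b) := by
  have hw : (copyMat a b).wrRA b = false := by
    simp only [copyMat, forLoop, Stmt.wrRA, hab, Bool.or_self]
  refine Runs.for_loop n hB
    (fun i σ' => ∀ x y : Fin n, (x : ℕ) < i → mat n σ' a x y = mat n σ b x y) rfl (by simp)
    (fun i σ' hF _ => by simp [hF.nv 0 rfl, hn]) ?_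
    (fun σ' _ h => by funext x y; exact h x y x.isLt)
  intro i hi σ₁ hF₁ hJ₁ hv₁
  refine Runs.for_loop n hB
    (fun j σ' => ∀ x y : Fin n, (x : ℕ) < i ∨ (x : ℕ) = i ∧ (y : ℕ) < j →
      mat n σ' a x y = mat n σ b x y) rfl ?_
    (fun i σ' hF _ => by simp [hF.nv 0 rfl, hF₁.nv 0 rfl, hn]) ?_ ?_
  · intro x y hxy
    exact hJ₁ x y (by omega)
  · intro j hj σ₂ hF₂ hJ₂ hv₂
    refine Runs.setRA fun _ x y hxy => ?_
    have h7 : σ₂.nv 7 = i := (hF₂.nv 7 rfl).trans hv₁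
    have hb : mat n σ₂ b = mat n σ b :=
      (mat_congr (hF₂.ra b (by simp only [forLoop, Stmt.wrRA, hab, Bool.or_self]))).trans (mat_congr (hF₁.ra b hw))
    simp only [NExp.eval, RExp.eval, h7, hv₂, mat_putNV]
    rw [mat_putRA_same (n := n) σ₂ a ⟨i, hi⟩ ⟨j, hj⟩]
    simp only [setCell]
    split_ifs with hc
    · rw [← hb, hc.1, hc.2]; rfl
    · refine hJ₂ x y ?_
      simp only [Fin.ext_iff] at hc
      omega
  · intro σ₂ _ h _ x y hxy
    exact h x y (by have := y.isLt; omega)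

/-- Store the flow on the best arc of every agent as its lower bound. -/
def initLower : Stmt :=
  forLoop 13 (.var 0)
    (.ite (.nle (.const 1) (.get 0 (.var 13) (.const 0)))
      (.setRA 4 (.var 13) (.get 1 (.var 13) (.const 0))
        (.get 6 (.var 13) (.get 1 (.var 13) (.const 0))))
      .skip)

theorem initLower_spec {σ : State} {B : ℕ} (hB : n ≤ B) (hI : HasMarket I σ)
    (h4 : ∀ v u, mat n σ 4 v u = 0) :
    Runs initLower σ (forTime B 2) (fun σ' => mat n σ' 4 = I.lowerB (mat n σ 6) 0) := by
  refine Runs.for_loop n hB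
    (fun i σ' => ∀ v u : Fin n, mat n σ' 4 v u =
      if (v : ℕ) < i then I.lowerB (mat n σ 6) 0 v u else 0) rfl (by simpa using h4)
    (fun i σ' hF _ => by simp [hF.nv 0 rfl, hI.size]) ?_
    (fun σ' _ h => by funext x y; simpa using h x y)
  intro i hi σ₁ hF₁ hJ₁ hv₁
  have hI₁ := hI.frame hF₁
  have hd := hI₁.deg ⟨i, hi⟩
  refine Runs.mono (T := max 1 1 + 1) (Runs.ite (fun hb => Runs.setRA fun _ => ?_)
    (fun hb => Runs.skip fun _ => ?_)) (by simp) (fun _ _ h => h)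
  · simp only [BExp.Holds, NExp.eval, hv₁] at hb
    simp only [] at hd
    rw [hd] at hb
    have hp := hI₁.pref ⟨i, hi⟩ 0 hb
    simp only [] at hp
    have h6 : mat n σ₁ 6 = mat n σ 6 := mat_congr (hF₁.ra 6 rfl)
    intro v u
    simp only [NExp.eval, RExp.eval, hv₁, hp, mat_putNV]
    rw [mat_putRA_same (n := n) σ₁ 4 ⟨i, hi⟩]
    simp only [setCell]
    split_ifs with hc hlt hlt
    · obtain ⟨rfl, rfl⟩ := hc
      rw [← h6]
      have hm : (I.pref ⟨i, hi⟩)[0] ∈ (I.pref ⟨i, hi⟩).take 1 := Market.getElem_mem_take (by simp) hb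
      simp [Market.lowerB, hm, mat]
    · simp [hc.1] at hlt
    · rw [hJ₁]
      by_cases hvi : (v : ℕ) < i
      · simp [hvi]
      · have hv : v = ⟨i, hi⟩ := Fin.ext (by simp only []; omega)
        subst hv
        have hu : u ∉ (I.pref ⟨i, hi⟩).take (0 + 1) := by
          rw [Market.mem_take_succ hb]
          simpa using hc
        simp [Market.lowerB] at hu ⊢
        intro h; exact absurd h hu
    · rw [hJ₁, if_neg (by omega)]
  · simp only [BExp.Holds, NExp.eval, hv₁] at hb
    simp only [] at hd
    rw [hd] at hb
    intro v u
    rw [mat_putNV, hJ₁]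
    by_cases hvi : (v : ℕ) < i
    · simp [hvi, hvi.trans (Nat.lt_succ_self i)]
    · by_cases hv : v = ⟨i, hi⟩
      · subst hv
        have : I.pref ⟨i, hi⟩ = [] := List.length_eq_zero_iff.1 (by omega)
        simp [Market.lowerB, this]
      · have : (v : ℕ) ≠ i := fun h => hv (Fin.ext h)
        rw [if_neg hvi, if_neg (by omega)]

end RealRAM

/-! ### Finding the first arcs that can be improved -/

namespace RealRAM

variable {n : ℕ} {I : Market n}

/-- Increment register `13`. -/
def nextAgent : Stmt := .setNV 13 (.add (.var 13) (.const 1))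

/-- The agent in register `13` has no further arc. -/
def exhausted : BExp := .nle (.get 0 (.var 13) (.const 0)) (.get 8 (.var 13) (.const 0))

/-- Fix the flow on the arc from register `13` to register `15`, pass to the next arc of this
agent, and start again. -/
def freezeArc : Stmt :=
  .setRA 5 (.var 13) (.var 15) (.get 6 (.var 13) (.var 15)) ;;
  .setNA 8 (.var 13) (.const 0) (.add (.get 8 (.var 13) (.const 0)) (.const 1)) ;;
  .ite exhausted .skip
    (.setNV 15 (.get 1 (.var 13) (.get 8 (.var 13) (.const 0))) ;;
      .setRA 4 (.var 13) (.var 15) (.get 6 (.var 13) (.var 15))) ;;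
  copyMat 3 6 ;;
  .setNV 13 (.const 0)

/-- Try to improve the flow on the arc from register `13` to register `15`. -/
def tryArc : Stmt :=
  .setNV 4 (.var 15) ;; .setNV 5 (.var 13) ;;
  .setRV 0 (.sub (.get 5 (.var 13) (.var 15)) (.get 3 (.var 13) (.var 15))) ;;
  search ;;
  .ite (.and (.not (.rle (.var 0) rzero)) (.not (.nle (.var 0) (.get 6 (.var 5) (.const 0)))))
    (augment (1 / 2) ;;
      .setRA 3 (.var 13) (.var 15) (.add (.get 3 (.var 13) (.var 15)) (.var 0)) ;;
      nextAgent)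
    freezeArc

def topStep : Stmt :=
  .ite exhausted nextAgent
    (.setNV 15 (.get 1 (.var 13) (.get 8 (.var 13) (.const 0))) ;;
    .ite (.not (.rle (.get 3 (.var 13) (.var 15)) (.get 4 (.var 13) (.var 15))))
      nextAgent tryArc)

/-- Find for every agent the first arc on which a weakly better flow can differ, and a flow that is
strictly better on all these arcs. -/
def findTops : Stmt :=
  .setNV 13 (.const 0) ;;
  .while (.not (.nle (.var 0) (.var 13))) topStep

/-- The data of the invariant of `findTops` that refer to the flow and its bounds. -/
structure Within (I : Market n) (f : Fin n → Fin n → ℝ) (σ : State) : Prop where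
  market : HasMarket I σ
  orig : mat n σ 6 = f
  le_deg : ∀ v, vec n σ 8 v ≤ (I.pref v).length
  lower : mat n σ 4 = I.lowerB f (vec n σ 8)
  upper : mat n σ 5 = I.upperB f (vec n σ 8)
  frozen : I.Frozen f (vec n σ 8)
  circ : Circ (mat n σ 3)
  bounds : ∀ a b, mat n σ 4 a b ≤ mat n σ 3 a b ∧ mat n σ 3 a b ≤ mat n σ 5 a b

/-- The flow is strictly better than `f` on the first arc of `v` that is not frozen. -/
def Improved (I : Market n) (f : Fin n → Fin n → ℝ) (σ : State) (v : Fin n) : Prop :=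
  ∀ u, (I.pref v)[vec n σ 8 v]? = some u → f v u < mat n σ 3 v u

/-- The number of arcs that are not frozen. -/
def openArcs (I : Market n) (τ : Fin n → ℕ) : ℕ := ∑ v, ((I.pref v).length - τ v)

structure TopInv (I : Market n) (f : Fin n → Fin n → ℝ) (k : ℕ) (σ : State) : Prop where
  within : Within I f σ
  cur_le : σ.nv 13 ≤ n
  improved : ∀ w : Fin n, (w : ℕ) < σ.nv 13 → Improved I f σ w
  count : (n + 1) * openArcs I (vec n σ 8) + (n - σ.nv 13) ≤ k

variable {f : Fin n → Fin n → ℝ}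

theorem Within.congr {σ σ' : State} (h : Within I f σ) (h1 : HasMarket I σ')
    (h6 : mat n σ' 6 = mat n σ 6) (h8 : vec n σ' 8 = vec n σ 8) (h3 : mat n σ' 3 = mat n σ 3)
    (h4 : mat n σ' 4 = mat n σ 4) (h5 : mat n σ' 5 = mat n σ 5) : Within I f σ' := by
  constructor
  · exact h1
  · rw [h6]; exact h.orig
  · rw [h8]; exact h.le_deg
  · rw [h4, h8]; exact h.lower
  · rw [h5, h8]; exact h.upper
  · rw [h8]; exact h.frozen
  · rw [h3]; exact h.circ
  · rw [h3, h4, h5]; exact h.bounds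

theorem nextAgent_spec {σ : State} {k : ℕ} {v : Fin n} (hJ : TopInv I f k σ) (h13 : σ.nv 13 = v)
    (hv : Improved I f σ v) :
    Runs nextAgent σ 1 (fun σ' => ∃ k' < k, TopInv I f k' σ') := by
  have hlt := v.isLt
  have hc := hJ.count
  refine Runs.setNV ⟨k - 1, by omega, ?_⟩
  refine ⟨hJ.within.congr (hJ.within.market.congr rfl rfl rfl rfl) rfl rfl rfl rfl rfl, ?_, ?_, ?_⟩
  · simp [h13]
  · intro w hw
    simp only [NExp.eval, putNV_nv, if_true, h13] at hw
    rcases Nat.lt_succ_iff_lt_or_eq.1 hw with hw | hw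
    · exact hJ.improved w (by omega)
    · obtain rfl : w = v := Fin.ext hw
      exact hv
  · simp only [NExp.eval, putNV_nv, if_true, h13, vec_putNV]
    omega

theorem openArcs_update {τ : Fin n → ℕ} {v : Fin n} (hv : τ v < (I.pref v).length) :
    openArcs I (Function.update τ v (τ v + 1)) < openArcs I τ := by
  refine Finset.sum_lt_sum (fun w _ => ?_) ⟨v, Finset.mem_univ v, ?_⟩
  · by_cases hw : w = v
    · subst hw; simp only [Function.update_self]; omega
    · rw [Function.update_of_ne hw]
  · simp only [Function.update_self]; omega

def freezeArcTime (B : ℕ) : ℕ := 1 + (1 + (max 1 (1 + 1) + 1 + (forTime B (forTime B 1) + 1)))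

/-- The next arc of v receives the lower bound f, which the current circulation may violate, so the
search restarts from f itself. One open arc fewer lowers the count by n + 1, which outweighs
resetting the agent counter. -/
theorem freezeArc_spec {σ : State} {B k : ℕ} {v : Fin n} (hB : n ≤ B) (hf : I.Feas f)
    (hJ : TopInv I f k σ) (h13 : σ.nv 13 = v) (hv : vec n σ 8 v < (I.pref v).length)
    (h15 : σ.nv 15 = (I.pref v)[vec n σ 8 v])
    (hmax : MaxOn f (mat n σ 4) (mat n σ 5) v (I.pref v)[vec n σ 8 v]) :
    Runs freezeArc σ (freezeArcTime B) (fun σ' => ∃ k' < k, TopInv I f k' σ') := by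
  have hW := hJ.within
  have h8 : σ.na 8 v 0 = vec n σ 8 v := rfl
  have hf6 : ∀ u : Fin n, σ.ra 6 v u = f v u := fun u => congrFun (congrFun hW.orig v) u
  refine Runs.setRA_seq (Runs.setNA_seq ?_)
  simp only [NExp.eval, RExp.eval, putRA_nv, putRA_na, h13, h15, h8, hf6]
  set τ := vec n σ 8 with hτ
  set u := (I.pref v)[τ v] with hu
  set σ₁ := (σ.putRA 5 v u (f v u)).putNA 8 v 0 (τ v + 1) with hσ₁
  set τ' := Function.update τ v (τ v + 1) with hτ'
  have e8 : vec n σ₁ 8 = τ' := by rw [hσ₁, vec_putNA_same]; rfl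
  have e5 : mat n σ₁ 5 = I.upperB f τ' := by
    rw [hσ₁, mat_putNA, mat_putRA_same, hW.upper, hτ', Market.upperB_succ hv]
  have e4 : mat n σ₁ 4 = I.lowerB f τ := by
    rw [hσ₁, mat_putNA, mat_putRA_ne _ _ _ _ (by norm_num), hW.lower]
  have e6 : mat n σ₁ 6 = f := by
    rw [hσ₁, mat_putNA, mat_putRA_ne _ _ _ _ (by norm_num), hW.orig]
  have hI₁ : HasMarket I σ₁ := by
    refine hW.market.congr rfl ?_ ?_ ?_ <;> (funext i j; simp [hσ₁])
  have hfr : I.Frozen f τ' := by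
    refine hW.frozen.succ hv ?_
    rw [← hW.lower, ← hW.upper]; exact hmax
  have hdeg : ∀ w, τ' w ≤ (I.pref w).length := by
    intro w
    by_cases hw : w = v
    · subst hw; rw [hτ', Function.update_self]; exact hv
    · rw [hτ', Function.update_of_ne hw]; exact hW.le_deg w
  have hcount : (n + 1) * openArcs I τ' + n < k := by
    have h1 := openArcs_update (I := I) hv
    have h2 := hJ.count
    rw [← hτ] at h2
    have h3 : (n + 1) * (openArcs I τ' + 1) ≤ (n + 1) * openArcs I τ := Nat.mul_le_mul_left _ h1
    rw [Nat.mul_add] at h3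
    omega
  have h8₁ : σ₁.na 8 v 0 = τ v + 1 := by simp [hσ₁]
  have h13₁ : σ₁.nv 13 = v := h13
  have hd₁ := hI₁.deg v
  -- Common tail of the cases in which v has a further arc or none.
  have key : ∀ σ₂ : State, HasMarket I σ₂ → mat n σ₂ 6 = f → vec n σ₂ 8 = τ' →
      mat n σ₂ 4 = I.lowerB f τ' → mat n σ₂ 5 = I.upperB f τ' →
      Runs (copyMat 3 6 ;; .setNV 13 (.const 0)) σ₂ (forTime B (forTime B 1) + 1)
        (fun σ' => ∃ k' < k, TopInv I f k' σ') := by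
    intro σ₂ hI₂ h6 h8 h4 h5
    refine Runs.seq ((copyMat_spec (n := n) rfl hB hI₂.size).imp fun σ₃ hF₃ hcopy _ => ?_)
    have m4 : mat n σ₃ 4 = I.lowerB f τ' := (mat_congr (hF₃.ra 4 rfl)).trans h4
    have m5 : mat n σ₃ 5 = I.upperB f τ' := (mat_congr (hF₃.ra 5 rfl)).trans h5
    have m6 : mat n σ₃ 6 = f := (mat_congr (hF₃.ra 6 rfl)).trans h6
    have v8 : vec n σ₃ 8 = τ' := (vec_congr (hF₃.na 8 rfl)).trans h8
    have m3 : mat n σ₃ 3 = f := hcopy.trans h6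
    refine Runs.setNV ⟨k - 1, by omega, ⟨?_, ?_, ?_, ?_, ?_, ?_, ?_, ?_⟩, by simp, by simp, ?_⟩
    · exact (hI₂.frame hF₃).congr rfl rfl rfl rfl
    · exact m6
    · rw [vec_putNV, v8]; exact hdeg
    · rw [mat_putNV, vec_putNV, v8]; exact m4
    · rw [mat_putNV, vec_putNV, v8]; exact m5
    · rw [vec_putNV, v8]; exact hfr
    · rw [mat_putNV, m3]; exact hf.circ
    · simp only [mat_putNV, m3, m4, m5]; exact hf.self_bounds τ'
    · simp only [vec_putNV, v8, NExp.eval, putNV_nv, if_true]; omega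
  refine Runs.seq (Runs.ite (fun hb => Runs.skip fun _ => ?_)
    (fun hb => Runs.setNV_seq (Runs.setRA fun _ => ?_)))
  · simp only [exhausted, BExp.Holds, NExp.eval, h13₁, h8₁, hd₁] at hb
    refine key σ₁ hI₁ e6 e8 ?_ e5
    rw [e4, hτ', Market.lowerB_succ_of_le hb]
  · simp only [exhausted, BExp.Holds, NExp.eval, h13₁, h8₁, hd₁, not_le] at hb
    have hp := hI₁.pref v (τ v + 1) hb
    have hf6' : ∀ u : Fin n, σ₁.ra 6 v u = f v u := fun u => congrFun (congrFun e6 v) u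
    simp only [NExp.eval, RExp.eval, h13₁, h8₁, putNV_nv, hp, putNV_ra, if_true]
    norm_num [h13₁, hf6']
    refine key _ ?_ ?_ ?_ ?_ ?_
    · refine hI₁.congr ?_ rfl rfl ?_
      · simp
      · funext i j; simp
    · rw [mat_putRA_ne _ _ _ _ (by norm_num)]; exact e6
    · exact e8
    · rw [mat_putRA_same, mat_putNV, e4, hτ', Market.lowerB_succ hb]
    · rw [mat_putRA_ne _ _ _ _ (by norm_num)]; exact e5

def tryArcTime (B : ℕ) : ℕ :=
  1 + (1 + (1 + (searchTime B + (max (augmentTime B + (1 + 1)) (freezeArcTime B) + 1))))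

theorem tryArc_spec {σ : State} {B k : ℕ} {v : Fin n} (hB : n ≤ B) (hf : I.Feas f)
    (hJ : TopInv I f k σ) (h13 : σ.nv 13 = v) (hv : vec n σ 8 v < (I.pref v).length)
    (h15 : σ.nv 15 = (I.pref v)[vec n σ 8 v])
    (hle : mat n σ 3 v (I.pref v)[vec n σ 8 v] ≤ mat n σ 4 v (I.pref v)[vec n σ 8 v]) :
    Runs tryArc σ (tryArcTime B) (fun σ' => ∃ k' < k, TopInv I f k' σ') := by
  refine Runs.setNV_seq (Runs.setNV_seq (Runs.setRV_seq ?_))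
  simp only [NExp.eval, RExp.eval, putNV_nv, putNV_ra, h13, h15, Nat.reduceEqDiff, reduceIte]
  set u := (I.pref v)[vec n σ 8 v] with hu
  set σ₁ := (((σ.putNV 4 u).putNV 5 v).putRV 0 (σ.ra 5 v u - σ.ra 3 v u)) with hσ₁
  have hn₁ : σ₁.nv 0 = n := by simp [hσ₁, hJ.within.market.size]
  refine Runs.seq ((search_spec hB hn₁ u (by simp [hσ₁])).imp fun σ₂ hF₂ hl _ => ?_)
  have hm : ∀ a, mat n σ₂ a = mat n σ a := fun a => mat_congr (hF₂.ra a rfl)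
  have hm₁ : ∀ a, mat n σ₁ a = mat n σ a := fun a => rfl
  have hl₂ : IsLabel (Res (mat n σ₂ 3) (mat n σ₂ 4) (mat n σ₂ 5)) u (vec n σ₂ 6) (vec n σ₂ 7) := by
    rw [hm, hm, hm]; exact hl
  have v8 : vec n σ₂ 8 = vec n σ 8 := vec_congr (hF₂.na 8 rfl)
  have h13₂ : σ₂.nv 13 = v := (hF₂.nv 13 rfl).trans (by simpa [hσ₁] using h13)
  have h15₂ : σ₂.nv 15 = u := (hF₂.nv 15 rfl).trans (by simpa [hσ₁] using h15)
  have h4₂ : σ₂.nv 4 = u := (hF₂.nv 4 rfl).trans (by simp [hσ₁])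
  have h5₂ : σ₂.nv 5 = v := (hF₂.nv 5 rfl).trans (by simp [hσ₁])
  have hr₂ : σ₂.rv 0 = mat n σ 5 v u - mat n σ 3 v u := (hF₂.rv 0 rfl).trans (by simp [hσ₁, mat])
  have hI₂ : HasMarket I σ₂ :=
    (hJ.within.market.congr (σ' := σ₁) (by simp [hσ₁]) rfl rfl rfl).frame hF₂
  have hW₂ : Within I f σ₂ := hJ.within.congr hI₂ (hm 6) v8 (hm 3) (hm 4) (hm 5)
  have hJ₂ : TopInv I f k σ₂ := by
    refine ⟨hW₂, ?_, ?_, ?_⟩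
    · rw [h13₂]; exact v.isLt.le
    · intro w hw
      have := hJ.improved w (by rw [h13]; rwa [h13₂] at hw)
      simpa only [Improved, v8, hm] using this
    · rw [v8, h13₂, ← h13]; exact hJ.count
  have hlow : mat n σ 4 v u = f v u := by
    rw [hJ.within.lower, Market.lowerB, if_pos (Market.getElem_mem_take (by omega) hv)]
  refine Runs.ite (fun hb => ?_) (fun hb => ?_)
  · simp only [BExp.Holds, NExp.eval, RExp.eval, rzero_eval, hI₂.size, h5₂, not_le] at hb
    -- Half the bottleneck is sent: a cell that is lowered by ρ / 2 stays strictly above its lower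
    -- bound, which on the first open arcs is f. Gains made for earlier agents thus remain strict.
    refine Runs.seq ((augment_spec (q := 1 / 2) (t := v) hB h4₂ h5₂ hl₂ hb.2 hb.1).imp
      fun σ₃ hF₃ hpost _ => ?_)
    obtain ⟨pt, ρ, hpost⟩ := hpost
    have ha := hpost.augmented
    have hamt := hpost.amount
    have hcast : ((1 / 2 : ℚ) : ℝ) * ρ = ρ / 2 := by push_cast; ring
    rw [hcast] at ha hamt
    have hpos := ha.pos
    have h13₃ : σ₃.nv 13 = v := (hF₃.nv 13 rfl).trans h13₂
    have h15₃ : σ₃.nv 15 = u := (hF₃.nv 15 rfl).trans h15₂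
    have m4 : mat n σ₃ 4 = mat n σ₂ 4 := mat_congr (hF₃.ra 4 rfl)
    have m5 : mat n σ₃ 5 = mat n σ₂ 5 := mat_congr (hF₃.ra 5 rfl)
    have m6 : mat n σ₃ 6 = mat n σ₂ 6 := mat_congr (hF₃.ra 6 rfl)
    have v8₃ : vec n σ₃ 8 = vec n σ₂ 8 := vec_congr (hF₃.na 8 rfl)
    have hcl : mat n σ₃ 3 v u = mat n σ₂ 3 v u :=
      ha.closing_cell hl₂.source (by rw [hm, hm]; exact not_lt.2 hle)
    refine Runs.setRA_seq ?_
    simp only [NExp.eval, RExp.eval, h13₃, h15₃, hamt]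
    set σ₄ := σ₃.putRA 3 v u (σ₃.ra 3 v u + ρ / 2) with hσ₄
    have hval : σ₃.ra 3 v u = mat n σ₃ 3 v u := rfl
    have e3 : mat n σ₄ 3 = setCell (mat n σ₃ 3) v u (mat n σ₃ 3 v u + ρ / 2) := by
      rw [hσ₄, hval, mat_putRA_same]
    have e : ∀ a, a ≠ 3 → mat n σ₄ a = mat n σ₃ a := fun a ha => mat_putRA_ne _ _ _ _ ha
    have hI₄ : HasMarket I σ₄ := by
      refine (hI₂.frame hF₃).congr rfl rfl rfl ?_
      funext i j; simp [hσ₄]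
    have hbd : ∀ a b, mat n σ₄ 4 a b ≤ mat n σ₄ 3 a b ∧ mat n σ₄ 3 a b ≤ mat n σ₄ 5 a b := by
      intro a b
      rw [e3, e 4 (by norm_num), e 5 (by norm_num), m4, m5]
      simp only [setCell]
      split_ifs with hc
      · have h1 := hW₂.bounds v u
        have h2 := ha.le
        rw [hr₂, ← hm, ← hm] at h2
        rw [hc.1, hc.2, hcl]
        constructor <;> linarith
      · exact ha.bounds (by linarith) (by linarith) (hW₂.bounds a b)
    have v8₄ : vec n σ₄ 8 = vec n σ₂ 8 := v8₃
    have hW₄ : Within I f σ₄ := by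
      constructor
      · exact hI₄
      · rw [e 6 (by norm_num), m6]; exact hW₂.orig
      · rw [v8₄]; exact hW₂.le_deg
      · rw [e 4 (by norm_num), m4, v8₄]; exact hW₂.lower
      · rw [e 5 (by norm_num), m5, v8₄]; exact hW₂.upper
      · rw [v8₄]; exact hW₂.frozen
      · rw [e3]; exact ha.circ hW₂.circ
      · exact hbd
    have hJ₄ : TopInv I f k σ₄ := by
      refine ⟨hW₄, ?_, ?_, ?_⟩
      · change σ₃.nv 13 ≤ n
        rw [h13₃]; exact v.isLt.le
      · intro w hw x hx
        change (w : ℕ) < σ₃.nv 13 at hw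
        rw [h13₃] at hw
        rw [v8₄] at hx
        have h1 := hJ₂.improved w (by rwa [h13₂]) x hx
        have h2 : mat n σ₂ 4 w x = f w x := by
          obtain ⟨hlt, rfl⟩ := List.getElem?_eq_some_iff.1 hx
          rw [hW₂.lower, Market.lowerB, if_pos (Market.getElem_mem_take (by omega) hlt)]
        have hne : ¬ (w = v ∧ x = u) := by rintro ⟨rfl, -⟩; omega
        rw [e3]
        simp only [setCell, hne, if_false]
        rcases ha.cell w x with h3 | ⟨h3, -⟩ | ⟨h3, -, h4, -⟩
        · rw [h3]; exact h1
        · rw [h3]; linarith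
        · rw [h3]; linarith
      · change (n + 1) * openArcs I (vec n σ₄ 8) + (n - σ₃.nv 13) ≤ k
        rw [v8₄, h13₃, ← h13₂]; exact hJ₂.count
    refine nextAgent_spec (v := v) hJ₄ h13₃ ?_
    intro x hx
    rw [v8₄, v8, List.getElem?_eq_getElem hv, Option.some.injEq, ← hu] at hx
    subst hx
    have h1 := hW₂.bounds v u
    rw [hm 4, hlow] at h1
    rw [e3]
    simp only [setCell, and_self, if_true]
    rw [hcl]; linarith
  · simp only [BExp.Holds, NExp.eval, RExp.eval, rzero_eval, hI₂.size, h5₂, not_and, not_le,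
      not_lt] at hb
    have hu₂ : (I.pref v)[vec n σ₂ 8 v]'(by rw [v8]; exact hv) = u := by simp only [v8]; rfl
    refine freezeArc_spec (v := v) hB hf hJ₂ h13₂ (by rw [v8]; exact hv) ?_ ?_
    · rw [hu₂]; exact h15₂
    · rw [hu₂]
      -- If (v, u) has room, the failed search shows that no circulation within the bounds exceeds
      -- the current one there; without room the upper bound shows it. The current value is at most
      -- f by `hle`.
      intro h hc hbd
      rw [← hlow]
      refine le_trans ?_ hle
      by_cases hroom : 0 < σ₂.rv 0
      · have := hl₂.maximal (t := v) (not_lt.2 (hb hroom)) hW₂.circ hc fun a b _ => hbd a b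
        rwa [hm] at this
      · have h1 := (hbd v u).2
        rw [hm] at h1
        rw [hr₂] at hroom
        linarith

def topStepTime (B : ℕ) : ℕ := max 1 (1 + (max 1 (tryArcTime B) + 1)) + 1

theorem topStep_spec {σ : State} {B k : ℕ} (hB : n ≤ B) (hf : I.Feas f) (hJ : TopInv I f k σ)
    (hlt : σ.nv 13 < n) :
    Runs topStep σ (topStepTime B) (fun σ' => ∃ k' < k, TopInv I f k' σ') := by
  obtain ⟨v, hv⟩ : ∃ v : Fin n, σ.nv 13 = v := ⟨⟨_, hlt⟩, rfl⟩
  have hI := hJ.within.market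
  have h8 : σ.na 8 v 0 = vec n σ 8 v := rfl
  refine Runs.ite (fun hb => ?_) (fun hb => ?_)
  · simp only [exhausted, BExp.Holds, NExp.eval, hv, hI.deg, h8] at hb
    refine nextAgent_spec hJ hv fun u hu => ?_
    rw [List.getElem?_eq_none hb] at hu
    exact absurd hu (by simp)
  · simp only [exhausted, BExp.Holds, NExp.eval, hv, hI.deg, h8, not_le] at hb
    have hp := hI.pref v _ hb
    refine Runs.setNV_seq ?_
    simp only [NExp.eval, hv, h8, hp]
    set u := (I.pref v)[vec n σ 8 v] with hu
    set σ₁ := σ.putNV 15 u with hσ₁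
    have h15 : σ₁.nv 15 = u := by simp [hσ₁]
    have h13 : σ₁.nv 13 = v := by simp [hσ₁, hv]
    have hJ₁ : TopInv I f k σ₁ := by
      refine ⟨hJ.within.congr (hI.congr (by simp [hσ₁]) rfl rfl rfl) rfl rfl rfl rfl rfl,
        ?_, ?_, ?_⟩
      · rw [h13]; exact v.isLt.le
      · rw [h13, ← hv]; exact hJ.improved
      · rw [h13, ← hv]; exact hJ.count
    have hlow : mat n σ 4 v u = f v u := by
      rw [hJ.within.lower, Market.lowerB, if_pos (Market.getElem_mem_take (by omega) hb)]
    refine Runs.ite (fun hb' => ?_) (fun hb' => ?_)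
    · simp only [BExp.Holds, NExp.eval, RExp.eval, h13, h15, not_le] at hb'
      refine nextAgent_spec hJ₁ h13 fun x hx => ?_
      have hx' : (I.pref v)[vec n σ 8 v]? = some x := hx
      rw [List.getElem?_eq_getElem hb, Option.some.injEq, ← hu] at hx'
      subst hx'
      rw [← hlow]; exact hb'
    · simp only [BExp.Holds, NExp.eval, RExp.eval, h13, h15, not_not] at hb'
      exact tryArc_spec hB hf hJ₁ h13 hb h15 hb'

def findTopsTime (B : ℕ) : ℕ :=
  1 + (((B + 1) * (B * B) + B) * (topStepTime B + 1) + 1)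

theorem findTops_spec {σ : State} {B : ℕ} (hB : n ≤ B) (hf : I.Feas f) (hI : HasMarket I σ)
    (h3 : mat n σ 3 = f) (h6 : mat n σ 6 = f) (h8 : vec n σ 8 = 0)
    (h4 : mat n σ 4 = I.lowerB f 0) (h5 : mat n σ 5 = I.capM) :
    Runs findTops σ (findTopsTime B) (fun σ' => Within I f σ' ∧ ∀ v, Improved I f σ' v) := by
  refine Runs.setNV_seq ?_
  have hopen : openArcs I (vec n σ 8) ≤ n * n := by
    unfold openArcs
    calc _ ≤ ∑ _v : Fin n, n := Finset.sum_le_sum fun v _ =>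
          (Nat.sub_le _ _).trans (pref_length_le I v)
      _ = _ := by simp
  -- There are at most n * n open arcs, each of weight n + 1, and at most n agents ahead of the
  -- counter.
  refine Runs.mono (T := ((n + 1) * (n * n) + n) * (topStepTime B + 1) + 1)
    (Runs.while_loop (fun k σ' => TopInv I f k σ') ((n + 1) * (n * n) + n) ?_ ?_ ?_)
    (by gcongr) (fun _ _ h => h)
  · refine ⟨⟨?_, ?_, ?_, ?_, ?_, ?_, ?_, ?_⟩, by simp, by simp, ?_⟩
    · exact hI.congr rfl rfl rfl rfl
    · exact h6
    · intro v; rw [vec_putNV, h8]; exact Nat.zero_le _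
    · rw [mat_putNV, vec_putNV, h8]; exact h4
    · rw [mat_putNV, vec_putNV, h8, h5]; funext a b; simp [Market.upperB]
    · rw [vec_putNV, h8]; exact Market.Frozen.zero
    · rw [mat_putNV, h3]; exact hf.circ
    · intro a b
      have := hf.self_bounds (I := I) 0 a b
      simp only [mat_putNV, h3, h4, h5]
      exact ⟨this.1, hf.le_cap a b⟩
    · simp only [vec_putNV, NExp.eval, putNV_nv, if_true]
      exact Nat.add_le_add (Nat.mul_le_mul_left _ hopen) (Nat.sub_le _ _)
  · rintro k - σ' _ hJ hb
    simp only [BExp.Holds, NExp.eval, hJ.within.market.size, not_le] at hb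
    exact (topStep_spec hB hf hJ hb).imp fun _ _ h _ => h
  · rintro k - σ' _ hJ hb
    simp only [BExp.Holds, NExp.eval, hJ.within.market.size, not_not] at hb
    exact ⟨hJ.within, fun v => hJ.improved v (v.isLt.trans_le hb)⟩

/-- Set register `2` to `1` if all agents are exhausted, else to `0`, and raise the lower bounds on
the improved arcs. -/
def decideTops : Stmt :=
  .setNV 2 (.const 1) ;;
  forLoop 13 (.var 0)
    (.ite exhausted .skip
      (.setNV 2 (.const 0) ;;
      .setNV 15 (.get 1 (.var 13) (.get 8 (.var 13) (.const 0))) ;;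
      .setRA 4 (.var 13) (.var 15) (.get 3 (.var 13) (.var 15))))

theorem decideTops_spec {σ : State} {B : ℕ} (hB : n ≤ B) (hW : Within I f σ) :
    Runs decideTops σ (1 + forTime B 4) (fun σ' =>
      mat n σ' 4 = I.improvedB f (mat n σ 3) (vec n σ 8) ∧
      ((σ'.nv 2 = 1 ∧ ∀ v, (I.pref v).length ≤ vec n σ 8 v) ∨
        (σ'.nv 2 = 0 ∧ ∃ v, vec n σ 8 v < (I.pref v).length))) := by
  refine Runs.setNV_seq ?_
  have hI : HasMarket I (σ.putNV 2 ((NExp.const 1).eval σ)) := hW.market.congr rfl rfl rfl rfl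
  refine Runs.for_loop n hB (fun i σ' =>
      (∀ v u : Fin n, mat n σ' 4 v u =
        if (v : ℕ) < i then I.improvedB f (mat n σ 3) (vec n σ 8) v u else mat n σ 4 v u) ∧
      ((σ'.nv 2 = 1 ∧ ∀ v : Fin n, (v : ℕ) < i → (I.pref v).length ≤ vec n σ 8 v) ∨
        (σ'.nv 2 = 0 ∧ ∃ v, vec n σ 8 v < (I.pref v).length))) rfl ?_
    (fun i σ' hF _ => (hI.frame hF).size) ?_ ?_
  · exact ⟨fun v u => by simp, .inl ⟨by simp, by simp⟩⟩
  · intro i hi σ₁ hF₁ ⟨hJ₁, hJ₂⟩ hv₁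
    obtain ⟨v, hv⟩ : ∃ v : Fin n, i = v := ⟨⟨i, hi⟩, rfl⟩
    subst hv
    have hI₁ := hI.frame hF₁
    have v8 : vec n σ₁ 8 = vec n σ 8 := vec_congr (hF₁.na 8 rfl)
    have m3 : mat n σ₁ 3 = mat n σ 3 := mat_congr (hF₁.ra 3 rfl)
    have h8 : σ₁.na 8 v 0 = vec n σ 8 v := by rw [← v8]; rfl
    refine Runs.mono (T := max 1 (1 + (1 + 1)) + 1) (Runs.ite (fun hb => Runs.skip fun _ => ?_)
      (fun hb => Runs.setNV_seq (Runs.setNV_seq (Runs.setRA fun _ => ?_)))) (by simp)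
      (fun _ _ h => h)
    · simp only [exhausted, BExp.Holds, NExp.eval, hv₁, hI₁.deg, h8] at hb
      constructor
      · intro w u
        rw [mat_putNV, hJ₁ w u]
        by_cases hw : (w : ℕ) < v
        · simp [hw, hw.trans (Nat.lt_succ_self _)]
        · by_cases hwv : w = v
          · subst hwv
            simp [Market.improvedB, List.getElem?_eq_none hb, ← hW.lower]
          · have : (w : ℕ) ≠ v := fun h => hwv (Fin.ext h)
            rw [if_neg hw, if_neg (by omega)]
      · refine hJ₂.imp (fun h => ⟨by simpa using h.1, fun w hw => ?_⟩) (fun h => by simpa using h)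
        rcases Nat.lt_succ_iff_lt_or_eq.1 hw with hw | hw
        · exact h.2 w hw
        · obtain rfl : w = v := Fin.ext hw
          exact hb
    · simp only [exhausted, BExp.Holds, NExp.eval, hv₁, hI₁.deg, h8, not_le] at hb
      have hp := hI₁.pref v _ hb
      simp only [NExp.eval, RExp.eval, putNV_nv, putNV_na, putNV_ra, hv₁]
      norm_num [hv₁, h8, hp]
      set u := (I.pref v)[vec n σ 8 v] with hu
      constructor
      · intro w x
        rw [mat_putRA_same]
        simp only [mat_putNV, setCell]
        split_ifs with hc hlt hlt
        · rw [hc.1, hc.2, Market.improvedB, if_pos (by rw [List.getElem?_eq_getElem hb]), ← m3]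
          rfl
        · rw [hc.1] at hlt; omega
        · rw [hJ₁]
          by_cases hw : (w : ℕ) < v
          · simp [hw]
          · obtain rfl : w = v := Fin.ext (by omega)
            have hx : u ≠ x := fun h => hc ⟨rfl, h.symm⟩
            rw [if_neg hw, Market.improvedB, List.getElem?_eq_getElem hb, if_neg (by simpa using hx),
              ← hW.lower]
        · rw [hJ₁, if_neg (by omega)]
      · exact ⟨v, hb⟩
  · intro σ' _ h
    refine ⟨by funext v u; simpa using h.1 v u, h.2.imp (fun h => ⟨h.1, fun v => h.2 v v.isLt⟩) id⟩

end RealRAM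

/-! ### Sequential maximization over all arcs -/

namespace RealRAM

variable {n : ℕ} {I : Market n}

/-- Maximize the flow on all arcs one after the other. -/
def maximizeAll : Stmt :=
  forLoop 13 (.var 0) (forLoop 14 (.get 0 (.var 13) (.const 0))
    (.setNV 15 (.get 1 (.var 13) (.var 14)) ;; maximize))

/-- The arcs before the `i`-th arc of the agent `v`. -/
def ArcsBefore (I : Market n) (v i : ℕ) (w u : Fin n) : Prop :=
  ((w : ℕ) < v ∧ u ∈ I.pref w) ∨ ((w : ℕ) = v ∧ u ∈ (I.pref w).take i)

theorem arcsBefore_succ {v : Fin n} {i : ℕ} (hi : i < (I.pref v).length) (w u : Fin n) :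
    ArcsBefore I v (i + 1) w u ↔ ArcsBefore I v i w u ∨ (w = v ∧ u = (I.pref v)[i]) := by
  unfold ArcsBefore
  by_cases hw : w = v
  · subst hw
    simp [Market.mem_take_succ hi]
  · have : (w : ℕ) ≠ v := fun h => hw (Fin.ext h)
    simp [hw, this]

theorem arcsBefore_next (v : Fin n) (w u : Fin n) :
    ArcsBefore I (v + 1) 0 w u ↔ ArcsBefore I v (I.pref v).length w u := by
  unfold ArcsBefore
  by_cases hw : w = v
  · subst hw
    simp
  · have : (w : ℕ) ≠ v := fun h => hw (Fin.ext h)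
    simp only [this, false_and, or_false, List.take_zero, List.not_mem_nil, and_false]
    constructor
    · rintro ⟨h1, h2⟩; exact ⟨by omega, h2⟩
    · rintro ⟨h1, h2⟩; exact ⟨by omega, h2⟩

theorem arcsBefore_zero (w u : Fin n) : ¬ ArcsBefore I 0 0 w u := by
  simp [ArcsBefore]

theorem arcsBefore_all (w u : Fin n) : ArcsBefore I n 0 w u ↔ u ∈ I.pref w := by
  simp [ArcsBefore]

def maximizeAllTime (B : ℕ) : ℕ := forTime B (forTime B (1 + maximizeTime B))

/-- Each list is processed from its top, as `SeqMax.step` needs all better arcs of the same agent to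
be finished; the order of the agents is immaterial. -/
theorem maximizeAll_spec {σ : State} {B : ℕ} (hB : n ≤ B) (hI : HasMarket I σ)
    (hc : Circ (mat n σ 3))
    (hb : ∀ a b, mat n σ 4 a b ≤ mat n σ 3 a b ∧ mat n σ 3 a b ≤ mat n σ 5 a b) :
    Runs maximizeAll σ (maximizeAllTime B) (fun σ' =>
      I.SeqMax (mat n σ 4) (mat n σ 5) (fun v u => u ∈ I.pref v)
        (mat n σ' 3) (mat n σ' 4) (mat n σ' 5)) := by
  refine Runs.for_loop n hB (fun v σ' => I.SeqMax (mat n σ 4) (mat n σ 5) (ArcsBefore I v 0)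
    (mat n σ' 3) (mat n σ' 4) (mat n σ' 5)) rfl
    (Market.SeqMax.init hc hb arcsBefore_zero) (fun i σ' hF _ => (hI.frame hF).size) ?_
    (fun σ' _ h => h.congr fun a b => (arcsBefore_all a b).symm)
  intro v hv σ₁ hF₁ hJ₁ hv₁
  obtain ⟨v, rfl⟩ : ∃ v' : Fin n, v = v' := ⟨⟨v, hv⟩, rfl⟩
  have hI₁ := hI.frame hF₁
  refine Runs.for_loop (I.pref v).length ((pref_length_le I v).trans hB)
    (fun i σ' => I.SeqMax (mat n σ 4) (mat n σ 5) (ArcsBefore I v i)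
      (mat n σ' 3) (mat n σ' 4) (mat n σ' 5)) rfl hJ₁ (fun i σ' hF _ => ?_) ?_ ?_
  · have h13 : σ'.nv 13 = v := (hF.nv 13 rfl).trans hv₁
    simpa [h13] using (hI₁.frame hF).deg v
  · intro i hi σ₂ hF₂ hJ₂ hv₂
    have hI₂ := hI₁.frame hF₂
    have h13 : σ₂.nv 13 = v := (hF₂.nv 13 rfl).trans hv₁
    have hp := hI₂.pref v i hi
    refine Runs.setNV_seq ?_
    simp only [NExp.eval, h13, hv₂, hp]
    refine (maximize_spec (σ := σ₂.putNV 15 ((I.pref v)[i] : Fin n)) (v := v) (u := (I.pref v)[i]) hB (by simpa using hI₂.size)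
      (by simpa using h13) (by simp) hJ₂.circ hJ₂.bounds).imp ?_
    rintro σ₃ hF₃ ⟨h1, h2, h3, h4, h5⟩ -
    simp only [mat_putNV] at h2 h3 h4 ⊢
    rw [h3, h4]
    refine hJ₂.step hi (fun u hu => .inr ⟨rfl, hu⟩) h1 h2 h5 (arcsBefore_succ hi)
  · intro σ₂ _ h _
    exact h.congr (arcsBefore_next v)

/-! ### Decomposition into cycles -/

/-- Subtract a cycle through the arc from register `13` to register `15` and output it. -/
def extract : Stmt :=
  .setNV 4 (.var 13) ;; .setNV 5 (.var 15) ;; search ;;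
  .setRV 0 (.get 3 (.var 13) (.var 15)) ;;
  augment 1 ;;
  .setRA 3 (.var 13) (.var 15) (.sub (.get 3 (.var 13) (.var 15)) (.var 0)) ;;
  .setNA 4 (.var 3) (.const 0) (.add (.var 10) (.const 1)) ;;
  .setRA 2 (.var 3) (.const 0) (.var 0) ;;
  .setNV 3 (.add (.var 3) (.const 1))

/-- Write the flow as a list of cycles. -/
def decompose : Stmt :=
  copyMat 4 7 ;; copyMat 5 7 ;; .setNV 3 (.const 0) ;;
  forLoop 13 (.var 0) (forLoop 14 (.get 0 (.var 13) (.const 0))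
    (.setNV 15 (.get 1 (.var 13) (.var 14)) ;;
    .while (.not (.rle (.get 3 (.var 13) (.var 15)) rzero)) extract))

/-- `L` has been extracted from the flow `G`. -/
structure DecInv (I : Market n) (G : Fin n → Fin n → ℝ) (L : List (List (Fin n) × ℝ))
    (σ : State) : Prop where
  market : HasMarket I σ
  -- With both bounds zero and a nonnegative flow, the residual arcs are exactly the reversals of
  -- the arcs that carry flow.
  lower : mat n σ 4 = 0
  upper : mat n σ 5 = 0
  nonneg : ∀ a b, 0 ≤ mat n σ 3 a b
  supp : ∀ a b, b ∉ I.pref a → mat n σ 3 a b = 0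
  sum : ∀ a b, G a b = mat n σ 3 a b + listFlow L a b
  out : Outputs σ L
  nodup : (L.map (fun x => (x.1 : Cycle (Fin n)))).Nodup
  dicycle : ∀ x ∈ L, IsDicycle I.Arc (x.1 : Cycle (Fin n))
  pos : ∀ x ∈ L, 0 < x.2
  -- Later cycles use only arcs that carry flow, so an exhausted arc on each listed cycle prevents
  -- repetitions.
  dead : ∀ x ∈ L, ∃ a b, CycleHasArc (x.1 : Cycle (Fin n)) a b ∧ mat n σ 3 a b = 0

/-- The number of arcs that carry flow. -/
noncomputable def posCount (g : Fin n → Fin n → ℝ) : ℕ :=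
  (Finset.univ.filter fun p : Fin n × Fin n => 0 < g p.1 p.2).card

theorem posCount_le (g : Fin n → Fin n → ℝ) : posCount g ≤ n * n := by
  refine (Finset.card_filter_le _ _).trans ?_
  simp

theorem posCount_lt {g h : Fin n → Fin n → ℝ} (hle : ∀ a b, h a b ≤ g a b) {a b : Fin n}
    (hg : 0 < g a b) (hh : h a b = 0) : posCount h < posCount g := by
  refine Finset.card_lt_card ⟨fun p hp => ?_, fun hsub => ?_⟩
  · simp only [Finset.mem_filter, Finset.mem_univ, true_and] at hp ⊢
    exact hp.trans_le (hle _ _)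
  · have := hsub (show (a, b) ∈ _ by simpa using hg)
    simp [hh] at this

theorem circ_of_sum {G g : Fin n → Fin n → ℝ} {L : List (List (Fin n) × ℝ)} (hG : Circ G)
    (h : ∀ a b, G a b = g a b + listFlow L a b) : Circ g := by
  intro v
  have h1 := hG v
  have h2 := circ_listFlow L v
  simp only [h, Finset.sum_add_distrib] at h1
  linarith

/-- In a circulation, the head of every arc that carries flow can be reached backwards from its
tail. -/
theorem reachable_of_circ {g : Fin n → Fin n → ℝ} {d p : Fin n → ℕ} {s t : Fin n} (hg : Circ g)
    (hnn : ∀ a b, 0 ≤ g a b) (hl : IsLabel (Res g 0 0) s d p) (hst : 0 < g s t) : d t < n := by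
  by_contra hcon
  -- This is also the residual graph of the zero flow below the transpose of g. The transpose is a
  -- competing circulation, so if t were out of reach, its value g s t on (t, s) would be at most
  -- zero.
  have hR : Res g 0 0 = Res 0 0 (fun a b => g b a) := by
    funext x y
    simp [Res, (hnn x y).not_gt]
  rw [hR] at hl
  have := hl.maximal (t := t) (h := fun a b => g b a) hcon (fun v => by simp)
    (fun v => (hg v).symm) (fun a b _ => ⟨hnn b a, le_rfl⟩)
  simp only [Pi.zero_apply] at this
  linarith

/-- The list of the vertices of a recorded path. -/
def pathList (pt : ℕ → Fin n) (k : ℕ) : List (Fin n) := (List.range (k + 1)).map pt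

@[simp] theorem pathList_length (pt : ℕ → Fin n) (k : ℕ) : (pathList pt k).length = k + 1 := by
  simp [pathList]

theorem pathList_getElem? (pt : ℕ → Fin n) (k : ℕ) {i : ℕ} (hi : i ≤ k) :
    (pathList pt k)[i]? = some (pt i) := by
  simp [pathList, List.getElem?_range (Nat.lt_succ_of_le hi)]

theorem arcAt_pathList_lt (pt : ℕ → Fin n) {k i : ℕ} (hi : i < k) (a b : Fin n) :
    ArcAt (pathList pt k) i a b ↔ a = pt i ∧ b = pt (i + 1) := by
  rw [ArcAt, pathList_length, Nat.mod_eq_of_lt (by omega), pathList_getElem? _ _ hi.le,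
    pathList_getElem? _ _ hi, Option.some.injEq, Option.some.injEq, eq_comm, @eq_comm _ (pt (i + 1))]

theorem arcAt_pathList_last (pt : ℕ → Fin n) (k : ℕ) (a b : Fin n) :
    ArcAt (pathList pt k) k a b ↔ a = pt k ∧ b = pt 0 := by
  rw [ArcAt, pathList_length, Nat.mod_self, pathList_getElem? _ _ le_rfl,
    pathList_getElem? _ _ (Nat.zero_le k), Option.some.injEq, Option.some.injEq, eq_comm,
    @eq_comm _ (pt 0)]

def extractTime (B : ℕ) : ℕ :=
  1 + (1 + (searchTime B + (1 + (augmentTime B + (1 + (1 + (1 + 1)))))))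

/-- The search runs from v to u against the flow, and the path is recorded from u to v. The row
therefore lists the cycle along the flow, closed by the arc (v, u). The row index is the number of
cycles found so far, so the path already stands in its place in the output area. -/
theorem extract_spec {σ : State} {B : ℕ} (hB : n ≤ B) {G : Fin n → Fin n → ℝ} (hG : Circ G)
    {L : List (List (Fin n) × ℝ)} (hJ : DecInv I G L σ) {v u : Fin n} (h13 : σ.nv 13 = v)
    (h15 : σ.nv 15 = u) (hpos : 0 < mat n σ 3 v u) :
    Runs extract σ (extractTime B) (fun σ' => (∃ L', DecInv I G L' σ') ∧
      (∀ a b, mat n σ' 3 a b ≤ mat n σ 3 a b) ∧ posCount (mat n σ' 3) < posCount (mat n σ 3)) := by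
  refine Runs.setNV_seq (Runs.setNV_seq ?_)
  simp only [NExp.eval, putNV_nv, h13, h15, Nat.reduceEqDiff, reduceIte]
  set σ₁ := (σ.putNV 4 v).putNV 5 u with hσ₁
  have hn₁ : σ₁.nv 0 = n := by simp [hσ₁, hJ.market.size]
  refine Runs.seq ((search_spec hB hn₁ v (by simp [hσ₁])).imp fun σ₂ hF₂ hl _ => ?_)
  have hm₁ : ∀ a, mat n σ₁ a = mat n σ a := fun a => rfl
  rw [hm₁, hm₁, hm₁, hJ.lower, hJ.upper] at hl
  refine Runs.setRV_seq ?_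
  have h13₂ : σ₂.nv 13 = v := (hF₂.nv 13 rfl).trans (by simpa [hσ₁] using h13)
  have h15₂ : σ₂.nv 15 = u := (hF₂.nv 15 rfl).trans (by simpa [hσ₁] using h15)
  have h4₂ : σ₂.nv 4 = v := (hF₂.nv 4 rfl).trans (by simp [hσ₁])
  have h5₂ : σ₂.nv 5 = u := (hF₂.nv 5 rfl).trans (by simp [hσ₁])
  have h3₂ : σ₂.nv 3 = L.length := (hF₂.nv 3 rfl).trans (by simpa [hσ₁] using hJ.out.1)
  set g := mat n σ 3 with hg
  have hnn : ∀ a b, 0 ≤ g a b := hJ.nonneg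
  have hsupp : ∀ a b, b ∉ I.pref a → g a b = 0 := hJ.supp
  have hsum : ∀ a b, G a b = g a b + listFlow L a b := hJ.sum
  have hval : σ₂.ra 3 v u = g v u := by rw [hF₂.ra 3 rfl]; rfl
  simp only [NExp.eval, RExp.eval, h13₂, h15₂, hval]
  set σ₃ := σ₂.putRV 0 (g v u) with hσ₃
  have m3 : mat n σ₃ 3 = g := (mat_congr (hF₂.ra 3 rfl)).trans (hm₁ 3)
  have m4 : mat n σ₃ 4 = 0 := ((mat_congr (hF₂.ra 4 rfl)).trans (hm₁ 4)).trans hJ.lower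
  have m5 : mat n σ₃ 5 = 0 := ((mat_congr (hF₂.ra 5 rfl)).trans (hm₁ 5)).trans hJ.upper
  have hl₃ : IsLabel (Res (mat n σ₃ 3) (mat n σ₃ 4) (mat n σ₃ 5)) v (vec n σ₃ 6) (vec n σ₃ 7) := by
    rw [m3, m4, m5]; exact hl
  have hcirc : Circ g := circ_of_sum hG hJ.sum
  have hreach : vec n σ₃ 6 u < n := reachable_of_circ hcirc hJ.nonneg hl hpos
  have hr₃ : σ₃.rv 0 = g v u := by simp [hσ₃]
  refine Runs.seq ((augment_spec (q := 1) (σ := σ₃) (t := u) hB h4₂ h5₂ hl₃ hreach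
    (by rw [hr₃]; exact hpos)).imp fun σ₄ hF₄ hpost _ => ?_)
  obtain ⟨pt, ρ, hpost⟩ := hpost
  have ha := hpost.augmented
  have hamt := hpost.amount
  have hpush := hpost.pushed
  have hpath := hpost.isPath
  have hrow := hpost.path
  have hrows := hpost.rows
  have hidx := hpost.idx
  simp only [Rat.cast_one, one_mul] at ha hamt hpush
  have h3₃ : σ₃.nv 3 = L.length := h3₂
  rw [h3₃] at hrow hrows
  rw [m3, m4, m5] at hpath ha
  rw [m3, m5] at hpush
  rw [hr₃] at ha
  set d := vec n σ₃ 6 with hd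
  set k := d u with hk
  have h13₄ : σ₄.nv 13 = v := (hF₄.nv 13 rfl).trans h13₂
  have h15₄ : σ₄.nv 15 = u := (hF₄.nv 15 rfl).trans h15₂
  have h3₄ : σ₄.nv 3 = L.length := (hF₄.nv 3 rfl).trans h3₃
  refine Runs.setRA_seq (Runs.setNA_seq (Runs.setRA_seq (Runs.setNV ?_)))
  simp only [NExp.eval, RExp.eval, putRA_nv, putNA_nv, putRA_rv, putNA_rv, h13₄, h15₄, h3₄, hamt,
    hidx]
  set h := mat n σ₄ 3 with hh
  have hval₄ : σ₄.ra 3 v u = h v u := rfl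
  rw [hval₄]
  set σ₅ := ((((σ₄.putRA 3 v u (h v u - ρ)).putNA 4 L.length 0 (k + 1)).putRA 2 L.length 0
    ρ).putNV 3 (L.length + 1)) with hσ₅
  set g' := mat n σ₅ 3 with hg'
  have hρ := ha.pos
  have hnot : ∀ a b, ¬ g a b < (0 : Fin n → Fin n → ℝ) a b := fun a b => (hnn a b).not_gt
  have e3 : g' = setCell h v u (h v u - ρ) := by
    rw [hg', hσ₅, mat_putNV, mat_putRA_ne _ _ _ _ (by norm_num), mat_putNA, mat_putRA_same]
  have hvu : u ∈ I.pref v := by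
    by_contra hcon
    rw [hsupp v u hcon] at hpos
    exact lt_irrefl _ hpos
  have hne : u ≠ v := by rintro rfl; exact I.no_loop _ hvu
  -- There are no loops, so u differs from v and the cycle has at least two vertices.
  have hk1 : 1 ≤ k := by
    by_contra hcon
    have hk0 : k = 0 := by omega
    have h1 := hpath.first
    have h2 := hpath.last
    rw [← hk, hk0] at h2
    exact hne (h1.symm.trans h2)
  set l := pathList pt k with hl'
  have hgcyc : ∀ a b, g' a b = g a b - cycFlow (l, ρ) l.length a b := by
    intro a b
    have h1 := pushes_back (δ := ρ) hpath hnot k le_rfl a b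
    rw [← hpush] at h1
    have h2 : cycFlow (l, ρ) l.length a b =
        (∑ j ∈ Finset.range k, if a = pt j ∧ b = pt (j + 1) then ρ else 0) +
          if a = v ∧ b = u then ρ else 0 := by
      rw [hl', pathList_length]
      unfold cycFlow
      rw [Finset.sum_range_succ]
      congr 1
      · refine Finset.sum_congr rfl fun i hi => ?_
        simp only [arcAt_pathList_lt pt (Finset.mem_range.1 hi)]
      · simp only [arcAt_pathList_last]
        rw [hpath.first, hpath.last]
    rw [h2, e3, ← sub_sub, ← h1]
    simp only [setCell]
    split_ifs with hc
    · rw [hc.1, hc.2]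
    · simp
  have hlen : l.length = k + 1 := by simp [hl']
  have hnodup : l.Nodup := by
    rw [hl', pathList]
    refine List.Nodup.map_on (fun i hi j hj hij => ?_) List.nodup_range
    rw [List.mem_range] at hi hj
    have h1 := hpath.label i (by omega)
    have h2 := hpath.label j (by omega)
    rw [hij] at h1
    omega
  have harc : ∀ i < l.length, ∀ a b, ArcAt l i a b → 0 < g a b := by
    intro i hi a b hab
    rw [hlen] at hi
    rcases Nat.lt_succ_iff_lt_or_eq.1 hi with hi | rfl
    · obtain ⟨rfl, rfl⟩ := (arcAt_pathList_lt pt hi a b).1 hab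
      exact (hpath.arc i hi).resolve_left (hnot _ _)
    · obtain ⟨rfl, rfl⟩ := (arcAt_pathList_last pt k a b).1 hab
      rw [hpath.first, hpath.last]; exact hpos
  have hcyc : IsDicycle I.Arc (l : Cycle (Fin n)) := by
    refine isDicycle_of_arcs hnodup (by omega) fun i hi a b hab => ?_
    by_contra hcon
    have := harc i hi a b hab
    rw [hsupp a b hcon] at this
    exact lt_irrefl _ this
  have hcell : ∀ a b, 0 ≤ h a b ∧ h a b ≤ g a b := by
    intro a b
    rcases ha.cell a b with h1 | ⟨-, h1, -⟩ | ⟨h1, -, h2, -⟩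
    · rw [h1]; exact ⟨hnn a b, le_rfl⟩
    · exact absurd h1 (hnot a b)
    · simp only [Pi.zero_apply] at h2
      rw [h1]; constructor <;> linarith
  have hhvu : h v u = g v u := by
    rcases ha.cell v u with h1 | ⟨-, h1, -⟩ | ⟨-, -, -, h1⟩
    · exact h1
    · exact absurd h1 (hnot v u)
    · have := hl₃.source; omega
  have hg'nn : ∀ a b, 0 ≤ g' a b ∧ g' a b ≤ g a b := by
    intro a b
    rw [e3]
    simp only [setCell]
    split_ifs with hc
    · have := ha.le
      rw [hc.1, hc.2, hhvu]; constructor <;> linarith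
    · exact hcell a b
  -- The amount is the minimum of the flow over the closing arc and the path, so some arc of the
  -- cycle is exhausted.
  obtain ⟨a₀, b₀, hg₀, hz₀⟩ : ∃ a b, 0 < g a b ∧ g' a b = 0 := by
    rcases ha.sat with hs | ⟨a, b, ⟨-, h1, -⟩ | ⟨-, h1, h2, h3⟩⟩
    · refine ⟨v, u, hpos, ?_⟩
      rw [e3]; simp [setCell, hhvu, hs]
    · exact absurd h1 (hnot a b)
    · refine ⟨a, b, h1, ?_⟩
      simp only [Pi.zero_apply, sub_zero] at h2
      have h4 := hg'nn a b
      have h5 : g' a b ≤ h a b := by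
        rw [e3]
        simp only [setCell]
        split_ifs with hc
        · rw [hc.1, hc.2]; linarith
        · exact le_rfl
      linarith
  have hhas₀ : CycleHasArc (l : Cycle (Fin n)) a₀ b₀ := by
    classical
    have h1 := hgcyc a₀ b₀
    rw [cycFlow_eq (by omega) hnodup] at h1
    by_contra hcon
    rw [if_neg hcon] at h1
    linarith
  have hrest : ∀ r, r ≠ L.length → ∀ i, σ₅.na 5 r i = σ.na 5 r i := by
    intro r hr i
    have h1 : σ₅.na 5 r i = σ₄.na 5 r i := by simp [hσ₅]
    rw [h1, hrows r hr i]
    change σ₂.na 5 r i = _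
    rw [hF₂.na 5 rfl]; rfl
  have hna4 : ∀ r, r ≠ L.length → σ₅.na 4 r 0 = σ.na 4 r 0 := by
    intro r hr
    have h1 : σ₅.na 4 r 0 = σ₄.na 4 r 0 := by simp [hσ₅, hr]
    rw [h1, hF₄.na 4 rfl]
    change σ₂.na 4 r 0 = _
    rw [hF₂.na 4 rfl]; rfl
  have hra2 : ∀ r, r ≠ L.length → σ₅.ra 2 r 0 = σ.ra 2 r 0 := by
    intro r hr
    have h1 : σ₅.ra 2 r 0 = σ₄.ra 2 r 0 := by simp [hσ₅, hr]
    rw [h1, hF₄.ra 2 rfl]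
    change σ₂.ra 2 r 0 = _
    rw [hF₂.ra 2 rfl]; rfl
  have hmkt₄ : HasMarket I σ₄ :=
    (((hJ.market.congr (σ' := σ₁) (by simp [hσ₁]) rfl rfl rfl).frame hF₂).congr (σ' := σ₃)
      rfl rfl rfl rfl).frame hF₄
  refine ⟨⟨L ++ [(l, ρ)], ?_⟩, fun a b => (hg'nn a b).2, posCount_lt (fun a b => (hg'nn a b).2) hg₀ hz₀⟩
  constructor
  · refine hmkt₄.congr ?_ ?_ ?_ ?_
    · simp [hσ₅]
    · funext i j; simp [hσ₅]
    · funext i j; simp [hσ₅]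
    · funext i j; simp [hσ₅]
  · rw [hσ₅, mat_putNV, mat_putRA_ne _ _ _ _ (by norm_num), mat_putNA,
      mat_putRA_ne _ _ _ _ (by norm_num), mat_congr (hF₄.ra 4 rfl)]
    exact m4
  · rw [hσ₅, mat_putNV, mat_putRA_ne _ _ _ _ (by norm_num), mat_putNA,
      mat_putRA_ne _ _ _ _ (by norm_num), mat_congr (hF₄.ra 5 rfl)]
    exact m5
  · exact fun a b => (hg'nn a b).1
  · intro a b hab
    have h1 := hg'nn a b
    rw [hsupp a b hab] at h1
    exact le_antisymm h1.2 h1.1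
  · intro a b
    rw [listFlow_concat, ← hg', hgcyc a b, hsum a b]
    ring
  · refine ⟨by simp [hσ₅], ?_⟩
    intro r hr
    rw [List.length_append, List.length_singleton] at hr
    rcases Nat.lt_succ_iff_lt_or_eq.1 hr with hr | rfl
    · obtain ⟨o1, o2, o3⟩ := hJ.out.2 r hr
      rw [List.getElem_append_left hr]
      refine ⟨(hna4 r hr.ne).trans o1, (hra2 r hr.ne).trans o2, fun i hi => ?_⟩
      exact (hrest r hr.ne i).trans (o3 i hi)
    · simp only [List.getElem_concat_length]
      refine ⟨by simp [hσ₅, hlen], by simp [hσ₅], fun i hi => ?_⟩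
      have h1 : σ₅.na 5 L.length i = σ₄.na 5 L.length i := by simp [hσ₅]
      rw [hlen] at hi
      rw [h1, hrow i (by omega)]
      have h2 := pathList_getElem? pt k (i := i) (by omega)
      obtain ⟨h3, h4⟩ := List.getElem?_eq_some_iff.1 h2
      rw [h4]
  · rw [List.map_append, List.map_singleton, List.nodup_append]
    refine ⟨hJ.nodup, List.nodup_singleton _, ?_⟩
    intro C hC C' hC' hCC'
    obtain ⟨x, hx, rfl⟩ := List.mem_map.1 hC
    rw [List.mem_singleton] at hC'
    -- An equal earlier cycle would contain an exhausted arc, whereas all arcs of the new one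
    -- carried flow.
    obtain ⟨a, b, hab, hz⟩ := hJ.dead x hx
    rw [hCC', hC'] at hab
    obtain ⟨i, hi, hi'⟩ := (cycleHasArc_coe_iff (l := l) (by omega) a b).1 hab
    have := harc i hi a b hi'
    rw [hg, hz] at this
    exact lt_irrefl _ this
  · intro x hx
    rcases List.mem_append.1 hx with hx | hx
    · exact hJ.dicycle x hx
    · rw [List.mem_singleton] at hx; subst hx; exact hcyc
  · intro x hx
    rcases List.mem_append.1 hx with hx | hx
    · exact hJ.pos x hx
    · rw [List.mem_singleton] at hx; subst hx; exact hρ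
  · intro x hx
    rcases List.mem_append.1 hx with hx | hx
    · obtain ⟨a, b, hab, hz⟩ := hJ.dead x hx
      have h1 := hg'nn a b
      rw [hg, hz] at h1
      exact ⟨a, b, hab, le_antisymm h1.2 h1.1⟩
    · rw [List.mem_singleton] at hx; subst hx
      exact ⟨a₀, b₀, hhas₀, hz₀⟩

def decomposeTime (B : ℕ) : ℕ :=
  forTime B (forTime B 1) + (forTime B (forTime B 1) + (1 + forTime B (forTime B
    (1 + (B * B * (extractTime B + 1) + 1)))))

theorem DecInv.putNV {σ : State} {G : Fin n → Fin n → ℝ} {L : List (List (Fin n) × ℝ)}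
    (h : DecInv I G L σ) (x k : ℕ) (h0 : (0 == x) = false) (h3 : (3 == x) = false) :
    DecInv I G L (σ.putNV x k) := by
  have h0' : (0 : ℕ) ≠ x := by simpa using h0
  have h3' : (3 : ℕ) ≠ x := by simpa using h3
  refine ⟨h.market.congr (by simp [h0']) rfl rfl rfl, h.lower, h.upper, h.nonneg, h.supp, h.sum,
    ⟨by simpa [h3'] using h.out.1, h.out.2⟩, h.nodup, h.dicycle, h.pos, h.dead⟩

/-- Extraction only lowers the flow, so arcs once exhausted stay so; after the last arc nothing is
left and the listed cycles account for the whole flow. The zero array 7 serves to clear both bounds.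
-/
theorem decompose_spec {σ : State} {B : ℕ} (hB : n ≤ B) (hI : HasMarket I σ)
    (hf : I.Feas (mat n σ 3)) (h7 : mat n σ 7 = 0) :
    Runs decompose σ (decomposeTime B) (fun σ' => ∃ (E : Exchange I) (L : _),
      E.ListedBy L ∧ Outputs σ' L ∧ E.flow = mat n σ 3) := by
  refine Runs.seq ((copyMat_spec (n := n) rfl hB hI.size).imp fun σ₁ hF₁ hc₁ _ => ?_)
  have hI₁ := hI.frame hF₁
  refine Runs.seq ((copyMat_spec (n := n) rfl hB hI₁.size).imp fun σ₂ hF₂ hc₂ _ => ?_)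
  have hI₂ := hI₁.frame hF₂
  refine Runs.setNV_seq ?_
  set G := mat n σ 3 with hG
  have m3 : mat n σ₂ 3 = G := (mat_congr (hF₂.ra 3 rfl)).trans (mat_congr (hF₁.ra 3 rfl))
  set σ₃ := σ₂.putNV 3 ((NExp.const 0).eval σ₂) with hσ₃
  have hinit : DecInv I G [] σ₃ := by
    constructor
    · exact hI₂.congr rfl rfl rfl rfl
    · change mat n σ₂ 4 = 0
      rw [mat_congr (hF₂.ra 4 rfl), hc₁, h7]
    · change mat n σ₂ 5 = 0
      rw [hc₂, mat_congr (hF₁.ra 7 rfl), h7]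
    · change ∀ a b, 0 ≤ mat n σ₂ 3 a b
      rw [m3]; exact hf.nonneg
    · change ∀ a b, b ∉ I.pref a → mat n σ₂ 3 a b = 0
      rw [m3]; exact fun a b hab => hf.eq_zero hab
    · change ∀ a b, G a b = mat n σ₂ 3 a b + listFlow [] a b
      rw [m3]; simp [listFlow]
    · exact ⟨by simp [hσ₃], by simp⟩
    · simp
    · simp
    · simp
    · simp
  refine Runs.for_loop n hB (fun v σ' => (∃ L, DecInv I G L σ') ∧
    ∀ a b, ArcsBefore I v 0 a b → mat n σ' 3 a b = 0) rfl
    ⟨⟨[], hinit.putNV 13 0 rfl rfl⟩, fun a b h => absurd h (arcsBefore_zero a b)⟩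
    (fun i σ' hF hJ => by obtain ⟨⟨L, hJ⟩, -⟩ := hJ; exact hJ.market.size) ?_ ?_
  · rintro v hv σ₄ hF₄ ⟨⟨L₄, hJ₄⟩, hz₄⟩ hv₄
    obtain ⟨v, rfl⟩ : ∃ v' : Fin n, v = v' := ⟨⟨v, hv⟩, rfl⟩
    refine Runs.for_loop (I.pref v).length ((pref_length_le I v).trans hB)
      (fun i σ' => (∃ L, DecInv I G L σ') ∧
        ∀ a b, ArcsBefore I v i a b → mat n σ' 3 a b = 0) rfl
      ⟨⟨L₄, hJ₄.putNV 14 0 rfl rfl⟩, hz₄⟩ ?_ ?_ ?_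
    · rintro i σ' hF ⟨⟨L, hJ⟩, -⟩
      have h13 : σ'.nv 13 = v := (hF.nv 13 rfl).trans hv₄
      simpa [h13] using hJ.market.deg v
    · rintro i hi σ₅ hF₅ ⟨⟨L₅, hJ₅⟩, hz₅⟩ hv₅
      have h13 : σ₅.nv 13 = v := (hF₅.nv 13 rfl).trans hv₄
      have hp := hJ₅.market.pref v i hi
      refine Runs.setNV_seq ?_
      simp only [NExp.eval, h13, hv₅, hp]
      set u := (I.pref v)[i] with hu
      set σ₆ := σ₅.putNV 15 u with hσ₆
      have h13₆ : σ₆.nv 13 = v := by simp [hσ₆, h13]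
      have h15₆ : σ₆.nv 15 = u := by simp [hσ₆]
      refine Runs.mono (T := n * n * (extractTime B + 1) + 1) (Runs.while_loop
        (fun k σ' => posCount (mat n σ' 3) ≤ k ∧ (∃ L, DecInv I G L σ') ∧
          ∀ a b, ArcsBefore I v i a b → mat n σ' 3 a b = 0) (n * n)
        ⟨posCount_le _, ⟨L₅, hJ₅.putNV 15 u rfl rfl⟩, hz₅⟩ ?_ ?_
        (Q := fun σ' => (∃ L, DecInv I G L σ') ∧
          ∀ a b, ArcsBefore I v (i + 1) a b → mat n σ' 3 a b = 0)) (by gcongr) ?_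
      · rintro k - σ₇ hF₇ ⟨hk, ⟨L₇, hJ₇⟩, hz₇⟩ hb
        have h13₇ : σ₇.nv 13 = v := (hF₇.nv 13 rfl).trans h13₆
        have h15₇ : σ₇.nv 15 = u := (hF₇.nv 15 rfl).trans h15₆
        simp only [BExp.Holds, NExp.eval, RExp.eval, rzero_eval, h13₇, h15₇, not_le] at hb
        refine (extract_spec hB hf.circ hJ₇ h13₇ h15₇ hb).imp ?_
        rintro σ₈ hF₈ ⟨⟨L₈, hJ₈⟩, hle, hcnt⟩ -
        exact ⟨posCount (mat n σ₈ 3), by omega, le_rfl, ⟨L₈, hJ₈⟩, fun a b hab =>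
          le_antisymm ((hle a b).trans (hz₇ a b hab).le) (hJ₈.nonneg a b)⟩
      · rintro k - σ₇ hF₇ ⟨hk, ⟨L₇, hJ₇⟩, hz₇⟩ hb
        have h13₇ : σ₇.nv 13 = v := (hF₇.nv 13 rfl).trans h13₆
        have h15₇ : σ₇.nv 15 = u := (hF₇.nv 15 rfl).trans h15₆
        simp only [BExp.Holds, NExp.eval, RExp.eval, rzero_eval, h13₇, h15₇, not_not] at hb
        refine ⟨⟨L₇, hJ₇⟩, fun a b hab => ?_⟩
        rcases (arcsBefore_succ hi a b).1 hab with hab | ⟨rfl, rfl⟩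
        · exact hz₇ a b hab
        · exact le_antisymm hb (hJ₇.nonneg _ _)
      · rintro σ₇ _ ⟨⟨L₇, hJ₇⟩, hz₇⟩ -
        exact ⟨⟨L₇, hJ₇.putNV 14 _ rfl rfl⟩, hz₇⟩
    · rintro σ₅ _ ⟨⟨L₅, hJ₅⟩, hz₅⟩ -
      exact ⟨⟨L₅, hJ₅.putNV 13 _ rfl rfl⟩, fun a b hab => hz₅ a b ((arcsBefore_next v a b).1 hab)⟩
  · rintro σ₄ _ ⟨⟨L, hJ⟩, hz⟩
    have hG' : ∀ a b, G a b = listFlow L a b := by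
      intro a b
      rw [hJ.sum a b]
      by_cases hab : b ∈ I.pref a
      · rw [hz a b ((arcsBefore_all a b).2 hab), zero_add]
      · rw [hJ.supp a b hab, zero_add]
    obtain ⟨E, hE⟩ := Exchange.exists_of_list L hJ.nodup hJ.dicycle hJ.pos fun a b hab => by
      rw [← hG']
      have := hf.le_cap a b
      rwa [Market.capM, if_pos (show b ∈ I.pref a from hab)] at this
    exact ⟨E, L, hE, hJ.out, by funext a b; rw [hE.flow_eq, hG']⟩

end RealRAM

/-! ### The complete program -/

namespace RealRAM

variable {n : ℕ} {I : Market n} {L : List (List (Fin n) × ℝ)}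

/-- Copy the listing to the output area. -/
def copyOut : Stmt :=
  .setNV 3 (.var 1) ;;
  forLoop 13 (.var 1)
    (.setNA 4 (.var 13) (.const 0) (.get 2 (.var 13) (.const 0)) ;;
    .setRA 2 (.var 13) (.const 0) (.get 1 (.var 13) (.const 0)) ;;
    forLoop 14 (.get 2 (.var 13) (.const 0))
      (.setNA 5 (.var 13) (.var 14) (.get 3 (.var 13) (.var 14))))

/-- The first `m` cycles of `L` are in the output area. -/
def RowsOut (L : List (List (Fin n) × ℝ)) (m : ℕ) (σ : State) : Prop :=
  ∀ (k : ℕ) (hk : k < L.length), k < m →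
    σ.na 4 k 0 = L[k].1.length ∧ σ.ra 2 k 0 = L[k].2 ∧
    ∀ (i : ℕ) (hi : i < L[k].1.length), σ.na 5 k i = (L[k].1[i] : Fin n).val

theorem copyOut_spec {σ : State} {B : ℕ} (hK : L.length ≤ B) (hB : n ≤ B)
    (hnd : ∀ x ∈ L, x.1.Nodup) (hL : HasList L σ) :
    Runs copyOut σ (1 + forTime B (1 + (1 + forTime B 1))) (fun σ' => Outputs σ' L) := by
  refine Runs.setNV_seq ?_
  set σ₀ := σ.putNV 3 ((NExp.var 1).eval σ) with hσ₀
  have hL₀ : HasList L σ₀ := hL.congr rfl rfl rfl rfl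
  refine Runs.for_loop L.length hK (fun m σ' => RowsOut L m σ') rfl (fun k hk hk0 => by omega)
    (fun i σ' hF _ => (hL₀.frame hF).count) ?_ ?_
  · intro m hm σ₁ hF₁ hJ₁ hv₁
    have hL₁ := hL₀.frame hF₁
    refine Runs.setNA_seq (Runs.setRA_seq ?_)
    simp only [NExp.eval, RExp.eval, putNA_nv, putNA_ra, hv₁, hL₁.len m hm, hL₁.amount m hm]
    set σ₂ := (σ₁.putNA 4 m 0 L[m].1.length).putRA 2 m 0 L[m].2 with hσ₂
    have hL₂ : HasList L σ₂ := by
      refine hL₁.congr rfl ?_ ?_ ?_ <;> (funext i j; simp [hσ₂])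
    have h13₂ : σ₂.nv 13 = m := hv₁
    have hlen : L[m].1.length ≤ B := by
      refine le_trans ?_ hB
      simpa using (hnd _ (List.getElem_mem hm)).length_le_card
    refine Runs.for_loop L[m].1.length hlen (fun j σ' => RowsOut L m σ' ∧
      ∀ (i : ℕ) (hi : i < L[m].1.length), i < j → σ'.na 5 m i = (L[m].1[i] : Fin n).val) rfl
      ⟨?_, fun i hi hi0 => by omega⟩ (fun i σ' hF _ => ?_) ?_ ?_
    · intro k hk hkm
      have := hJ₁ k hk hkm
      simpa [hσ₂, hkm.ne] using this
    · have h13 : σ'.nv 13 = m := (hF.nv 13 rfl).trans h13₂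
      simpa [h13] using (hL₂.frame hF).len m hm
    · rintro j hj σ₃ hF₃ ⟨hJ₃, hJ₃'⟩ hv₃
      have h13 : σ₃.nv 13 = m := (hF₃.nv 13 rfl).trans h13₂
      have hx := (hL₂.frame hF₃).vert m hm j hj
      refine Runs.setNA fun _ => ⟨?_, ?_⟩
      · intro k hk hkm
        simpa [h13, hkm.ne] using hJ₃ k hk hkm
      · intro i hi hij
        rcases Nat.lt_succ_iff_lt_or_eq.1 hij with hij | rfl
        · simpa [h13, hv₃, hij.ne] using hJ₃' i hi hij
        · simp [h13, hv₃, hx]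
    · rintro σ₃ hF₃ ⟨hJ₃, hJ₃'⟩ - k hk hkm
      rcases Nat.lt_succ_iff_lt_or_eq.1 hkm with hkm | rfl
      · exact hJ₃ k hk hkm
      · refine ⟨?_, ?_, fun i hi => hJ₃' i hi hi⟩
        · change σ₃.na 4 k 0 = _
          rw [hF₃.na 4 rfl]; simp [hσ₂]
        · change σ₃.ra 2 k 0 = _
          rw [hF₃.ra 2 rfl]; simp [hσ₂]
  · intro σ' hF h
    refine ⟨?_, fun k hk => h k hk hk⟩
    rw [hF.nv 3 rfl, hσ₀]
    simpa using hL.count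

/-- Decide Pareto optimality and improve the given exchange to a Pareto optimal one. -/
def improve : Stmt :=
  sumCycles ;; copyMat 5 0 ;; copyMat 3 6 ;; initLower ;; findTops ;; decideTops ;;
  .ite (.nle (.const 1) (.var 2)) copyOut (maximizeAll ;; decompose)

def improveTime (B : ℕ) : ℕ :=
  forTime B (forTime B 4) + (forTime B (forTime B 1) + (forTime B (forTime B 1) +
    (forTime B 2 + (findTopsTime B + (1 + forTime B 4 +
      (max (1 + forTime B (1 + (1 + forTime B 1))) (maximizeAllTime B + decomposeTime B) + 1))))))

theorem improve_spec {B : ℕ} (hB : n ≤ B) (hK : L.length ≤ B) (E : Exchange I)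
    (hE : E.ListedBy L) :
    Runs improve (inputState I L) (improveTime B) (fun σ =>
      (answer σ = 1 ∧ E.ParetoOptimal ∧ Outputs σ L) ∨
      (answer σ = 0 ∧ ∃ (E' : Exchange I) (L' : List (List (Fin n) × ℝ)),
        E'.ListedBy L' ∧ Outputs σ L' ∧ E'.Dominates E ∧ E'.ParetoOptimal)) := by
  have hnd : ∀ x ∈ L, x.1.Nodup := fun x hx =>
    (isDicycle_coe (E.isDicycle _ ((hE.2.1 _).2 ⟨x, hx, rfl⟩))).1
  set f := E.flow with hfdef
  have hf : I.Feas f := E.flow_feas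
  have hfl : f = listFlow L := by funext v u; exact hE.flow_eq v u
  set σ₀ := inputState I L with hσ₀
  have hI₀ : HasMarket I σ₀ := hasMarket_inputState
  have hL₀ : HasList L σ₀ := hasList_inputState
  -- Memory outside the input starts at zero; the summation of the cycles, the initial lower bounds
  -- and the final clearing rely on it.
  have hz : ∀ a, 2 ≤ a → mat n σ₀ a = 0 := by
    intro a ha
    funext v u
    have h0 : a ≠ 0 := by omega
    have h1 : a ≠ 1 := by omega
    simp [hσ₀, mat, inputState, h0, h1]
  have h8₀ : vec n σ₀ 8 = 0 := by
    funext v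
    simp [hσ₀, vec, inputState]
  refine Runs.seq ((sumCycles_spec hK hB hnd hL₀ (by simp [hz 6])).imp fun σ₁ hF₁ h6 _ => ?_)
  have hI₁ := hI₀.frame hF₁
  refine Runs.seq ((copyMat_spec (n := n) rfl hB hI₁.size).imp fun σ₂ hF₂ hc₂ _ => ?_)
  have hI₂ := hI₁.frame hF₂
  refine Runs.seq ((copyMat_spec (n := n) rfl hB hI₂.size).imp fun σ₃ hF₃ hc₃ _ => ?_)
  have hI₃ := hI₂.frame hF₃
  have m4 : mat n σ₃ 4 = 0 := by
    rw [mat_congr (hF₃.ra 4 rfl), mat_congr (hF₂.ra 4 rfl), mat_congr (hF₁.ra 4 rfl), hz 4 (by simp)]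
  refine Runs.seq ((initLower_spec hB hI₃ (by simp [m4])).imp fun σ₄ hF₄ h4 _ => ?_)
  have hI₄ := hI₃.frame hF₄
  have m6₂ : mat n σ₂ 6 = f := by rw [mat_congr (hF₂.ra 6 rfl), h6, hfl]
  have m6₃ : mat n σ₃ 6 = f := by rw [mat_congr (hF₃.ra 6 rfl), m6₂]
  have m6₄ : mat n σ₄ 6 = f := by rw [mat_congr (hF₄.ra 6 rfl), m6₃]
  have m3₄ : mat n σ₄ 3 = f := by rw [mat_congr (hF₄.ra 3 rfl), hc₃, m6₂]
  have m5₄ : mat n σ₄ 5 = I.capM := by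
    rw [mat_congr (hF₄.ra 5 rfl), mat_congr (hF₃.ra 5 rfl), hc₂, hI₁.cap]
  have v8₄ : vec n σ₄ 8 = 0 := by
    rw [vec_congr (hF₄.na 8 rfl), vec_congr (hF₃.na 8 rfl), vec_congr (hF₂.na 8 rfl),
      vec_congr (hF₁.na 8 rfl), h8₀]
  refine Runs.seq ((findTops_spec hB hf hI₄ m3₄ m6₄ v8₄ (by rw [h4, m6₃]) m5₄).imp ?_)
  rintro σ₅ hF₅ ⟨hW, himp⟩ -
  refine Runs.seq ((decideTops_spec hB hW).imp ?_)
  rintro σ₆ hF₆ ⟨hlow, hans⟩ -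
  have hL₆ : HasList L σ₆ :=
    (((((hL₀.frame hF₁).frame hF₂).frame hF₃).frame hF₄).frame hF₅).frame hF₆
  have hI₆ : HasMarket I σ₆ := hW.market.frame hF₆
  set τ := vec n σ₅ 8 with hτ
  set g := mat n σ₅ 3 with hg
  have m3₆ : mat n σ₆ 3 = g := mat_congr (hF₆.ra 3 rfl)
  have m5₆ : mat n σ₆ 5 = I.upperB f τ := (mat_congr (hF₆.ra 5 rfl)).trans hW.upper
  refine Runs.ite (fun hb => ?_) (fun hb => ?_)
  · simp only [BExp.Holds, NExp.eval] at hb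
    obtain ⟨h2, hall⟩ : σ₆.nv 2 = 1 ∧ ∀ v, (I.pref v).length ≤ τ v := by
      rcases hans with h | h
      · exact h
      · omega
    refine (copyOut_spec hK hB hnd hL₆).imp fun σ₇ hF₇ hout => .inl ⟨?_, ?_, hout⟩
    · exact (hF₇.nv 2 rfl).trans h2
    · rintro E' ⟨hw, v, hv⟩
      exact hW.frozen.no_improvement hall E'.flow_feas hw v hv
  · simp only [BExp.Holds, NExp.eval] at hb
    obtain ⟨h2, v₀, hv₀⟩ : σ₆.nv 2 = 0 ∧ ∃ v, τ v < (I.pref v).length := by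
      rcases hans with h | h
      · omega
      · exact h
    have hbg : ∀ a b, I.lowerB f τ a b ≤ g a b ∧ g a b ≤ I.upperB f τ a b := by
      have := hW.bounds
      rwa [hW.lower, hW.upper] at this
    have hgnn : ∀ a b, 0 ≤ g a b := fun a b => le_trans (by
      unfold Market.lowerB
      split_ifs
      · exact hf.nonneg a b
      · exact le_rfl) (hbg a b).1
    have hlt : ∀ v (hv : τ v < (I.pref v).length),
        f v (I.pref v)[τ v] < g v (I.pref v)[τ v] := fun v hv =>
      himp v _ (List.getElem?_eq_getElem hv)
    refine Runs.seq ((maximizeAll_spec hB hI₆ (by rw [m3₆]; exact hW.circ) ?_).imp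
      fun σ₇ hF₇ hseq _ => ?_)
    · rw [hlow, m3₆, m5₆]
      exact Market.improvedB_bounds hbg
    rw [hlow, m5₆] at hseq
    have hI₇ := hI₆.frame hF₇
    have hfeas : I.Feas (mat n σ₇ 3) :=
      Market.feas_of_improvedB hf hgnn hseq.circ hseq.bounds₀
    have m7 : mat n σ₇ 7 = 0 := by
      rw [mat_congr (hF₇.ra 7 rfl), mat_congr (hF₆.ra 7 rfl), mat_congr (hF₅.ra 7 rfl),
        mat_congr (hF₄.ra 7 rfl), mat_congr (hF₃.ra 7 rfl), mat_congr (hF₂.ra 7 rfl),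
        mat_congr (hF₁.ra 7 rfl), hz 7 (by simp)]
    refine (decompose_spec hB hI₇ hfeas m7).imp ?_
    rintro σ₈ hF₈ ⟨E', L', hE', hout, hflow⟩
    refine .inr ⟨?_, E', L', hE', hout, ⟨?_, v₀, ?_⟩, ?_⟩
    · exact ((hF₈.nv 2 rfl).trans (hF₇.nv 2 rfl)).trans h2
    · intro v
      rw [Exchange.prefers_iff, hflow]
      exact Market.not_prefersM_of_improvedB hseq.bounds₀ hlt v
    · rw [Exchange.prefers_iff, hflow]
      exact Market.prefersM_of_improvedB hseq.bounds₀ hv₀ (hlt v₀ hv₀)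
    · rintro E'' ⟨hw, v, hv⟩
      simp only [Exchange.prefers_iff, hflow] at hw hv
      exact hseq.no_improvement hW.frozen (fun v u hu => hu) hlt E''.flow_feas hw v hv

/-! ### The running time is polynomial -/

/-- `T` is bounded by a polynomial. -/
def PolyBounded (T : ℕ → ℕ) : Prop := ∃ p : Polynomial ℕ, ∀ B, T B ≤ p.eval B

namespace PolyBounded

variable {S T : ℕ → ℕ}

theorem const (c : ℕ) : PolyBounded fun _ => c := ⟨Polynomial.C c, by simp⟩

theorem id : PolyBounded fun B => B := ⟨Polynomial.X, by simp⟩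

theorem add (hS : PolyBounded S) (hT : PolyBounded T) : PolyBounded fun B => S B + T B := by
  obtain ⟨p, hp⟩ := hS
  obtain ⟨q, hq⟩ := hT
  exact ⟨p + q, fun B => by rw [Polynomial.eval_add]; exact add_le_add (hp B) (hq B)⟩

theorem mul (hS : PolyBounded S) (hT : PolyBounded T) : PolyBounded fun B => S B * T B := by
  obtain ⟨p, hp⟩ := hS
  obtain ⟨q, hq⟩ := hT
  exact ⟨p * q, fun B => by rw [Polynomial.eval_mul]; exact Nat.mul_le_mul (hp B) (hq B)⟩

theorem max (hS : PolyBounded S) (hT : PolyBounded T) :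
    PolyBounded fun B => Max.max (S B) (T B) := by
  obtain ⟨p, hp⟩ := hS.add hT
  exact ⟨p, fun B => (max_le (Nat.le_add_right _ _) (Nat.le_add_left _ _)).trans (hp B)⟩

theorem forTime (hT : PolyBounded T) : PolyBounded fun B => RealRAM.forTime B (T B) :=
  (const 1).add ((id.mul ((hT.add (const 1)).add (const 1))).add (const 1))

theorem searchTime : PolyBounded RealRAM.searchTime :=
  (const 1).forTime.add ((const 1).add (const 3).forTime.forTime.forTime)

/-- Here 9 stands for 8 + 1; closed sums in the time bounds match numerals by evaluation. -/
theorem augmentTime : PolyBounded RealRAM.augmentTime :=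
  ((const 1).add ((const 1).add (((id.mul (const 9)).add (const 1)).add (const 1)))).add
    ((const 1).add (const 4).forTime)

theorem maximizeTime : PolyBounded RealRAM.maximizeTime := by
  have h : PolyBounded RealRAM.maximizeStepTime := searchTime.add (((const 1).max ((const 1).add
    (augmentTime.add (const 4)))).add (const 1))
  have h' : PolyBounded fun B =>
      (B * (B * (B + B)) + 1) * (RealRAM.maximizeStepTime B + 1) + 1 :=
    ((((id.mul (id.mul (id.add id))).add (const 1)).mul (h.add (const 1))).add (const 1))
  exact (const 1).add ((const 1).add ((const 1).add ((const 1).add ((const 1).add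
    ((const 1).add h')))))

theorem findTopsTime : PolyBounded RealRAM.findTopsTime := by
  have h₁ : PolyBounded RealRAM.freezeArcTime := (const 1).add ((const 1).add
    ((const 3).add ((const 1).forTime.forTime.add (const 1))))
  have h₂ : PolyBounded RealRAM.tryArcTime := (const 1).add ((const 1).add ((const 1).add
    (searchTime.add (((augmentTime.add (const 2)).max h₁).add (const 1)))))
  have h₃ : PolyBounded RealRAM.topStepTime := ((const 1).max ((const 1).add
    (((const 1).max h₂).add (const 1)))).add (const 1)
  exact (const 1).add (((((id.add (const 1)).mul (id.mul id)).add id).mul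
    (h₃.add (const 1))).add (const 1))

theorem decomposeTime : PolyBounded RealRAM.decomposeTime := by
  have h : PolyBounded RealRAM.extractTime := (const 1).add ((const 1).add (searchTime.add
    ((const 1).add (augmentTime.add (const 4)))))
  have h' : PolyBounded fun B => 1 + (B * B * (RealRAM.extractTime B + 1) + 1) :=
    (const 1).add (((id.mul id).mul (h.add (const 1))).add (const 1))
  exact (const 1).forTime.forTime.add ((const 1).forTime.forTime.add ((const 1).add
    h'.forTime.forTime))

theorem improveTime : PolyBounded RealRAM.improveTime := by
  have h₁ : PolyBounded RealRAM.maximizeAllTime := ((const 1).add maximizeTime).forTime.forTime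
  have h₂ : PolyBounded fun B => 1 + RealRAM.forTime B (1 + (1 + RealRAM.forTime B 1)) :=
    (const 1).add ((const 1).add ((const 1).add (const 1).forTime)).forTime
  exact (const 4).forTime.forTime.add ((const 1).forTime.forTime.add ((const 1).forTime.forTime.add
    ((const 2).forTime.add (findTopsTime.add (((const 1).add (const 4).forTime).add
      ((h₂.max (h₁.add decomposeTime)).add (const 1)))))))

end PolyBounded

end RealRAM

theorem size_le_inputSize {n : ℕ} (I : Market n) (L : List (List (Fin n) × ℝ)) :
    n ≤ inputSize I L := by
  unfold inputSize; omega

theorem length_le_inputSize {n : ℕ} (I : Market n) (L : List (List (Fin n) × ℝ)) :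
    L.length ≤ inputSize I L := by
  have h : L.length ≤ (L.map (fun x => x.1.length + 1)).sum := by
    induction L with
    | nil => simp
    | cons x L ih => simp only [List.length_cons, List.map_cons, List.sum_cons]; omega
  unfold inputSize; omega

theorem corollary1 :
    ∃ (P : RealRAM.Stmt) (p : Polynomial ℕ),
      ∀ (n : ℕ) (I : Market n) (E : Exchange I) (L : List (List (Fin n) × ℝ)),
        E.ListedBy L → E.Maximal → E.TradeInFree →
        ∃ (t : ℕ) (σ : RealRAM.State),
          RealRAM.Exec P (inputState I L) t σ ∧
          t ≤ p.eval (inputSize I L) ∧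
          (E.ParetoOptimal → answer σ = 1 ∧ Outputs σ L) ∧
          (¬ E.ParetoOptimal → answer σ = 0 ∧
            ∃ (E' : Exchange I) (L' : List (List (Fin n) × ℝ)),
              E'.ListedBy L' ∧ Outputs σ L' ∧ E'.Dominates E ∧ E'.ParetoOptimal) := by
  obtain ⟨p, hp⟩ := PolyBounded.improveTime
  refine ⟨improve, p, fun n I E L hE _ _ => ?_⟩
  obtain ⟨t, σ, hexec, ht, hpost⟩ :=
    improve_spec (size_le_inputSize I L) (length_le_inputSize I L) E hE
  refine ⟨t, σ, hexec, ht.trans (hp _), fun hpo => ?_, fun hpo => ?_⟩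
  · rcases hpost with ⟨h1, -, h2⟩ | ⟨-, E', -, -, -, hd, -⟩
    · exact ⟨h1, h2⟩
    · exact absurd hd (hpo E')
  · rcases hpost with ⟨-, h, -⟩ | h
    · exact absurd h hpo
    · exact h
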